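/- **Theorem.** Let $\Omega=(-1,1)^2$ be divided into the four squares $\Omega_1=(-1,0)\times(-1,0)$, $\Omega_2=(0,1)\times(-1,0)$, $\Omega_3=(0,1)\times(0,1)$, $\Omega_4=(-1,0)\times(0,1)$, let $\Gamma_{ij}$ be the open interface between adjacent squares, $\Gamma$ the union of the closed interfaces, $\partial\Omega_i^0=\partial\Omega_i\cap\partial\Omega$, and $n_i$ the outward unit normal of $\Omega_i$. Let $f\in L^2(\Omega)$ and $g\in H^{3/2}(\partial\Omega)$ (that is, $g$ is the trace of a function in $H^2(\Omega)$), and let $u^0\in H^2(\Omega)$, $\psi^0\in H^2(\Omega)\cap H^1_0(\Omega)$ with $u^0=g$ on $\partial\Omega\cap\Gamma$. For a function $h$ let $h_o(x,y)=\frac12\big(h(x,y)-h(-x,-y)\big)$ be its odd symmetric part, and let $u_o$ be the solution of $-\Delta u_o=f_o$ in $\Omega$, $u_o=g_o$ on $\partial\Omega$. Let $\theta\in(0,\frac12)$. The mixed Neumann-Neumann method for this problem starts from $u_i^0=u^0_o|_{\Omega_i}$, $\psi_i^0=\psi^0_o|_{\Omega_i}$; for $k\ge 1$ it solves, for each $i\in\{1,2,3,4\}$,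 first $$-\Delta u_i^k=f_o \text{ in }\Omega_i,\qquad u_i^k=g_o\text{ on }\partial\Omega_i^0,$$ $$u_i^k=u_i^{k-1}-\theta\big(\psi_i^{k-1}+\psi_j^{k-1}\big)\quad\text{on every }\Gamma_{ij}\in\{\Gamma_{23},\Gamma_{41}\},$$ $$\partial_{n_i}u_i^k=\partial_{n_i}u_i^{k-1}-\theta\big(\partial_{n_i}\psi_i^{k-1}+\partial_{n_i}\psi_j^{k-1}\big)\quad\text{on every }\Gamma_{ij}\in\{\Gamma_{12},\Gamma_{34}\},$$ and then $$-\Delta \psi_i^k=0 \text{ in }\Omega_i,\qquad \psi_i^k=0\text{ on }\partial\Omega_i^0,$$ $$\psi_i^k=u_i^k-u_j^k\quad\text{on every }\Gamma_{ij}\in\{\Gamma_{12},\Gamma_{34}\},$$ $$\partial_{n_i}\psi_i^k=\partial_{n_i}u_i^k+\partial_{n_j}u_j^k\quad\text{on every }\Gamma_{ij}\in\{\Gamma_{23},\Gamma_{41}\},$$ where solutions are weak solutions in $H^1(\Omega_i)$. Then each of these local problems has exactly one solution, so that the method produces a sequence $(u^k)_k$, $u^k|_{\Omega_i}=u_i^k$.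 Its errors $e^k=u_o-u^k$ satisfy $$e^k=(1-4\theta)^{k-1}e^1\quad\text{a.e. in }\Omega\setminus\Gamma,\qquad k\ge1 .$$ Hence $u^k$ converges geometrically to $u_o$, with convergence factor $|1-4\theta|<1$, both in the norm of $L^2(\Omega)$ and in the broken $H^1$ norm $\sum_i\|\cdot\|_{H^1(\Omega_i)}$: each of these two norms of $e^k$ equals $|1-4\theta|^{k-1}$ times that of $e^1$. In particular, for $\theta=\frac14$ the method is a direct solver: $u^k=u_o$ for all $k\ge2$. -/

import Mathlib

open Set Filter Topology MeasureTheory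
open scoped ContDiff

noncomputable section

namespace MixedNNM

/-! ### Geometry -/

/-- The square `Ω = (-1,1) × (-1,1)`. -/
def Omega : Set (ℝ × ℝ) := Ioo (-1) 1 ×ˢ Ioo (-1) 1

/-- The open quadrants, numbered counterclockwise from the lower left one.  The subdomains
`Ω₁, Ω₂, Ω₃, Ω₄` carry the indices `0, 1, 2, 3 : Fin 4`. -/
def quadrant : Fin 4 → Set (ℝ × ℝ) :=
  ![Iio 0 ×ˢ Iio 0, Ioi 0 ×ˢ Iio 0, Ioi 0 ×ˢ Ioi 0, Iio 0 ×ˢ Ioi 0]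

/-- The four open square subdomains. -/
def sub (i : Fin 4) : Set (ℝ × ℝ) := Omega ∩ quadrant i

/-- The skeleton `Γ`, the union of the closed interfaces. -/
def skeleton : Set (ℝ × ℝ) := {p | p ∈ closure Omega ∧ (p.1 = 0 ∨ p.2 = 0)}

/-- For adjacent subdomains, the open rectangle `Ω_i ∪ Γ_ij ∪ Ω_j`. -/
def patch (i j : Fin 4) : Set (ℝ × ℝ) := interior (closure (sub i ∪ sub j))

/-- The centres of the subdomains. -/
def centre : Fin 4 → ℝ × ℝ :=
  ![(-1 / 2, -1 / 2), (1 / 2, -1 / 2), (1 / 2, 1 / 2), (-1 / 2, 1 / 2)]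

/-- The unit normal `n_i` on `Γ_ij`, pointing from `Ω_i` to the adjacent `Ω_j`.  (The centres of
adjacent subdomains are at distance one and their difference is orthogonal to `Γ_ij`.) -/
def normal (i j : Fin 4) : ℝ × ℝ := centre j - centre i

/-- The ordered pairs `(i, j)` for which `Γ_ij` is one of the vertical interfaces
`Γ₁₂`, `Γ₃₄`. -/
def verticalInterfaces : Set (Fin 4 × Fin 4) := {(0, 1), (1, 0), (2, 3), (3, 2)}

/-- The ordered pairs `(i, j)` for which `Γ_ij` is one of the horizontal interfaces
`Γ₂₃`, `Γ₄₁`. -/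
def horizontalInterfaces : Set (Fin 4 × Fin 4) := {(1, 2), (2, 1), (3, 0), (0, 3)}

/-- Interfaces with a Dirichlet condition for `u`. -/
def GammaD1 : Set (Fin 4 × Fin 4) := horizontalInterfaces

/-- Interfaces with a Neumann condition for `u`. -/
def GammaN1 : Set (Fin 4 × Fin 4) := verticalInterfaces

/-- Interfaces with a Dirichlet condition for `ψ`. -/
def GammaD2 : Set (Fin 4 × Fin 4) := verticalInterfaces

/-- Interfaces with a Neumann condition for `ψ`. -/
def GammaN2 : Set (Fin 4 × Fin 4) := horizontalInterfaces

/-- The odd symmetric part of a function (with respect to `p ↦ -p`). -/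
def oddPart (h : ℝ × ℝ → ℝ) : ℝ × ℝ → ℝ := fun p => (h p - h (-p)) / 2

/-! ### Sobolev spaces -/

/-- Test functions: `φ ∈ C_c^∞(U)`. -/
def IsTest (U : Set (ℝ × ℝ)) (φ : ℝ × ℝ → ℝ) : Prop :=
  ContDiff ℝ ∞ φ ∧ HasCompactSupport φ ∧ tsupport φ ⊆ U

/-- The classical partial derivative `∂φ/∂x`. -/
def pdx (φ : ℝ × ℝ → ℝ) (p : ℝ × ℝ) : ℝ := fderiv ℝ φ p (1, 0)

/-- The classical partial derivative `∂φ/∂y`. -/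
def pdy (φ : ℝ × ℝ → ℝ) (p : ℝ × ℝ) : ℝ := fderiv ℝ φ p (0, 1)

/-- An element of `H¹(U)`: a representative, together with its weak partial derivatives. -/
structure H1 (U : Set (ℝ × ℝ)) where
  val : ℝ × ℝ → ℝ
  dx : ℝ × ℝ → ℝ
  dy : ℝ × ℝ → ℝ
  memLp_val : MemLp val 2 (volume.restrict U)
  memLp_dx : MemLp dx 2 (volume.restrict U)
  memLp_dy : MemLp dy 2 (volume.restrict U)
  weak_dx : ∀ φ, IsTest U φ → ∫ p in U, val p * pdx φ p = -∫ p in U, dx p * φ p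
  weak_dy : ∀ φ, IsTest U φ → ∫ p in U, val p * pdy φ p = -∫ p in U, dy p * φ p

/-- An element of `H¹(Δ; U)`: an `H¹(U)` function, together with its weak Laplacian, which is
required to lie in `L²(U)`. -/
structure HDelta (U : Set (ℝ × ℝ)) extends H1 U where
  lap : ℝ × ℝ → ℝ
  memLp_lap : MemLp lap 2 (volume.restrict U)
  weak_lap : ∀ φ, IsTest U φ →
    ∫ p in U, (dx p * pdx φ p + dy p * pdy φ p) = -∫ p in U, lap p * φ p

/-- `w ∈ H²(U)`: both weak partial derivatives of `w` are again in `H¹(U)`. -/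
def MemH2 {U : Set (ℝ × ℝ)} (w : H1 U) : Prop :=
  ∃ wx wy : H1 U, wx.val = w.dx ∧ wy.val = w.dy

/-- `g ∈ H^{3/2}(∂Ω)`: `g` is the boundary value of (the continuous representative of) an
`H²(Ω)` function. -/
def MemH32 (g : ℝ × ℝ → ℝ) : Prop :=
  ∃ G : H1 Omega, MemH2 G ∧ ContinuousOn G.val (closure Omega) ∧
    ∀ p ∈ frontier Omega, G.val p = g p

/-! ### Traces and normal derivatives

Traces and normal derivatives are the ones defined by the Gauss-Green formulas, and boundary
conditions are equalities of distributions on the relevant open part of the boundary. -/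

/-- `∫_∂Ω g φ n_x ds`, with `n` the outward unit normal of `Ω`. -/
def boundaryX (g φ : ℝ × ℝ → ℝ) : ℝ :=
  ∫ y in (-1 : ℝ)..1, (g (1, y) * φ (1, y) - g (-1, y) * φ (-1, y))

/-- `∫_∂Ω g φ n_y ds`, with `n` the outward unit normal of `Ω`. -/
def boundaryY (g φ : ℝ × ℝ → ℝ) : ℝ :=
  ∫ x in (-1 : ℝ)..1, (g (x, 1) * φ (x, 1) - g (x, -1) * φ (x, -1))

/-- For `U = Ω ∩ Q` with `Q` open: the trace of `w ∈ H¹(U)` on the part `∂Ω ∩ Q` of `∂U` is `g`,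
that is, `∫_U ∂_k (w φ) = ∫_(∂Ω ∩ Q) g φ n_k ds` for both coordinate directions and for all
`φ ∈ C_c^∞(Q)` (which vanish near the rest of `∂U`). -/
def HasOuterTrace {U : Set (ℝ × ℝ)} (Q : Set (ℝ × ℝ)) (w : H1 U) (g : ℝ × ℝ → ℝ) : Prop :=
  ∀ φ, IsTest Q φ →
    ∫ p in U, (w.val p * pdx φ p + w.dx p * φ p) = boundaryX g φ ∧
    ∫ p in U, (w.val p * pdy φ p + w.dy p * φ p) = boundaryY g φ

/-- The trace of `w ∈ H¹(Ω_i)` on `Γ_ij`, applied to `φ ∈ C_c^∞(Ω_i ∪ Γ_ij ∪ Ω_j)`: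
by the divergence theorem, `∫_(Γ_ij) w φ ds = ∫_(Ω_i) n_i · ∇(w φ)`. -/
def tracePairing {i : Fin 4} (j : Fin 4) (w : H1 (sub i)) (φ : ℝ × ℝ → ℝ) : ℝ :=
  (normal i j).1 * (∫ p in sub i, (w.val p * pdx φ p + w.dx p * φ p)) +
  (normal i j).2 * (∫ p in sub i, (w.val p * pdy φ p + w.dy p * φ p))

/-- The outward normal derivative of `w ∈ H¹(Δ; U)`, applied to `φ`:
by Green's formula, `∫_∂U (∂_n w) φ ds = ∫_U (∇w · ∇φ + (Δw) φ)`.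
For `U = Ω_i` and `φ ∈ C_c^∞(Ω_i ∪ Γ_ij ∪ Ω_j)` it is `∫_(Γ_ij) (∂_(n_i) w) φ ds`. -/
def normalPairing {U : Set (ℝ × ℝ)} (w : HDelta U) (φ : ℝ × ℝ → ℝ) : ℝ :=
  ∫ p in U, (w.dx p * pdx φ p + w.dy p * pdy φ p + w.lap p * φ p)

/-! ### The model problem and the method -/

/-- `-Δu = f` in `Ω`, `u = g` on `∂Ω`. -/
def SolvesDirichlet (f g : ℝ × ℝ → ℝ) (u : HDelta Omega) : Prop :=
  (∀ᵐ p ∂volume.restrict Omega, -u.lap p = f p) ∧ HasOuterTrace univ u.toH1 g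

/-- A couple `(u⁰, ψ⁰)` compatible with the Dirichlet datum `g`: `u⁰ ∈ H²(Ω)` (continuous
representative), `ψ⁰ ∈ H²(Ω) ∩ H¹₀(Ω)` and `u⁰ = g` on `∂Ω ∩ Γ`. -/
def Compatible (g : ℝ × ℝ → ℝ) (u0 psi0 : H1 Omega) : Prop :=
  MemH2 u0 ∧ ContinuousOn u0.val (closure Omega) ∧
  MemH2 psi0 ∧ HasOuterTrace univ psi0 0 ∧
  ∀ p ∈ frontier Omega ∩ skeleton, u0.val p = g p

/-- The first step of the mixed method in `Ω_i`: `w` solves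
* `-Δw = f` in `Ω_i`, `w = g` on `∂Ω_i ∩ ∂Ω`,
* `w = u_i - θ (ψ_i + ψ_j)` on every `Γ_ij ∈ Γ_D^1`,
* `∂_(n_i) w = ∂_(n_i) u_i - θ (∂_(n_i) ψ_i + ∂_(n_i) ψ_j)` on every `Γ_ij ∈ Γ_N^1`.

In the last condition both corrections are differentiated along the same normal `n_i`;
`∂_(n_i) ψ_j = -∂_(n_j) ψ_j`, and the pairing of `ψ_j` is with respect to `n_j`. -/
def FirstStep (f g : ℝ × ℝ → ℝ) (θ : ℝ) (u psi : ∀ i : Fin 4, HDelta (sub i))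
    (i : Fin 4) (w : HDelta (sub i)) : Prop :=
  (∀ᵐ p ∂volume.restrict (sub i), -w.lap p = f p) ∧
  HasOuterTrace (quadrant i) w.toH1 g ∧
  (∀ j, (i, j) ∈ GammaD1 → ∀ φ, IsTest (patch i j) φ →
    tracePairing j w.toH1 φ = tracePairing j (u i).toH1 φ
      - θ * (tracePairing j (psi i).toH1 φ + tracePairing i (psi j).toH1 φ)) ∧
  (∀ j, (i, j) ∈ GammaN1 → ∀ φ, IsTest (patch i j) φ →
    normalPairing w φ = normalPairing (u i) φ
      - θ * (normalPairing (psi i) φ + -normalPairing (psi j) φ))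

/-- The second step of the mixed method in `Ω_i`: `w` solves
* `-Δw = 0` in `Ω_i`, `w = 0` on `∂Ω_i ∩ ∂Ω`,
* `w = u_i - u_j` on every `Γ_ij ∈ Γ_D^2`,
* `∂_(n_i) w = ∂_(n_i) u_i + ∂_(n_j) u_j` on every `Γ_ij ∈ Γ_N^2`. -/
def SecondStep (u : ∀ i : Fin 4, HDelta (sub i)) (i : Fin 4) (w : HDelta (sub i)) : Prop :=
  (∀ᵐ p ∂volume.restrict (sub i), -w.lap p = 0) ∧
  HasOuterTrace (quadrant i) w.toH1 0 ∧
  (∀ j, (i, j) ∈ GammaD2 → ∀ φ, IsTest (patch i j) φ →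
    tracePairing j w.toH1 φ = tracePairing j (u i).toH1 φ - tracePairing i (u j).toH1 φ) ∧
  (∀ j, (i, j) ∈ GammaN2 → ∀ φ, IsTest (patch i j) φ →
    normalPairing w φ = normalPairing (u i) φ + normalPairing (u j) φ)

/-- `(u^k, ψ^k)_k` is generated by the mixed Neumann-Neumann method with relaxation parameter `θ`
for the data `f`, `g`, starting from the functions `u0`, `psi0` on `Ω`. -/
def IsMixedNNM (f g : ℝ × ℝ → ℝ) (θ : ℝ) (u0 psi0 : ℝ × ℝ → ℝ)
    (u psi : ℕ → ∀ i : Fin 4, HDelta (sub i)) : Prop :=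
  (∀ i, (u 0 i).val =ᵐ[volume.restrict (sub i)] u0) ∧
  (∀ i, (psi 0 i).val =ᵐ[volume.restrict (sub i)] psi0) ∧
  ∀ k i, FirstStep f g θ (u k) (psi k) i (u (k + 1) i) ∧
    SecondStep (u (k + 1)) i (psi (k + 1) i)

/-! ### Error norms -/

/-- The `L²(Ω)` norm of `u - v`, where `v` is given piecewise. -/
def errL2 (u : H1 Omega) (v : ∀ i : Fin 4, HDelta (sub i)) : ℝ :=
  √(∑ i, ∫ p in sub i, (u.val p - (v i).val p) ^ 2)

/-- The broken `H¹` norm `∑_i ‖u - v_i‖_{H¹(Ω_i)}`. -/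
def errH1 (u : H1 Omega) (v : ∀ i : Fin 4, HDelta (sub i)) : ℝ :=
  ∑ i, √(∫ p in sub i, ((u.val p - (v i).val p) ^ 2 + (u.dx p - (v i).dx p) ^ 2
    + (u.dy p - (v i).dy p) ^ 2))

end MixedNNM

end

/-!
The iteration is controlled by the symmetry of the error. All data of the problem are odd with
respect to `p ↦ -p`. In the first iteration the Dirichlet data of the error `e` on the horizontal
interfaces and its Neumann data on the vertical ones are those of one odd function
`uo - u⁰ + 2 θ ψ⁰` on the whole square, because a function on `Ω` has the same trace and the same
flux from both sides of an interface. Mirror images of functions with vanishing outer trace and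
vanishing Laplacian have the same properties, so the uniqueness of the solution of the mixed
problem in a subdomain shows that the error is odd with respect to the vertical and even with
respect to the horizontal interfaces (`isOddEven_of_odd`). For such an error the right hand sides
of the second step are twice the data of `-e`, so that `ψ = -2 e` (`SecondStep.eq_err`); the first
step then subtracts `4 θ e` from the error (`FirstStep.err_eq`), and the symmetry is preserved.
The identity for `e` implies the one for its weak gradient, hence the statements on the norms.

The local problems need uniqueness and existence. Since the subdomains are squares, uniqueness
follows by separation of variables: a solution with homogeneous data is orthogonal to the products
of the sine and cosine eigenfunctions, and these are total by the Stone-Weierstrass theorem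
(`ae_eq_zero_of_mixedY`, `ae_eq_zero_of_mixedX`, `ae_eq_zero_of_dirichlet`).
Existence follows from a Poincaré inequality and the Lax-Milgram theorem in the closure of the
test functions which vanish near the Dirichlet boundary (`exists_mixedY`, `exists_mixedX`), once
the Dirichlet data are the trace of an `H¹` function. From the second iteration on such a function
is obtained from the previous iterates by reflection across an interface. For the first iteration
one has to combine the outer values `g` and the interface values `u⁰`, which belong to different
`H²` functions and agree only at the end points of the interfaces. This is done in `exists_lift`:
the difference `q(x)` of the two on the line `y = 0` is an `H¹` function of one variable which
vanishes at the end points, and `(1 - y²) q(x)` corrects the interface values without changing the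
outer ones.
-/

noncomputable section

namespace MixedNNM

/-! ### Cutoff functions -/

/-- A smooth cutoff which vanishes for `t ≤ 1 / n` and equals one for `t ≥ 2 / n`. -/
def cut (n : ℕ) (t : ℝ) : ℝ := Real.smoothTransition (n * t - 1)

lemma cut_contDiff (n : ℕ) : ContDiff ℝ ∞ (cut n) := by
  unfold cut
  exact Real.smoothTransition.contDiff.comp (by fun_prop)

lemma cut_nonneg (n : ℕ) (t : ℝ) : 0 ≤ cut n t := Real.smoothTransition.nonneg _

lemma cut_le_one (n : ℕ) (t : ℝ) : cut n t ≤ 1 := Real.smoothTransition.le_one _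

lemma abs_cut_le_one (n : ℕ) (t : ℝ) : |cut n t| ≤ 1 := by
  rw [abs_of_nonneg (cut_nonneg n t)]
  exact cut_le_one n t

lemma cut_eq_zero {n : ℕ} {t : ℝ} (h : n * t ≤ 1) : cut n t = 0 :=
  Real.smoothTransition.zero_of_nonpos (by linarith)

lemma cut_eq_one {n : ℕ} {t : ℝ} (h : 2 ≤ n * t) : cut n t = 1 :=
  Real.smoothTransition.one_of_one_le (by linarith)

lemma cut_hasDerivAt (n : ℕ) (t : ℝ) : HasDerivAt (cut n) (deriv (cut n) t) t :=
  ((cut_contDiff n).differentiable (by simp) t).hasDerivAt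

lemma deriv_cut_eq (n : ℕ) (t : ℝ) :
    deriv (cut n) t = deriv Real.smoothTransition (n * t - 1) * n := by
  have h1 : HasDerivAt (fun t : ℝ => (n : ℝ) * t - 1) n t := by
    simpa using ((hasDerivAt_id t).const_mul (n : ℝ)).sub_const 1
  have h2 : HasDerivAt Real.smoothTransition (deriv Real.smoothTransition (n * t - 1))
      (n * t - 1) :=
    ((Real.smoothTransition.contDiff (n := 1)).differentiable (by simp) _).hasDerivAt
  exact (h2.comp t h1).deriv

lemma deriv_smoothTransition_of_lt {s : ℝ} (h : s < 0) : deriv Real.smoothTransition s = 0 := by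
  have : Real.smoothTransition =ᶠ[𝓝 s] fun _ => (0 : ℝ) := by
    filter_upwards [Iio_mem_nhds h] with t ht
    exact Real.smoothTransition.zero_of_nonpos (le_of_lt ht)
  rw [this.deriv_eq]
  simp

lemma deriv_smoothTransition_of_gt {s : ℝ} (h : 1 < s) : deriv Real.smoothTransition s = 0 := by
  have : Real.smoothTransition =ᶠ[𝓝 s] fun _ => (1 : ℝ) := by
    filter_upwards [Ioi_mem_nhds h] with t ht
    exact Real.smoothTransition.one_of_one_le (le_of_lt ht)
  rw [this.deriv_eq]
  simp

lemma continuous_deriv_smoothTransition : Continuous (deriv Real.smoothTransition) :=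
  (Real.smoothTransition.contDiff (n := 1)).continuous_deriv (by simp)

lemma exists_abs_deriv_smoothTransition_le :
    ∃ C : ℝ, 0 ≤ C ∧ ∀ s, |deriv Real.smoothTransition s| ≤ C := by
  obtain ⟨C, hC⟩ := (isCompact_Icc (a := (0 : ℝ)) (b := 1)).exists_bound_of_continuousOn
    continuous_deriv_smoothTransition.continuousOn
  refine ⟨|C|, abs_nonneg _, fun s => ?_⟩
  by_cases hs : s ∈ Icc (0 : ℝ) 1
  · exact (hC s hs).trans (le_abs_self C)
  · have : deriv Real.smoothTransition s = 0 := by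
      by_cases h0 : s < 0
      · exact deriv_smoothTransition_of_lt h0
      · exact deriv_smoothTransition_of_gt (by
          by_contra h1
          exact hs ⟨not_lt.1 h0, not_lt.1 h1⟩)
    rw [this]
    simp

/-- The derivative of the cutoff is of size `1 / t`, uniformly in `n`. -/
lemma exists_abs_mul_deriv_cut_le :
    ∃ C : ℝ, 0 ≤ C ∧ ∀ (n : ℕ) (t : ℝ), |t| * |deriv (cut n) t| ≤ C := by
  obtain ⟨C, hC0, hC⟩ := exists_abs_deriv_smoothTransition_le
  refine ⟨2 * C, by positivity, fun n t => ?_⟩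
  rw [deriv_cut_eq, abs_mul, Nat.abs_cast]
  by_cases h : (n : ℝ) * t - 1 ∈ Icc (0 : ℝ) 1
  · have ht : |t| * n ≤ 2 := by
      have : |(n : ℝ) * t| ≤ 2 := by
        rw [abs_of_nonneg (by linarith [h.1])]
        linarith [h.2]
      rwa [abs_mul, Nat.abs_cast, mul_comm] at this
    calc |t| * (|deriv Real.smoothTransition (n * t - 1)| * n)
        = (|t| * n) * |deriv Real.smoothTransition (n * t - 1)| := by ring
      _ ≤ 2 * C := mul_le_mul ht (hC _) (abs_nonneg _) (by norm_num)
  · have : deriv Real.smoothTransition (n * t - 1) = 0 := by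
      by_cases h0 : (n : ℝ) * t - 1 < 0
      · exact deriv_smoothTransition_of_lt h0
      · exact deriv_smoothTransition_of_gt (by
          by_contra h1
          exact h ⟨not_lt.1 h0, not_lt.1 h1⟩)
    rw [this]
    simpa using hC0

lemma deriv_cut_eventually (t : ℝ) : ∀ᶠ n : ℕ in atTop, deriv (cut n) t = 0 := by
  rcases le_or_gt t 0 with ht | ht
  · refine Eventually.of_forall fun n => ?_
    rw [deriv_cut_eq, deriv_smoothTransition_of_lt, zero_mul]
    nlinarith [(Nat.cast_nonneg n : (0 : ℝ) ≤ n)]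
  · have : Tendsto (fun n : ℕ => (n : ℝ) * t) atTop atTop :=
      tendsto_natCast_atTop_atTop.atTop_mul_const ht
    filter_upwards [this.eventually_gt_atTop 2] with n hn
    rw [deriv_cut_eq, deriv_smoothTransition_of_gt (by linarith), zero_mul]

lemma cut_eventually {t : ℝ} (ht : 0 < t) : ∀ᶠ n : ℕ in atTop, cut n t = 1 := by
  have : Tendsto (fun n : ℕ => (n : ℝ) * t) atTop atTop :=
    tendsto_natCast_atTop_atTop.atTop_mul_const ht
  filter_upwards [this.eventually_ge_atTop 2] with n hn
  exact cut_eq_one hn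

/-! ### Test functions -/

/-- Test functions of one variable. -/
def IsTest1 (P : Set ℝ) (a : ℝ → ℝ) : Prop :=
  ContDiff ℝ ∞ a ∧ HasCompactSupport a ∧ tsupport a ⊆ P

lemma IsTest.mono {P Q : Set (ℝ × ℝ)} (h : P ⊆ Q) {φ : ℝ × ℝ → ℝ} (hφ : IsTest P φ) :
    IsTest Q φ := ⟨hφ.1, hφ.2.1, hφ.2.2.trans h⟩

lemma IsTest.differentiable {P : Set (ℝ × ℝ)} {φ : ℝ × ℝ → ℝ} (hφ : IsTest P φ) :
    Differentiable ℝ φ := hφ.1.differentiable (by simp)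

lemma contDiff_pdx {φ : ℝ × ℝ → ℝ} (hφ : ContDiff ℝ ∞ φ) : ContDiff ℝ ∞ (pdx φ) := by
  unfold pdx
  exact (hφ.fderiv_right (m := ∞) (by simp)).clm_apply contDiff_const

lemma contDiff_pdy {φ : ℝ × ℝ → ℝ} (hφ : ContDiff ℝ ∞ φ) : ContDiff ℝ ∞ (pdy φ) := by
  unfold pdy
  exact (hφ.fderiv_right (m := ∞) (by simp)).clm_apply contDiff_const

lemma tsupport_fderiv_apply_subset (φ : ℝ × ℝ → ℝ) (v : ℝ × ℝ) :
    tsupport (fun p => fderiv ℝ φ p v) ⊆ tsupport φ := by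
  refine closure_minimal (fun p hp => ?_) (isClosed_tsupport _)
  refine support_fderiv_subset ℝ fun h => hp ?_
  change fderiv ℝ φ p = 0 at h
  simp [h]

lemma IsTest.pdx {P : Set (ℝ × ℝ)} {φ : ℝ × ℝ → ℝ} (hφ : IsTest P φ) : IsTest P (pdx φ) :=
  ⟨contDiff_pdx hφ.1,
    hφ.2.1.of_isClosed_subset (isClosed_tsupport _) (tsupport_fderiv_apply_subset φ _),
    (tsupport_fderiv_apply_subset φ _).trans hφ.2.2⟩

lemma IsTest.pdy {P : Set (ℝ × ℝ)} {φ : ℝ × ℝ → ℝ} (hφ : IsTest P φ) : IsTest P (pdy φ) :=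
  ⟨contDiff_pdy hφ.1,
    hφ.2.1.of_isClosed_subset (isClosed_tsupport _) (tsupport_fderiv_apply_subset φ _),
    (tsupport_fderiv_apply_subset φ _).trans hφ.2.2⟩

lemma IsTest.eq_zero {P : Set (ℝ × ℝ)} {φ : ℝ × ℝ → ℝ} (hφ : IsTest P φ) {p : ℝ × ℝ}
    (hp : p ∉ P) : φ p = 0 := image_eq_zero_of_notMem_tsupport fun h => hp (hφ.2.2 h)

lemma IsTest.bound {P : Set (ℝ × ℝ)} {φ : ℝ × ℝ → ℝ} (hφ : IsTest P φ) :
    ∃ C : ℝ, ∀ p, |φ p| ≤ C := hφ.2.1.exists_bound_of_continuous hφ.1.continuous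

lemma IsTest.memLp {P : Set (ℝ × ℝ)} {φ : ℝ × ℝ → ℝ} (hφ : IsTest P φ) (U : Set (ℝ × ℝ)) :
    MemLp φ 2 (volume.restrict U) := hφ.1.continuous.memLp_of_hasCompactSupport hφ.2.1

lemma pdx_mul {φ ψ : ℝ × ℝ → ℝ} {p : ℝ × ℝ} (hφ : DifferentiableAt ℝ φ p)
    (hψ : DifferentiableAt ℝ ψ p) :
    pdx (fun q => φ q * ψ q) p = φ p * pdx ψ p + ψ p * pdx φ p := by
  simp [pdx, fderiv_fun_mul hφ hψ]

lemma pdy_mul {φ ψ : ℝ × ℝ → ℝ} {p : ℝ × ℝ} (hφ : DifferentiableAt ℝ φ p)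
    (hψ : DifferentiableAt ℝ ψ p) :
    pdy (fun q => φ q * ψ q) p = φ p * pdy ψ p + ψ p * pdy φ p := by
  simp [pdy, fderiv_fun_mul hφ hψ]

lemma IsTest.mul_left {P : Set (ℝ × ℝ)} {φ ψ : ℝ × ℝ → ℝ} (hφ : IsTest P φ)
    (hψ : ContDiff ℝ ∞ ψ) : IsTest P (fun p => ψ p * φ p) :=
  ⟨hψ.mul hφ.1, hφ.2.1.mul_left, (tsupport_mul_subset_right).trans hφ.2.2⟩

lemma hasFDerivAt_tensor {a b : ℝ → ℝ} (ha : Differentiable ℝ a) (hb : Differentiable ℝ b)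
    (p : ℝ × ℝ) : HasFDerivAt (fun p : ℝ × ℝ => a p.1 * b p.2)
      (a p.1 • (deriv b p.2 • ContinuousLinearMap.snd ℝ ℝ ℝ) +
        b p.2 • (deriv a p.1 • ContinuousLinearMap.fst ℝ ℝ ℝ)) p := by
  have h1 : HasFDerivAt (fun p : ℝ × ℝ => a p.1)
      (deriv a p.1 • ContinuousLinearMap.fst ℝ ℝ ℝ) p :=
    (ha p.1).hasDerivAt.comp_hasFDerivAt p hasFDerivAt_fst
  have h2 : HasFDerivAt (fun p : ℝ × ℝ => b p.2)
      (deriv b p.2 • ContinuousLinearMap.snd ℝ ℝ ℝ) p :=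
    (hb p.2).hasDerivAt.comp_hasFDerivAt p hasFDerivAt_snd
  exact h1.mul h2

lemma pdx_tensor {a b : ℝ → ℝ} (ha : Differentiable ℝ a) (hb : Differentiable ℝ b)
    (p : ℝ × ℝ) : pdx (fun p : ℝ × ℝ => a p.1 * b p.2) p = deriv a p.1 * b p.2 := by
  rw [pdx, (hasFDerivAt_tensor ha hb p).fderiv]
  simp [mul_comm]

lemma pdy_tensor {a b : ℝ → ℝ} (ha : Differentiable ℝ a) (hb : Differentiable ℝ b)
    (p : ℝ × ℝ) : pdy (fun p : ℝ × ℝ => a p.1 * b p.2) p = a p.1 * deriv b p.2 := by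
  rw [pdy, (hasFDerivAt_tensor ha hb p).fderiv]
  simp

lemma IsTest1.differentiable {P : Set ℝ} {a : ℝ → ℝ} (ha : IsTest1 P a) : Differentiable ℝ a :=
  ha.1.differentiable (by simp)

lemma IsTest1.tensor {P Q : Set ℝ} {a b : ℝ → ℝ} (ha : IsTest1 P a) (hb : IsTest1 Q b) :
    IsTest (P ×ˢ Q) (fun p => a p.1 * b p.2) := by
  have hsub : tsupport (fun p : ℝ × ℝ => a p.1 * b p.2) ⊆ tsupport a ×ˢ tsupport b := by
    refine closure_minimal (fun p hp => ?_) ((isClosed_tsupport a).prod (isClosed_tsupport b))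
    exact ⟨subset_tsupport a (left_ne_zero_of_mul hp), subset_tsupport b (right_ne_zero_of_mul hp)⟩
  refine ⟨?_, ?_, hsub.trans (prod_mono ha.2.2 hb.2.2)⟩
  · exact (ha.1.comp contDiff_fst).mul (hb.1.comp contDiff_snd)
  · exact (ha.2.1.isCompact.prod hb.2.1.isCompact).of_isClosed_subset (isClosed_tsupport _) hsub

/-! ### First order distributions -/

/-- The distribution `φ ↦ ∫_U (α φ + β ∂_x φ + γ ∂_y φ)`.  Traces and normal derivatives are
special cases. -/
def act (U : Set (ℝ × ℝ)) (α β γ φ : ℝ × ℝ → ℝ) : ℝ :=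
  ∫ p in U, (α p * φ p + β p * pdx φ p + γ p * pdy φ p)

lemma act_integrable {U P : Set (ℝ × ℝ)} {α β γ φ : ℝ × ℝ → ℝ}
    (hα : MemLp α 2 (volume.restrict U)) (hβ : MemLp β 2 (volume.restrict U))
    (hγ : MemLp γ 2 (volume.restrict U)) (hφ : IsTest P φ) :
    Integrable (fun p => α p * φ p + β p * pdx φ p + γ p * pdy φ p) (volume.restrict U) :=
  ((hα.integrable_mul (hφ.memLp U)).add (hβ.integrable_mul (hφ.pdx.memLp U))).add
    (hγ.integrable_mul (hφ.pdy.memLp U))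

/-- A distribution of first order which is supported on the line `L = 0` vanishes on the test
functions which vanish on this line. -/
lemma act_eq_zero_of_abs_le {P U : Set (ℝ × ℝ)} (L : ℝ × ℝ →L[ℝ] ℝ)
    (hU : ∀ p, p ∈ U ↔ p ∈ P ∧ 0 < L p) (hUm : MeasurableSet U)
    (hfin : volume U ≠ ⊤) {α β γ φ : ℝ × ℝ → ℝ}
    (hα : MemLp α 2 (volume.restrict U)) (hβ : MemLp β 2 (volume.restrict U))
    (hγ : MemLp γ 2 (volume.restrict U))
    (h : ∀ ψ, IsTest U ψ → act U α β γ ψ = 0)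
    (hφ : IsTest P φ) {C : ℝ} (hC : ∀ p, |φ p| ≤ C * |L p|) : act U α β γ φ = 0 := by
  have : IsFiniteMeasure (volume.restrict U) := ⟨by simpa [lt_top_iff_ne_top] using hfin⟩
  obtain ⟨D, hD0, hD⟩ := exists_abs_mul_deriv_cut_le
  obtain ⟨M0, hM0⟩ := hφ.bound
  obtain ⟨M1, hM1⟩ := hφ.pdx.bound
  obtain ⟨M2, hM2⟩ := hφ.pdy.bound
  -- `ψ n` cuts `φ` off near the line `L = 0`.  Its derivatives stay bounded as `n → ∞`, since
  -- `|φ| ≤ C |L|` compensates the growth of the derivative of the cutoff function.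
  set ψ : ℕ → ℝ × ℝ → ℝ := fun n p => cut n (L p) * φ p with hψdef
  have hcutL : ∀ n : ℕ, ContDiff ℝ ∞ (fun p : ℝ × ℝ => cut n (L p)) := fun n =>
    (cut_contDiff n).comp L.contDiff
  have hψ : ∀ n : ℕ, IsTest U (ψ n) := by
    intro n
    have h1 := hφ.mul_left (hcutL n)
    refine ⟨h1.1, h1.2.1, fun p hp => (hU p).2 ⟨h1.2.2 hp, ?_⟩⟩
    have : tsupport (ψ n) ⊆ {q | (1 : ℝ) ≤ n * L q} := by
      refine closure_minimal (fun q hq => ?_)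
        (isClosed_le continuous_const (continuous_const.mul L.continuous))
      by_contra hlt
      exact hq (by simp [hψdef, cut_eq_zero (le_of_lt (not_le.1 hlt))])
    have h2 : (1 : ℝ) ≤ n * L p := this hp
    by_contra hneg
    nlinarith [(Nat.cast_nonneg n : (0 : ℝ) ≤ n)]
  have hder : ∀ (n : ℕ) (p v : ℝ × ℝ), fderiv ℝ (ψ n) p v =
      cut n (L p) * fderiv ℝ φ p v + φ p * (deriv (cut n) (L p) * L v) := by
    intro n p v
    have h1 : HasFDerivAt (fun p : ℝ × ℝ => cut n (L p)) (deriv (cut n) (L p) • L) p :=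
      (cut_hasDerivAt n (L p)).comp_hasFDerivAt p L.hasFDerivAt
    have h2 : HasFDerivAt (ψ n) (cut n (L p) • fderiv ℝ φ p +
        φ p • (deriv (cut n) (L p) • L)) p := h1.mul (hφ.differentiable p).hasFDerivAt
    rw [h2.fderiv]
    simp
  have hbd : ∀ (n : ℕ) (p : ℝ × ℝ), |φ p| * |deriv (cut n) (L p)| ≤ |C| * D := by
    intro n p
    calc |φ p| * |deriv (cut n) (L p)| ≤ (|C| * |L p|) * |deriv (cut n) (L p)| := by
          gcongr
          exact (hC p).trans (by gcongr; exact le_abs_self C)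
      _ = |C| * (|L p| * |deriv (cut n) (L p)|) := by ring
      _ ≤ |C| * D := by gcongr; exact hD n _
  have hbd2 : ∀ (n : ℕ) (p v : ℝ × ℝ) (M : ℝ), |fderiv ℝ φ p v| ≤ M →
      |fderiv ℝ (ψ n) p v| ≤ M + |C| * D * |L v| := by
    intro n p v M hM
    rw [hder]
    refine (abs_add_le _ _).trans (add_le_add ?_ ?_)
    · rw [abs_mul]
      calc |cut n (L p)| * |fderiv ℝ φ p v| ≤ 1 * M :=
            mul_le_mul (abs_cut_le_one n _) hM (abs_nonneg _) zero_le_one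
        _ = M := one_mul M
    · rw [abs_mul, abs_mul, ← mul_assoc]
      exact mul_le_mul_of_nonneg_right (hbd n p) (abs_nonneg _)
  have hlim : Tendsto (fun n => act U α β γ (ψ n)) atTop (𝓝 (act U α β γ φ)) := by
    unfold act
    refine tendsto_integral_of_dominated_convergence
      (fun p => |α p| * M0 + |β p| * (M1 + |C| * D * |L (1, 0)|) +
        |γ p| * (M2 + |C| * D * |L (0, 1)|)) ?_ ?_ ?_ ?_
    · exact fun n => (act_integrable hα hβ hγ (hψ n)).aestronglyMeasurable
    · exact (((hα.integrable one_le_two).abs.mul_const _).add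
        ((hβ.integrable one_le_two).abs.mul_const _)).add
        ((hγ.integrable one_le_two).abs.mul_const _)
    · refine fun n => Eventually.of_forall fun p => ?_
      have e0 : |ψ n p| ≤ M0 := by
        rw [hψdef, abs_mul]
        calc |cut n (L p)| * |φ p| ≤ 1 * M0 :=
              mul_le_mul (abs_cut_le_one n _) (hM0 p) (abs_nonneg _) zero_le_one
          _ = M0 := one_mul _
      have e1 : |pdx (ψ n) p| ≤ _ := hbd2 n p (1, 0) M1 (hM1 p)
      have e2 : |pdy (ψ n) p| ≤ _ := hbd2 n p (0, 1) M2 (hM2 p)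
      rw [Real.norm_eq_abs]
      refine (abs_add_le _ _).trans (add_le_add ((abs_add_le _ _).trans (add_le_add ?_ ?_)) ?_)
      · rw [abs_mul]; gcongr
      · rw [abs_mul]; gcongr
      · rw [abs_mul]; gcongr
    · filter_upwards [ae_restrict_mem hUm] with p hp
      have hLp := ((hU p).1 hp).2
      refine tendsto_const_nhds.congr' ?_
      filter_upwards [cut_eventually hLp, deriv_cut_eventually (L p)] with n h1 h2
      have h0 : ψ n p = φ p := by simp only [hψdef, h1, one_mul]
      simp only [pdx, pdy, hder, h0, h1, h2]
      ring
  have hz : ∀ n, act U α β γ (ψ n) = 0 := fun n => h _ (hψ n)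
  simp only [hz] at hlim
  exact (tendsto_nhds_unique hlim tendsto_const_nhds)

/-! ### Extending one-dimensional identities to the boundary -/

/-- The cutoff of the interval `(p, q)`. -/
def cutI (p q : ℝ) (n : ℕ) (x : ℝ) : ℝ := cut n (x - p) * cut n (q - x)

lemma cutI_contDiff (p q : ℝ) (n : ℕ) : ContDiff ℝ ∞ (cutI p q n) :=
  ((cut_contDiff n).comp (by fun_prop)).mul ((cut_contDiff n).comp (by fun_prop))

lemma hasDerivAt_cutI (p q : ℝ) (n : ℕ) (x : ℝ) : HasDerivAt (cutI p q n)
    (deriv (cut n) (x - p) * cut n (q - x) - cut n (x - p) * deriv (cut n) (q - x)) x := by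
  have h1 : HasDerivAt (fun x => cut n (x - p)) (deriv (cut n) (x - p)) x := by
    simpa using (cut_hasDerivAt n (x - p)).comp_sub_const x p
  have h2 : HasDerivAt (fun x => cut n (q - x)) (-deriv (cut n) (q - x)) x := by
    simpa using (cut_hasDerivAt n (q - x)).comp_const_sub q x
  exact (h1.mul h2).congr_deriv (by ring)

lemma abs_cutI_le_one (p q : ℝ) (n : ℕ) (x : ℝ) : |cutI p q n x| ≤ 1 := by
  rw [cutI, abs_mul]
  exact mul_le_one₀ (abs_cut_le_one _ _) (abs_nonneg _) (abs_cut_le_one _ _)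

lemma cutI_mul_isTest1 (p q : ℝ) (n : ℕ) {a : ℝ → ℝ} (ha : ContDiff ℝ ∞ a) :
    IsTest1 (Ioo p q) (fun x => cutI p q n x * a x) := by
  have hsub : tsupport (fun x => cutI p q n x * a x) ⊆
      {x | (1 : ℝ) ≤ n * (x - p)} ∩ {x | (1 : ℝ) ≤ n * (q - x)} := by
    refine closure_minimal (fun x hx => ?_) ((isClosed_le continuous_const (by fun_prop)).inter
      (isClosed_le continuous_const (by fun_prop)))
    constructor
    · by_contra hlt
      exact hx (by simp [cutI, cut_eq_zero (le_of_lt (not_le.1 hlt))])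
    · by_contra hlt
      exact hx (by simp [cutI, cut_eq_zero (le_of_lt (not_le.1 hlt))])
  have hsub2 : tsupport (fun x => cutI p q n x * a x) ⊆ Ioo p q := by
    intro x hx
    obtain ⟨h1, h2⟩ := hsub hx
    simp only [mem_ofPred_eq] at h1 h2
    have hn := (Nat.cast_nonneg n : (0 : ℝ) ≤ n)
    constructor
    · by_contra hneg
      nlinarith
    · by_contra hneg
      nlinarith
  exact ⟨(cutI_contDiff p q n).mul ha, isCompact_Icc.of_isClosed_subset (isClosed_tsupport _)
    (hsub2.trans Ioo_subset_Icc_self), hsub2⟩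

lemma cutI_eventually {p q x : ℝ} (hx : x ∈ Ioo p q) :
    ∀ᶠ n : ℕ in atTop, cutI p q n x = 1 ∧ deriv (cutI p q n) x = 0 := by
  filter_upwards [cut_eventually (sub_pos.2 hx.1), cut_eventually (sub_pos.2 hx.2),
    deriv_cut_eventually (x - p), deriv_cut_eventually (q - x)] with n h1 h2 h3 h4
  rw [(hasDerivAt_cutI p q n x).deriv, cutI, h1, h2, h3, h4]
  simp

lemma exists_abs_deriv_cutI_mul_le {p q : ℝ} {a : ℝ → ℝ} (ha : ContDiff ℝ ∞ a)
    (hp : a p = 0) (hq : a q = 0) :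
    ∃ C : ℝ, 0 ≤ C ∧ ∀ n, ∀ x ∈ Icc p q, |deriv (cutI p q n) x * a x| ≤ C := by
  obtain ⟨D, hD0, hD⟩ := exists_abs_mul_deriv_cut_le
  obtain ⟨M, hM⟩ := (isCompact_Icc (a := p) (b := q)).exists_bound_of_continuousOn
    (ha.continuous_deriv (by simp)).continuousOn
  have hlip : ∀ x ∈ Icc p q, ∀ y ∈ Icc p q, |a y - a x| ≤ M * |y - x| := fun x hx y hy =>
    (convex_Icc p q).norm_image_sub_le_of_norm_deriv_le
      (fun z _ => (ha.differentiable (by simp)) z) hM hx hy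
  have key : ∀ (n : ℕ) (s t M c : ℝ), |s| ≤ M * |t| → |c| ≤ 1 → 0 ≤ M →
      |deriv (cut n) t * c * s| ≤ M * D := by
    intro n s t M c hs hc hM
    rw [abs_mul, abs_mul]
    calc |deriv (cut n) t| * |c| * |s| ≤ |deriv (cut n) t| * 1 * (M * |t|) := by gcongr
      _ = M * (|t| * |deriv (cut n) t|) := by ring
      _ ≤ M * D := by gcongr; exact hD n t
  refine ⟨2 * (|M| * D), by positivity, fun n x hx => ?_⟩
  have hpq : p ≤ q := hx.1.trans hx.2
  have h1 : |a x| ≤ |M| * |x - p| := by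
    have := hlip p (left_mem_Icc.2 hpq) x hx
    rw [hp, sub_zero] at this
    exact this.trans (by gcongr; exact le_abs_self M)
  have h2 : |a x| ≤ |M| * |q - x| := by
    have := hlip q (right_mem_Icc.2 hpq) x hx
    rw [hq, sub_zero, abs_sub_comm] at this
    exact this.trans (by gcongr; exact le_abs_self M)
  rw [(hasDerivAt_cutI p q n x).deriv, sub_mul]
  refine (abs_sub _ _).trans ?_
  rw [two_mul]
  refine add_le_add (key n _ _ _ _ h1 (abs_cut_le_one _ _) (abs_nonneg M)) ?_
  rw [mul_comm (cut n (x - p))]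
  exact key n _ _ _ _ h2 (abs_cut_le_one _ _) (abs_nonneg M)

/-- An identity which holds for test functions in an interval extends to the smooth functions
which vanish at its end points. -/
lemma integral_deriv_eq_zero_of_test {E : Type*} [MeasurableSpace E] {μ : Measure E} {X : E → ℝ}
    (hX : Measurable X) {p q : ℝ} (hXI : ∀ᵐ e ∂μ, X e ∈ Ioo p q) {u v : E → ℝ}
    (hu : Integrable u μ) (hv : Integrable v μ)
    (h : ∀ a, IsTest1 (Ioo p q) a → ∫ e, (u e * deriv a (X e) + v e * a (X e)) ∂μ = 0)
    {a : ℝ → ℝ} (ha : ContDiff ℝ ∞ a) (hp : a p = 0) (hq : a q = 0) :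
    ∫ e, (u e * deriv a (X e) + v e * a (X e)) ∂μ = 0 := by
  -- As `a` vanishes at `p` and `q`, the products of `a` and the derivatives of the cutoff functions
  -- are bounded by a constant, so that dominated convergence applies.
  obtain ⟨C, hC0, hC⟩ := exists_abs_deriv_cutI_mul_le ha hp hq
  obtain ⟨M0, hM0⟩ := (isCompact_Icc (a := p) (b := q)).exists_bound_of_continuousOn
    ha.continuous.continuousOn
  obtain ⟨M1, hM1⟩ := (isCompact_Icc (a := p) (b := q)).exists_bound_of_continuousOn
    (ha.continuous_deriv (by simp)).continuousOn
  have hder : ∀ n x, deriv (fun x => cutI p q n x * a x) x =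
      deriv (cutI p q n) x * a x + cutI p q n x * deriv a x := fun n x =>
    (((cutI_contDiff p q n).differentiable (by simp) x).hasDerivAt.mul
      ((ha.differentiable (by simp)) x).hasDerivAt).deriv
  have hlim : Tendsto (fun n => ∫ e, (u e * deriv (fun x => cutI p q n x * a x) (X e) +
      v e * (cutI p q n (X e) * a (X e))) ∂μ) atTop
      (𝓝 (∫ e, (u e * deriv a (X e) + v e * a (X e)) ∂μ)) := by
    refine tendsto_integral_of_dominated_convergence
      (fun e => |u e| * (C + M1) + |v e| * M0) ?_ ?_ ?_ ?_
    · intro n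
      have h1 : Measurable fun e => deriv (fun x => cutI p q n x * a x) (X e) :=
        (measurable_deriv _).comp hX
      have h2 : Measurable fun e => cutI p q n (X e) * a (X e) :=
        ((cutI_contDiff p q n).continuous.measurable.comp hX).mul
          (ha.continuous.measurable.comp hX)
      exact (hu.aestronglyMeasurable.mul h1.aestronglyMeasurable).add
        (hv.aestronglyMeasurable.mul h2.aestronglyMeasurable)
    · exact (hu.abs.mul_const _).add (hv.abs.mul_const _)
    · intro n
      filter_upwards [hXI] with e he
      have he' := Ioo_subset_Icc_self he
      rw [hder, Real.norm_eq_abs]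
      refine (abs_add_le _ _).trans (add_le_add ?_ ?_)
      · rw [abs_mul]
        gcongr
        refine (abs_add_le _ _).trans (add_le_add (hC n _ he') ?_)
        rw [abs_mul]
        calc _ ≤ 1 * M1 := mul_le_mul (abs_cutI_le_one _ _ _ _) (hM1 _ he') (abs_nonneg _)
              zero_le_one
          _ = M1 := one_mul _
      · rw [abs_mul, abs_mul]
        gcongr
        calc _ ≤ 1 * M0 := mul_le_mul (abs_cutI_le_one _ _ _ _) (hM0 _ he') (abs_nonneg _)
              zero_le_one
          _ = M0 := one_mul _
    · filter_upwards [hXI] with e he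
      refine tendsto_const_nhds.congr' ?_
      filter_upwards [cutI_eventually he] with n hn
      rw [hder, hn.1, hn.2]
      ring
  have hz : ∀ n, ∫ e, (u e * deriv (fun x => cutI p q n x * a x) (X e) +
      v e * (cutI p q n (X e) * a (X e))) ∂μ = 0 := fun n =>
    h _ (cutI_mul_isTest1 p q n ha)
  simp only [hz] at hlim
  exact tendsto_nhds_unique hlim tendsto_const_nhds

/-- An identity without derivatives which holds for test functions in an interval extends to all
smooth functions. -/
lemma integral_eq_zero_of_test {E : Type*} [MeasurableSpace E] {μ : Measure E} {X : E → ℝ}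
    (hX : Measurable X) {p q : ℝ} (hXI : ∀ᵐ e ∂μ, X e ∈ Ioo p q) {v : E → ℝ}
    (hv : Integrable v μ)
    (h : ∀ a, IsTest1 (Ioo p q) a → ∫ e, v e * a (X e) ∂μ = 0)
    {a : ℝ → ℝ} (ha : ContDiff ℝ ∞ a) : ∫ e, v e * a (X e) ∂μ = 0 := by
  obtain ⟨M0, hM0⟩ := (isCompact_Icc (a := p) (b := q)).exists_bound_of_continuousOn
    ha.continuous.continuousOn
  have hlim : Tendsto (fun n => ∫ e, v e * (cutI p q n (X e) * a (X e)) ∂μ) atTop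
      (𝓝 (∫ e, v e * a (X e) ∂μ)) := by
    refine tendsto_integral_of_dominated_convergence (fun e => |v e| * M0) ?_ ?_ ?_ ?_
    · intro n
      have h2 : Measurable fun e => cutI p q n (X e) * a (X e) :=
        ((cutI_contDiff p q n).continuous.measurable.comp hX).mul
          (ha.continuous.measurable.comp hX)
      exact hv.aestronglyMeasurable.mul h2.aestronglyMeasurable
    · exact hv.abs.mul_const _
    · intro n
      filter_upwards [hXI] with e he
      rw [Real.norm_eq_abs, abs_mul, abs_mul]
      gcongr
      calc _ ≤ 1 * M0 := mul_le_mul (abs_cutI_le_one _ _ _ _)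
            (hM0 _ (Ioo_subset_Icc_self he)) (abs_nonneg _) zero_le_one
        _ = M0 := one_mul _
    · filter_upwards [hXI] with e he
      refine tendsto_const_nhds.congr' ?_
      filter_upwards [cutI_eventually he] with n hn
      rw [hn.1, one_mul]
  have hz : ∀ n, ∫ e, v e * (cutI p q n (X e) * a (X e)) ∂μ = 0 := fun n =>
    h _ (cutI_mul_isTest1 p q n ha)
  simp only [hz] at hlim
  exact tendsto_nhds_unique hlim tendsto_const_nhds

/-! ### Geometry of the decomposition -/

/-- The sign of the first coordinate in a quadrant. -/
def sx : Fin 4 → ℝ := ![-1, 1, 1, -1]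

/-- The sign of the second coordinate in a quadrant. -/
def sy : Fin 4 → ℝ := ![-1, -1, 1, 1]

/-- The neighbour across the vertical interface. -/
def nbX : Fin 4 → Fin 4 := ![1, 0, 3, 2]

/-- The neighbour across the horizontal interface. -/
def nbY : Fin 4 → Fin 4 := ![3, 2, 1, 0]

/-- The unit interval `(0, 1)` for `s = 1`, and `(-1, 0)` for `s = -1`. -/
def half (s : ℝ) : Set ℝ := {x | 0 < s * x ∧ s * x < 1}

lemma mem_half {s x : ℝ} : x ∈ half s ↔ 0 < s * x ∧ s * x < 1 := Iff.rfl

lemma half_one : half 1 = Ioo 0 1 := by ext x; simp [mem_half]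

lemma half_neg_one : half (-1) = Ioo (-1) 0 := by
  ext x
  simp only [mem_half, mem_Ioo]
  constructor <;> rintro ⟨h1, h2⟩ <;> constructor <;> linarith

lemma sx_cases (i : Fin 4) : sx i = 1 ∨ sx i = -1 := by fin_cases i <;> simp [sx]

lemma sy_cases (i : Fin 4) : sy i = 1 ∨ sy i = -1 := by fin_cases i <;> simp [sy]

lemma sx_mul_self (i : Fin 4) : sx i * sx i = 1 := by rcases sx_cases i with h | h <;> simp [h]

lemma sy_mul_self (i : Fin 4) : sy i * sy i = 1 := by rcases sy_cases i with h | h <;> simp [h]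

lemma sx_nbX (i : Fin 4) : sx (nbX i) = -sx i := by fin_cases i <;> simp [sx, nbX]

lemma sy_nbX (i : Fin 4) : sy (nbX i) = sy i := by fin_cases i <;> simp [sy, nbX]

lemma sx_nbY (i : Fin 4) : sx (nbY i) = sx i := by fin_cases i <;> simp [sx, nbY]

lemma sy_nbY (i : Fin 4) : sy (nbY i) = -sy i := by fin_cases i <;> simp [sy, nbY]

lemma nbX_nbX (i : Fin 4) : nbX (nbX i) = i := by fin_cases i <;> rfl

lemma nbY_nbY (i : Fin 4) : nbY (nbY i) = i := by fin_cases i <;> rfl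

lemma mem_vertical (i j : Fin 4) : (i, j) ∈ verticalInterfaces ↔ j = nbX i := by
  fin_cases i <;> fin_cases j <;> simp [verticalInterfaces, nbX]

lemma mem_horizontal (i j : Fin 4) : (i, j) ∈ horizontalInterfaces ↔ j = nbY i := by
  fin_cases i <;> fin_cases j <;> simp [horizontalInterfaces, nbY]

lemma normal_nbX (i : Fin 4) : normal i (nbX i) = (-sx i, 0) := by
  fin_cases i <;> simp [normal, centre, nbX, sx] <;> norm_num

lemma normal_nbY (i : Fin 4) : normal i (nbY i) = (0, -sy i) := by
  fin_cases i <;> simp [normal, centre, nbY, sy] <;> norm_num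

lemma mem_quadrant (i : Fin 4) (p : ℝ × ℝ) :
    p ∈ quadrant i ↔ 0 < sx i * p.1 ∧ 0 < sy i * p.2 := by
  fin_cases i <;> simp [quadrant, sx, sy]

lemma mem_sub (i : Fin 4) (p : ℝ × ℝ) : p ∈ sub i ↔ p.1 ∈ half (sx i) ∧ p.2 ∈ half (sy i) := by
  rw [sub, mem_inter_iff, mem_quadrant, mem_half, mem_half, Omega, mem_prod, mem_Ioo, mem_Ioo]
  rcases sx_cases i with h | h <;> rcases sy_cases i with h' | h' <;> rw [h, h'] <;>
    constructor <;> rintro ⟨⟨h1, h2⟩, h3, h4⟩ <;> refine ⟨⟨?_, ?_⟩, ?_, ?_⟩ <;>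
      first | linarith | (constructor <;> linarith)

lemma sub_eq (i : Fin 4) : sub i = half (sx i) ×ˢ half (sy i) := by
  ext p; exact mem_sub i p

lemma isOpen_half (s : ℝ) : IsOpen (half s) :=
  (isOpen_lt (f := fun _ : ℝ => (0 : ℝ)) (g := fun x => s * x) (by fun_prop) (by fun_prop)).inter
    (isOpen_lt (f := fun x => s * x) (g := fun _ : ℝ => (1 : ℝ)) (by fun_prop) (by fun_prop))

lemma isOpen_sub (i : Fin 4) : IsOpen (sub i) := by
  rw [sub_eq]
  exact (isOpen_half _).prod (isOpen_half _)

lemma isOpen_Omega : IsOpen Omega := isOpen_Ioo.prod isOpen_Ioo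

lemma sub_subset (i : Fin 4) : sub i ⊆ Omega := inter_subset_left

lemma volume_Omega_ne_top : volume Omega ≠ ⊤ := by
  refine ((measure_mono (t := Icc (-1) 1 ×ˢ Icc (-1) 1)
    (prod_mono Ioo_subset_Icc_self Ioo_subset_Icc_self)).trans_lt ?_).ne
  exact (isCompact_Icc.prod isCompact_Icc).measure_lt_top

lemma volume_sub_ne_top (i : Fin 4) : volume (sub i) ≠ ⊤ :=
  ne_top_of_le_ne_top volume_Omega_ne_top (measure_mono (sub_subset i))

instance : IsFiniteMeasure (volume.restrict Omega) :=
  ⟨by simpa [lt_top_iff_ne_top] using volume_Omega_ne_top⟩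

instance (i : Fin 4) : IsFiniteMeasure (volume.restrict (sub i)) :=
  ⟨by simpa [lt_top_iff_ne_top] using volume_sub_ne_top i⟩

lemma closure_half_union {s : ℝ} (hs : s = 1 ∨ s = -1) :
    closure (half s ∪ half (-s)) = Icc (-1) 1 := by
  have : half s ∪ half (-s) = Ioo (-1) 0 ∪ Ioo 0 1 := by
    rcases hs with rfl | rfl
    · rw [half_one, half_neg_one, union_comm]
    · rw [neg_neg, half_one, half_neg_one]
  rw [this, closure_union, closure_Ioo (by norm_num), closure_Ioo (by norm_num),
    Icc_union_Icc_eq_Icc (by norm_num) (by norm_num)]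

lemma interior_closure_half {s : ℝ} (hs : s = 1 ∨ s = -1) :
    interior (closure (half s)) = half s := by
  rcases hs with rfl | rfl
  · rw [half_one, closure_Ioo (by norm_num), interior_Icc]
  · rw [half_neg_one, closure_Ioo (by norm_num), interior_Icc]

lemma patch_nbX (i : Fin 4) : patch i (nbX i) = Ioo (-1) 1 ×ˢ half (sy i) := by
  rw [patch, sub_eq, sub_eq, sx_nbX, sy_nbX, ← union_prod, closure_prod_eq,
    closure_half_union (sx_cases i), interior_prod_eq, interior_Icc,
    interior_closure_half (sy_cases i)]

lemma patch_nbY (i : Fin 4) : patch i (nbY i) = half (sx i) ×ˢ Ioo (-1) 1 := by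
  rw [patch, sub_eq, sub_eq, sx_nbY, sy_nbY, ← prod_union, closure_prod_eq,
    closure_half_union (sy_cases i), interior_prod_eq, interior_Icc,
    interior_closure_half (sx_cases i)]

/-! ### Calculus of first order distributions -/

lemma act_congr {U : Set (ℝ × ℝ)} {α β γ α' β' γ' : ℝ × ℝ → ℝ}
    (hα : α =ᵐ[volume.restrict U] α') (hβ : β =ᵐ[volume.restrict U] β')
    (hγ : γ =ᵐ[volume.restrict U] γ') (φ : ℝ × ℝ → ℝ) :
    act U α β γ φ = act U α' β' γ' φ := by
  refine integral_congr_ae ?_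
  filter_upwards [hα, hβ, hγ] with p h1 h2 h3
  rw [h1, h2, h3]

lemma act_comb {U P : Set (ℝ × ℝ)} {α β γ α' β' γ' : ℝ × ℝ → ℝ}
    (hα : MemLp α 2 (volume.restrict U)) (hβ : MemLp β 2 (volume.restrict U))
    (hγ : MemLp γ 2 (volume.restrict U)) (hα' : MemLp α' 2 (volume.restrict U))
    (hβ' : MemLp β' 2 (volume.restrict U)) (hγ' : MemLp γ' 2 (volume.restrict U))
    {φ : ℝ × ℝ → ℝ} (hφ : IsTest P φ) (a b : ℝ) :
    act U (fun p => a * α p + b * α' p) (fun p => a * β p + b * β' p)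
      (fun p => a * γ p + b * γ' p) φ = a * act U α β γ φ + b * act U α' β' γ' φ := by
  unfold act
  rw [← integral_const_mul, ← integral_const_mul, ← integral_add
    ((act_integrable hα hβ hγ hφ).const_mul a) ((act_integrable hα' hβ' hγ' hφ).const_mul b)]
  refine integral_congr_ae (Eventually.of_forall fun p => ?_)
  simp only
  ring

lemma IsTest.sub {P : Set (ℝ × ℝ)} {φ ψ : ℝ × ℝ → ℝ} (hφ : IsTest P φ) (hψ : IsTest P ψ) :
    IsTest P (fun p => φ p - ψ p) :=
  ⟨hφ.1.sub hψ.1, hφ.2.1.sub hψ.2.1,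
    (tsupport_sub φ ψ).trans (union_subset hφ.2.2 hψ.2.2)⟩

lemma act_sub_right {U P : Set (ℝ × ℝ)} {α β γ : ℝ × ℝ → ℝ}
    (hα : MemLp α 2 (volume.restrict U)) (hβ : MemLp β 2 (volume.restrict U))
    (hγ : MemLp γ 2 (volume.restrict U)) {φ ψ : ℝ × ℝ → ℝ} (hφ : IsTest P φ)
    (hψ : IsTest P ψ) :
    act U α β γ (fun p => φ p - ψ p) = act U α β γ φ - act U α β γ ψ := by
  unfold act
  rw [← integral_sub (act_integrable hα hβ hγ hφ) (act_integrable hα hβ hγ hψ)]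
  refine integral_congr_ae (Eventually.of_forall fun p => ?_)
  simp only [pdx, pdy]
  rw [fderiv_fun_sub (hφ.differentiable p) (hψ.differentiable p)]
  simp only [sub_apply]
  ring

lemma integral_eq_of_isTest {U V : Set (ℝ × ℝ)} (hV : MeasurableSet V) (hUV : U ⊆ V)
    {F : ℝ × ℝ → ℝ} (hF : ∀ p, p ∉ U → F p = 0) : ∫ p in V, F p = ∫ p in U, F p :=
  setIntegral_eq_of_subset_of_forall_sdiff_eq_zero hV hUV fun p hp => hF p hp.2

lemma act_eq_of_subset {U V : Set (ℝ × ℝ)} (hV : MeasurableSet V) (hUV : U ⊆ V)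
    {α β γ φ : ℝ × ℝ → ℝ} (hφ : IsTest U φ) : act V α β γ φ = act U α β γ φ := by
  refine integral_eq_of_isTest hV hUV fun p hp => ?_
  rw [hφ.eq_zero hp, hφ.pdx.eq_zero hp, hφ.pdy.eq_zero hp]
  ring

lemma ae_eq_zero_of_test {U : Set (ℝ × ℝ)} (hU : IsOpen U) {f : ℝ × ℝ → ℝ}
    (hf : IntegrableOn f U) (h : ∀ φ, IsTest U φ → ∫ p in U, f p * φ p = 0) :
    f =ᵐ[volume.restrict U] 0 := by
  have := hU.ae_eq_zero_of_integral_contDiff_smul_eq_zero (hf.locallyIntegrableOn)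
    (fun g hg hgc hgs => by
      have hφ : IsTest U g := ⟨hg, hgc, hgs⟩
      rw [← h g hφ, setIntegral_eq_integral_of_forall_compl_eq_zero
        (fun p hp => by rw [hφ.eq_zero hp, mul_zero])]
      exact integral_congr_ae (Eventually.of_forall fun p => by simp [mul_comm]))
  rw [Filter.EventuallyEq, ae_restrict_iff' hU.measurableSet]
  simpa using this

/-! ### Sign changes of the coordinates -/

/-- The linear map `(x, y) ↦ (s x, t y)`, a symmetry of the square for `s, t = ±1`. -/
def flip (s t : ℝ) (p : ℝ × ℝ) : ℝ × ℝ := (s * p.1, t * p.2)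

/-- For `s, t = ±1`, the map `flip s t` carries `U` onto `V`. -/
structure IsFlip (s t : ℝ) (U V : Set (ℝ × ℝ)) : Prop where
  hs : s = 1 ∨ s = -1
  ht : t = 1 ∨ t = -1
  mem_iff : ∀ p, flip s t p ∈ V ↔ p ∈ U

lemma IsFlip.mul_self_left {s t : ℝ} {U V : Set (ℝ × ℝ)} (h : IsFlip s t U V) : s * s = 1 := by
  rcases h.hs with rfl | rfl <;> norm_num

lemma IsFlip.mul_self_right {s t : ℝ} {U V : Set (ℝ × ℝ)} (h : IsFlip s t U V) : t * t = 1 := by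
  rcases h.ht with rfl | rfl <;> norm_num

lemma IsFlip.flip_flip {s t : ℝ} {U V : Set (ℝ × ℝ)} (h : IsFlip s t U V) (p : ℝ × ℝ) :
    flip s t (flip s t p) = p := by
  simp only [flip, ← mul_assoc, h.mul_self_left, h.mul_self_right, one_mul]

lemma IsFlip.symm {s t : ℝ} {U V : Set (ℝ × ℝ)} (h : IsFlip s t U V) : IsFlip s t V U :=
  ⟨h.hs, h.ht, fun p => by rw [← h.mem_iff, h.flip_flip]⟩

lemma continuous_flip (s t : ℝ) : Continuous (flip s t) := by unfold flip; fun_prop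

lemma contDiff_flip (s t : ℝ) : ContDiff ℝ ∞ (flip s t) := by unfold flip; fun_prop

lemma IsFlip.preimage {s t : ℝ} {U V : Set (ℝ × ℝ)} (h : IsFlip s t U V) :
    flip s t ⁻¹' V = U := by ext p; exact h.mem_iff p

/-- The sign change as a homeomorphism. -/
def IsFlip.homeomorph {s t : ℝ} {U V : Set (ℝ × ℝ)} (h : IsFlip s t U V) : ℝ × ℝ ≃ₜ ℝ × ℝ where
  toFun := flip s t
  invFun := flip s t
  left_inv := h.flip_flip
  right_inv := h.flip_flip
  continuous_toFun := continuous_flip s t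
  continuous_invFun := continuous_flip s t

lemma measurePreserving_sign {s : ℝ} (h : s = 1 ∨ s = -1) :
    MeasurePreserving (fun x : ℝ => s * x) := by
  rcases h with rfl | rfl
  · simp only [one_mul]
    exact MeasurePreserving.id volume
  · simpa using Measure.measurePreserving_neg (volume : Measure ℝ)

lemma IsFlip.measurePreserving {s t : ℝ} {U V : Set (ℝ × ℝ)} (h : IsFlip s t U V) :
    MeasurePreserving (flip s t) (volume.restrict U) (volume.restrict V) := by
  have h1 : MeasurePreserving (flip s t) :=
    (measurePreserving_sign h.hs).prod (measurePreserving_sign h.ht)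
  rw [← h.preimage]
  exact h1.restrict_preimage_emb h.homeomorph.measurableEmbedding V

lemma IsFlip.integral_comp {s t : ℝ} {U V : Set (ℝ × ℝ)} (h : IsFlip s t U V)
    (F : ℝ × ℝ → ℝ) : ∫ p in U, F (flip s t p) = ∫ p in V, F p :=
  h.measurePreserving.integral_comp h.homeomorph.measurableEmbedding F

lemma IsFlip.memLp {s t : ℝ} {U V : Set (ℝ × ℝ)} (h : IsFlip s t U V) {f : ℝ × ℝ → ℝ}
    (hf : MemLp f 2 (volume.restrict V)) :
    MemLp (fun p => f (flip s t p)) 2 (volume.restrict U) :=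
  hf.comp_measurePreserving h.measurePreserving

lemma IsFlip.ae {s t : ℝ} {U V : Set (ℝ × ℝ)} (h : IsFlip s t U V) {P : ℝ × ℝ → Prop}
    (hP : ∀ᵐ p ∂volume.restrict V, P p) : ∀ᵐ p ∂volume.restrict U, P (flip s t p) :=
  h.measurePreserving.quasiMeasurePreserving.ae hP

lemma IsFlip.isTest {s t : ℝ} {U V : Set (ℝ × ℝ)} (h : IsFlip s t U V) {φ : ℝ × ℝ → ℝ}
    (hφ : IsTest V φ) : IsTest U (fun p => φ (flip s t p)) := by
  have h1 : tsupport (fun p => φ (flip s t p)) = flip s t ⁻¹' tsupport φ :=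
    tsupport_comp_eq_preimage φ h.homeomorph
  refine ⟨hφ.1.comp (contDiff_flip s t), ?_, ?_⟩
  · exact hφ.2.1.comp_homeomorph h.homeomorph
  · rw [h1, ← h.preimage]
    exact preimage_mono hφ.2.2

lemma hasFDerivAt_flip (s t : ℝ) (p : ℝ × ℝ) : HasFDerivAt (flip s t)
    ((s • ContinuousLinearMap.fst ℝ ℝ ℝ).prod (t • ContinuousLinearMap.snd ℝ ℝ ℝ)) p :=
  ((s • ContinuousLinearMap.fst ℝ ℝ ℝ).prod (t • ContinuousLinearMap.snd ℝ ℝ ℝ)).hasFDerivAt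

lemma pdx_flip {φ : ℝ × ℝ → ℝ} (hφ : Differentiable ℝ φ) (s t : ℝ) (p : ℝ × ℝ) :
    pdx (fun p => φ (flip s t p)) p = s * pdx φ (flip s t p) := by
  have := ((hφ (flip s t p)).hasFDerivAt.comp p (hasFDerivAt_flip s t p)).fderiv
  rw [pdx, show (fun p => φ (flip s t p)) = φ ∘ flip s t from rfl, this, pdx,
    ← smul_eq_mul, ← map_smul]
  simp

lemma pdy_flip {φ : ℝ × ℝ → ℝ} (hφ : Differentiable ℝ φ) (s t : ℝ) (p : ℝ × ℝ) :
    pdy (fun p => φ (flip s t p)) p = t * pdy φ (flip s t p) := by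
  have := ((hφ (flip s t p)).hasFDerivAt.comp p (hasFDerivAt_flip s t p)).fderiv
  rw [pdy, show (fun p => φ (flip s t p)) = φ ∘ flip s t from rfl, this, pdy,
    ← smul_eq_mul, ← map_smul]
  simp

lemma IsFlip.act {s t : ℝ} {U V P : Set (ℝ × ℝ)} (h : IsFlip s t U V) (α β γ : ℝ × ℝ → ℝ)
    {φ : ℝ × ℝ → ℝ} (hφ : IsTest P φ) :
    act U (fun p => α (flip s t p)) (fun p => s * β (flip s t p)) (fun p => t * γ (flip s t p)) φ
      = act V α β γ (fun p => φ (flip s t p)) := by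
  unfold MixedNNM.act
  rw [← h.integral_comp]
  refine integral_congr_ae (Eventually.of_forall fun p => ?_)
  simp only [pdx_flip hφ.differentiable, pdy_flip hφ.differentiable, h.flip_flip]
  ring

/-- A first order distribution which is supported on the line `L = 0` does not distinguish
between a test function and its mirror image. -/
lemma act_flip_eq {s t : ℝ} {P U : Set (ℝ × ℝ)} (hP : IsFlip s t P P) (L : ℝ × ℝ →L[ℝ] ℝ)
    (hU : ∀ p, p ∈ U ↔ p ∈ P ∧ 0 < L p) (hUm : MeasurableSet U) (hfin : volume U ≠ ⊤)
    (hL : ∀ p, ‖p - flip s t p‖ ≤ 2 * |L p|) {α β γ φ : ℝ × ℝ → ℝ}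
    (hα : MemLp α 2 (volume.restrict U)) (hβ : MemLp β 2 (volume.restrict U))
    (hγ : MemLp γ 2 (volume.restrict U))
    (h : ∀ ψ, IsTest U ψ → act U α β γ ψ = 0) (hφ : IsTest P φ) :
    act U α β γ (fun p => φ (flip s t p)) = act U α β γ φ := by
  have hφ' := hP.isTest hφ
  obtain ⟨C, hC⟩ := (hφ.1.of_le (m := 1) (by simp)).lipschitzWith_of_hasCompactSupport hφ.2.1
    (by simp)
  have := act_eq_zero_of_abs_le L hU hUm hfin hα hβ hγ h (hφ.sub hφ') (C := C * 2) (fun p => by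
    have h1 := hC.norm_sub_le p (flip s t p)
    rw [Real.norm_eq_abs] at h1
    refine h1.trans ?_
    rw [mul_assoc]
    exact mul_le_mul_of_nonneg_left (hL p) C.2)
  rw [act_sub_right hα hβ hγ hφ hφ'] at this
  linarith

lemma isFlip_nbX (i : Fin 4) : IsFlip (-1) 1 (sub i) (sub (nbX i)) :=
  ⟨Or.inr rfl, Or.inl rfl, fun p => by
    simp [mem_sub, mem_half, flip, sx_nbX, sy_nbX]⟩

lemma isFlip_nbY (i : Fin 4) : IsFlip 1 (-1) (sub i) (sub (nbY i)) :=
  ⟨Or.inl rfl, Or.inr rfl, fun p => by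
    simp [mem_sub, mem_half, flip, sx_nbY, sy_nbY]⟩

lemma isFlip_Omega : IsFlip (-1) (-1) Omega Omega :=
  ⟨Or.inr rfl, Or.inr rfl, fun p => by
    simp only [Omega, flip, mem_prod, mem_Ioo]
    constructor <;> rintro ⟨⟨h1, h2⟩, h3, h4⟩ <;> refine ⟨⟨?_, ?_⟩, ?_, ?_⟩ <;> linarith⟩

lemma isFlip_univ : IsFlip (-1) (-1) univ univ :=
  ⟨Or.inr rfl, Or.inr rfl, fun p => by simp⟩

lemma isFlip_patch_nbX (i : Fin 4) : IsFlip (-1) 1 (patch i (nbX i)) (patch i (nbX i)) :=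
  ⟨Or.inr rfl, Or.inl rfl, fun p => by
    rw [patch_nbX]
    simp only [flip, mem_prod, mem_Ioo, one_mul]
    constructor <;> rintro ⟨⟨h1, h2⟩, h3⟩ <;> refine ⟨⟨?_, ?_⟩, h3⟩ <;> linarith⟩

lemma isFlip_patch_nbY (i : Fin 4) : IsFlip 1 (-1) (patch i (nbY i)) (patch i (nbY i)) :=
  ⟨Or.inl rfl, Or.inr rfl, fun p => by
    rw [patch_nbY]
    simp only [flip, mem_prod, mem_Ioo, one_mul]
    constructor <;> rintro ⟨h3, h1, h2⟩ <;> refine ⟨h3, ?_, ?_⟩ <;> linarith⟩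

lemma sub_iff_patch_nbX (i : Fin 4) (p : ℝ × ℝ) :
    p ∈ sub i ↔ p ∈ patch i (nbX i) ∧ 0 < (sx i • ContinuousLinearMap.fst ℝ ℝ ℝ) p := by
  rw [mem_sub, patch_nbX, mem_prod, mem_half (s := sx i), mem_Ioo]
  simp only [smul_apply, ContinuousLinearMap.coe_fst', smul_eq_mul]
  rcases sx_cases i with h | h <;> rw [h] <;> constructor
  all_goals
    try rintro ⟨⟨h1, h2⟩, h3⟩
    try obtain ⟨⟨h1, h2⟩, h4⟩ := h1
  all_goals
    first
    | exact ⟨⟨⟨by linarith, by linarith⟩, h3⟩, by linarith⟩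
    | exact ⟨⟨by linarith, by linarith⟩, h2⟩

lemma sub_iff_patch_nbY (i : Fin 4) (p : ℝ × ℝ) :
    p ∈ sub i ↔ p ∈ patch i (nbY i) ∧ 0 < (sy i • ContinuousLinearMap.snd ℝ ℝ ℝ) p := by
  rw [mem_sub, patch_nbY, mem_prod, mem_half (s := sy i), mem_Ioo]
  simp only [smul_apply, ContinuousLinearMap.coe_snd', smul_eq_mul]
  rcases sy_cases i with h | h <;> rw [h] <;> constructor
  all_goals
    try rintro ⟨h1, h2, h3⟩
  all_goals
    first
    | exact ⟨⟨h1, by linarith, by linarith⟩, by linarith⟩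
    | (rintro ⟨⟨h1, h2, h4⟩, h3⟩; exact ⟨h1, by linarith, by linarith⟩)

lemma sub_subset_patch_nbX (i : Fin 4) : sub i ⊆ patch i (nbX i) := fun p hp =>
  ((sub_iff_patch_nbX i p).1 hp).1

lemma sub_subset_patch_nbY (i : Fin 4) : sub i ⊆ patch i (nbY i) := fun p hp =>
  ((sub_iff_patch_nbY i p).1 hp).1

lemma act_flipX {i : Fin 4} {α β γ φ : ℝ × ℝ → ℝ}
    (hα : MemLp α 2 (volume.restrict (sub i))) (hβ : MemLp β 2 (volume.restrict (sub i)))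
    (hγ : MemLp γ 2 (volume.restrict (sub i)))
    (h : ∀ ψ, IsTest (sub i) ψ → act (sub i) α β γ ψ = 0) (hφ : IsTest (patch i (nbX i)) φ) :
    act (sub i) α β γ (fun p => φ (flip (-1) 1 p)) = act (sub i) α β γ φ :=
  act_flip_eq (isFlip_patch_nbX i) _ (sub_iff_patch_nbX i) (isOpen_sub i).measurableSet
    (volume_sub_ne_top i) (fun p => by
      rcases sx_cases i with h | h <;>
        simp [flip, h, Prod.norm_def, ← two_mul]) hα hβ hγ h hφ

lemma act_flipY {i : Fin 4} {α β γ φ : ℝ × ℝ → ℝ}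
    (hα : MemLp α 2 (volume.restrict (sub i))) (hβ : MemLp β 2 (volume.restrict (sub i)))
    (hγ : MemLp γ 2 (volume.restrict (sub i)))
    (h : ∀ ψ, IsTest (sub i) ψ → act (sub i) α β γ ψ = 0) (hφ : IsTest (patch i (nbY i)) φ) :
    act (sub i) α β γ (fun p => φ (flip 1 (-1) p)) = act (sub i) α β γ φ :=
  act_flip_eq (isFlip_patch_nbY i) _ (sub_iff_patch_nbY i) (isOpen_sub i).measurableSet
    (volume_sub_ne_top i) (fun p => by
      rcases sy_cases i with h | h <;>
        simp [flip, h, Prod.norm_def, ← two_mul]) hα hβ hγ h hφ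

/-! ### Operations on Sobolev functions -/

section Pairings
variable {U : Set (ℝ × ℝ)}

lemma memLp_zero_fun : MemLp (fun _ : ℝ × ℝ => (0 : ℝ)) 2 (volume.restrict U) := MemLp.zero'

lemma integrable_mul_fun {f g : ℝ × ℝ → ℝ} (hf : MemLp f 2 (volume.restrict U))
    (hg : MemLp g 2 (volume.restrict U)) :
    Integrable (fun p => f p * g p) (volume.restrict U) := hf.integrable_mul hg

/-- The distribution `φ ↦ ∫_U ∂_x (w φ)`, which is carried by the boundary of `U`. -/
def pairX (w : H1 U) (φ : ℝ × ℝ → ℝ) : ℝ := act U w.dx w.val (fun _ => 0) φ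

/-- The distribution `φ ↦ ∫_U ∂_y (w φ)`, which is carried by the boundary of `U`. -/
def pairY (w : H1 U) (φ : ℝ × ℝ → ℝ) : ℝ := act U w.dy (fun _ => 0) w.val φ

lemma pairX_eq (w : H1 U) (φ : ℝ × ℝ → ℝ) :
    pairX w φ = ∫ p in U, (w.val p * pdx φ p + w.dx p * φ p) :=
  integral_congr_ae (Eventually.of_forall fun p => by simp only; ring)

lemma pairY_eq (w : H1 U) (φ : ℝ × ℝ → ℝ) :
    pairY w φ = ∫ p in U, (w.val p * pdy φ p + w.dy p * φ p) :=
  integral_congr_ae (Eventually.of_forall fun p => by simp only; ring)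

lemma normalPairing_eq (w : HDelta U) (φ : ℝ × ℝ → ℝ) :
    normalPairing w φ = act U w.lap w.dx w.dy φ :=
  integral_congr_ae (Eventually.of_forall fun p => by simp only; ring)

lemma weakX_iff {f d φ : ℝ × ℝ → ℝ} {P : Set (ℝ × ℝ)} (hf : MemLp f 2 (volume.restrict U))
    (hd : MemLp d 2 (volume.restrict U)) (hφ : IsTest P φ) :
    ∫ p in U, f p * pdx φ p = -∫ p in U, d p * φ p ↔ act U d f (fun _ => 0) φ = 0 := by
  have : act U d f (fun _ => 0) φ = (∫ p in U, d p * φ p) + ∫ p in U, f p * pdx φ p := by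
    rw [← integral_add (integrable_mul_fun hd (hφ.memLp U))
      (integrable_mul_fun hf (hφ.pdx.memLp U))]
    exact integral_congr_ae (Eventually.of_forall fun p => by simp)
  rw [this]
  constructor <;> intro h <;> linarith

lemma weakY_iff {f d φ : ℝ × ℝ → ℝ} {P : Set (ℝ × ℝ)} (hf : MemLp f 2 (volume.restrict U))
    (hd : MemLp d 2 (volume.restrict U)) (hφ : IsTest P φ) :
    ∫ p in U, f p * pdy φ p = -∫ p in U, d p * φ p ↔ act U d (fun _ => 0) f φ = 0 := by
  have : act U d (fun _ => 0) f φ = (∫ p in U, d p * φ p) + ∫ p in U, f p * pdy φ p := by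
    rw [← integral_add (integrable_mul_fun hd (hφ.memLp U))
      (integrable_mul_fun hf (hφ.pdy.memLp U))]
    exact integral_congr_ae (Eventually.of_forall fun p => by simp)
  rw [this]
  constructor <;> intro h <;> linarith

lemma weakLap_iff {l a b φ : ℝ × ℝ → ℝ} {P : Set (ℝ × ℝ)} (hl : MemLp l 2 (volume.restrict U))
    (ha : MemLp a 2 (volume.restrict U)) (hb : MemLp b 2 (volume.restrict U))
    (hφ : IsTest P φ) :
    ∫ p in U, (a p * pdx φ p + b p * pdy φ p) = -∫ p in U, l p * φ p ↔ act U l a b φ = 0 := by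
  have : act U l a b φ =
      (∫ p in U, l p * φ p) + ∫ p in U, (a p * pdx φ p + b p * pdy φ p) := by
    rw [← integral_add (integrable_mul_fun hl (hφ.memLp U))
      (f := fun p => l p * φ p) (g := fun p => a p * pdx φ p + b p * pdy φ p)
      ((integrable_mul_fun ha (hφ.pdx.memLp U)).add (integrable_mul_fun hb (hφ.pdy.memLp U)))]
    exact integral_congr_ae (Eventually.of_forall fun p => by simp only; ring)
  rw [this]
  constructor <;> intro h <;> linarith

lemma pairX_eq_zero (w : H1 U) {φ : ℝ × ℝ → ℝ} (hφ : IsTest U φ) : pairX w φ = 0 :=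
  (weakX_iff w.memLp_val w.memLp_dx hφ).1 (w.weak_dx φ hφ)

lemma pairY_eq_zero (w : H1 U) {φ : ℝ × ℝ → ℝ} (hφ : IsTest U φ) : pairY w φ = 0 :=
  (weakY_iff w.memLp_val w.memLp_dy hφ).1 (w.weak_dy φ hφ)

lemma normalPairing_eq_zero (w : HDelta U) {φ : ℝ × ℝ → ℝ} (hφ : IsTest U φ) :
    normalPairing w φ = 0 := by
  rw [normalPairing_eq]
  exact (weakLap_iff w.memLp_lap w.memLp_dx w.memLp_dy hφ).1 (w.weak_lap φ hφ)

lemma MemLp.comb {f g : ℝ × ℝ → ℝ} (hf : MemLp f 2 (volume.restrict U))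
    (hg : MemLp g 2 (volume.restrict U)) (a b : ℝ) :
    MemLp (fun p => a * f p + b * g p) 2 (volume.restrict U) :=
  (hf.const_mul a).add (hg.const_mul b)

/-- The linear combination `a u + b v`. -/
def H1.comb (a : ℝ) (u : H1 U) (b : ℝ) (v : H1 U) : H1 U where
  val p := a * u.val p + b * v.val p
  dx p := a * u.dx p + b * v.dx p
  dy p := a * u.dy p + b * v.dy p
  memLp_val := MemLp.comb u.memLp_val v.memLp_val a b
  memLp_dx := MemLp.comb u.memLp_dx v.memLp_dx a b
  memLp_dy := MemLp.comb u.memLp_dy v.memLp_dy a b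
  weak_dx φ hφ := by
    rw [weakX_iff (MemLp.comb u.memLp_val v.memLp_val a b)
      (MemLp.comb u.memLp_dx v.memLp_dx a b) hφ]
    have := act_comb u.memLp_dx u.memLp_val memLp_zero_fun v.memLp_dx v.memLp_val
      memLp_zero_fun hφ a b
    simp only [mul_zero, add_zero] at this
    rw [this]
    have h1 := pairX_eq_zero u hφ
    have h2 := pairX_eq_zero v hφ
    rw [pairX] at h1 h2
    rw [h1, h2]
    ring
  weak_dy φ hφ := by
    rw [weakY_iff (MemLp.comb u.memLp_val v.memLp_val a b)
      (MemLp.comb u.memLp_dy v.memLp_dy a b) hφ]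
    have := act_comb u.memLp_dy memLp_zero_fun u.memLp_val v.memLp_dy
      memLp_zero_fun v.memLp_val hφ a b
    simp only [mul_zero, add_zero] at this
    rw [this]
    have h1 := pairY_eq_zero u hφ
    have h2 := pairY_eq_zero v hφ
    rw [pairY] at h1 h2
    rw [h1, h2]
    ring

/-- The linear combination `a u + b v`. -/
def HDelta.comb (a : ℝ) (u : HDelta U) (b : ℝ) (v : HDelta U) : HDelta U where
  toH1 := H1.comb a u.toH1 b v.toH1
  lap p := a * u.lap p + b * v.lap p
  memLp_lap := MemLp.comb u.memLp_lap v.memLp_lap a b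
  weak_lap φ hφ := by
    rw [weakLap_iff (MemLp.comb u.memLp_lap v.memLp_lap a b)
      (H1.comb a u.toH1 b v.toH1).memLp_dx (H1.comb a u.toH1 b v.toH1).memLp_dy hφ]
    have := act_comb u.memLp_lap u.memLp_dx u.memLp_dy v.memLp_lap v.memLp_dx v.memLp_dy hφ a b
    simp only [H1.comb]
    rw [this, ← normalPairing_eq, ← normalPairing_eq, normalPairing_eq_zero u hφ,
      normalPairing_eq_zero v hφ]
    ring

lemma pairX_comb {P : Set (ℝ × ℝ)} {φ : ℝ × ℝ → ℝ} (hφ : IsTest P φ) (a : ℝ) (u : H1 U) (b : ℝ)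
    (v : H1 U) : pairX (H1.comb a u b v) φ = a * pairX u φ + b * pairX v φ := by
  have := act_comb u.memLp_dx u.memLp_val memLp_zero_fun v.memLp_dx v.memLp_val
    memLp_zero_fun hφ a b
  simp only [mul_zero, add_zero] at this
  exact this

lemma pairY_comb {P : Set (ℝ × ℝ)} {φ : ℝ × ℝ → ℝ} (hφ : IsTest P φ) (a : ℝ) (u : H1 U) (b : ℝ)
    (v : H1 U) : pairY (H1.comb a u b v) φ = a * pairY u φ + b * pairY v φ := by
  have := act_comb u.memLp_dy memLp_zero_fun u.memLp_val v.memLp_dy memLp_zero_fun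
    v.memLp_val hφ a b
  simp only [mul_zero, add_zero] at this
  exact this

lemma normalPairing_comb {P : Set (ℝ × ℝ)} {φ : ℝ × ℝ → ℝ} (hφ : IsTest P φ) (a : ℝ)
    (u : HDelta U) (b : ℝ) (v : HDelta U) :
    normalPairing (HDelta.comb a u b v) φ = a * normalPairing u φ + b * normalPairing v φ := by
  simp only [normalPairing_eq]
  exact act_comb u.memLp_lap u.memLp_dx u.memLp_dy v.memLp_lap v.memLp_dx v.memLp_dy hφ a b

lemma H1.deriv_ae_zero (hU : IsOpen U) [IsFiniteMeasure (volume.restrict U)] (w : H1 U)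
    (h : w.val =ᵐ[volume.restrict U] 0) :
    w.dx =ᵐ[volume.restrict U] 0 ∧ w.dy =ᵐ[volume.restrict U] 0 := by
  constructor
  · refine ae_eq_zero_of_test hU (w.memLp_dx.integrable one_le_two) fun φ hφ => ?_
    have h1 := w.weak_dx φ hφ
    rw [integral_congr_ae (g := fun _ => (0 : ℝ))] at h1
    · simpa using h1.symm
    · filter_upwards [h] with p hp
      simp [hp]
  · refine ae_eq_zero_of_test hU (w.memLp_dy.integrable one_le_two) fun φ hφ => ?_
    have h1 := w.weak_dy φ hφ
    rw [integral_congr_ae (g := fun _ => (0 : ℝ))] at h1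
    · simpa using h1.symm
    · filter_upwards [h] with p hp
      simp [hp]

lemma HDelta.lap_ae_zero (hU : IsOpen U) [IsFiniteMeasure (volume.restrict U)] (w : HDelta U)
    (h : w.val =ᵐ[volume.restrict U] 0) : w.lap =ᵐ[volume.restrict U] 0 := by
  obtain ⟨h1, h2⟩ := w.toH1.deriv_ae_zero hU h
  refine ae_eq_zero_of_test hU (w.memLp_lap.integrable one_le_two) fun φ hφ => ?_
  have h3 := w.weak_lap φ hφ
  rw [integral_congr_ae (g := fun _ => (0 : ℝ))] at h3
  · simpa using h3.symm
  · filter_upwards [h1, h2] with p hp hp'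
    simp [hp, hp']

/-- Equality of elements of `H¹(U)`. -/
structure H1.Eqv (u v : H1 U) : Prop where
  val : u.val =ᵐ[volume.restrict U] v.val
  dx : u.dx =ᵐ[volume.restrict U] v.dx
  dy : u.dy =ᵐ[volume.restrict U] v.dy

lemma H1.Eqv.of_val (hU : IsOpen U) [IsFiniteMeasure (volume.restrict U)] {u v : H1 U}
    (h : u.val =ᵐ[volume.restrict U] v.val) : u.Eqv v := by
  obtain ⟨h1, h2⟩ := (H1.comb 1 u (-1) v).deriv_ae_zero hU (by
    filter_upwards [h] with p hp
    simp [H1.comb, hp])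
  refine ⟨h, ?_, ?_⟩
  · filter_upwards [h1] with p hp
    simp only [H1.comb, Pi.zero_apply] at hp
    linarith
  · filter_upwards [h2] with p hp
    simp only [H1.comb, Pi.zero_apply] at hp
    linarith

lemma HDelta.lap_congr (hU : IsOpen U) [IsFiniteMeasure (volume.restrict U)] {u v : HDelta U}
    (h : u.val =ᵐ[volume.restrict U] v.val) : u.lap =ᵐ[volume.restrict U] v.lap := by
  have h1 := (HDelta.comb 1 u (-1) v).lap_ae_zero hU (by
    filter_upwards [h] with p hp
    simp [H1.comb, HDelta.comb, hp])
  filter_upwards [h1] with p hp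
  simp only [HDelta.comb, Pi.zero_apply] at hp
  linarith

lemma pairX_congr (hU : IsOpen U) [IsFiniteMeasure (volume.restrict U)] {u v : H1 U}
    (h : u.val =ᵐ[volume.restrict U] v.val) (φ : ℝ × ℝ → ℝ) : pairX u φ = pairX v φ :=
  act_congr (H1.Eqv.of_val hU h).dx h (ae_eq_refl _) φ

lemma pairY_congr (hU : IsOpen U) [IsFiniteMeasure (volume.restrict U)] {u v : H1 U}
    (h : u.val =ᵐ[volume.restrict U] v.val) (φ : ℝ × ℝ → ℝ) : pairY u φ = pairY v φ :=
  act_congr (H1.Eqv.of_val hU h).dy (ae_eq_refl _) h φ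

lemma normalPairing_congr (hU : IsOpen U) [IsFiniteMeasure (volume.restrict U)] {u v : HDelta U}
    (h : u.val =ᵐ[volume.restrict U] v.val) (φ : ℝ × ℝ → ℝ) :
    normalPairing u φ = normalPairing v φ := by
  rw [normalPairing_eq, normalPairing_eq]
  exact act_congr (HDelta.lap_congr hU h) (H1.Eqv.of_val hU h).dx (H1.Eqv.of_val hU h).dy φ

/-! ### Reflection and restriction of Sobolev functions -/

variable {V : Set (ℝ × ℝ)} {s t : ℝ}

lemma integral_pullX (h : IsFlip s t U V) {P : Set (ℝ × ℝ)} (f d : ℝ × ℝ → ℝ) {φ : ℝ × ℝ → ℝ}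
    (hφ : IsTest P φ) :
    act U (fun p => s * d (flip s t p)) (fun p => f (flip s t p)) (fun _ => 0) φ =
      s * act V d f (fun _ => 0) (fun p => φ (flip s t p)) := by
  have h1 := h.act (fun p => s * d p) (fun p => s * f p) (fun _ => 0) hφ
  simp only [← mul_assoc, h.mul_self_left, one_mul, mul_zero] at h1
  rw [h1, act, act, ← integral_const_mul]
  exact integral_congr_ae (Eventually.of_forall fun p => by simp only; ring)

lemma integral_pullY (h : IsFlip s t U V) {P : Set (ℝ × ℝ)} (f d : ℝ × ℝ → ℝ) {φ : ℝ × ℝ → ℝ}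
    (hφ : IsTest P φ) :
    act U (fun p => t * d (flip s t p)) (fun _ => 0) (fun p => f (flip s t p)) φ =
      t * act V d (fun _ => 0) f (fun p => φ (flip s t p)) := by
  have h1 := h.act (fun p => t * d p) (fun _ => 0) (fun p => t * f p) hφ
  simp only [← mul_assoc, h.mul_self_right, one_mul, mul_zero] at h1
  rw [h1, act, act, ← integral_const_mul]
  exact integral_congr_ae (Eventually.of_forall fun p => by simp only; ring)

/-- The composition of a Sobolev function with a sign change of the coordinates. -/
def H1.pull (h : IsFlip s t U V) (w : H1 V) : H1 U where
  val p := w.val (flip s t p)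
  dx p := s * w.dx (flip s t p)
  dy p := t * w.dy (flip s t p)
  memLp_val := h.memLp w.memLp_val
  memLp_dx := (h.memLp w.memLp_dx).const_mul s
  memLp_dy := (h.memLp w.memLp_dy).const_mul t
  weak_dx φ hφ := by
    rw [weakX_iff (h.memLp w.memLp_val) ((h.memLp w.memLp_dx).const_mul s) hφ,
      integral_pullX h _ _ hφ]
    have := pairX_eq_zero w (h.symm.isTest hφ)
    rw [pairX] at this
    rw [this, mul_zero]
  weak_dy φ hφ := by
    rw [weakY_iff (h.memLp w.memLp_val) ((h.memLp w.memLp_dy).const_mul t) hφ,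
      integral_pullY h _ _ hφ]
    have := pairY_eq_zero w (h.symm.isTest hφ)
    rw [pairY] at this
    rw [this, mul_zero]

/-- The composition of a Sobolev function with a sign change of the coordinates. -/
def HDelta.pull (h : IsFlip s t U V) (w : HDelta V) : HDelta U where
  toH1 := w.toH1.pull h
  lap p := w.lap (flip s t p)
  memLp_lap := h.memLp w.memLp_lap
  weak_lap φ hφ := by
    rw [weakLap_iff (h.memLp w.memLp_lap) (w.toH1.pull h).memLp_dx (w.toH1.pull h).memLp_dy hφ]
    simp only [H1.pull]
    rw [h.act _ _ _ hφ, ← normalPairing_eq, normalPairing_eq_zero w (h.symm.isTest hφ)]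

lemma pairX_pull {P : Set (ℝ × ℝ)} {φ : ℝ × ℝ → ℝ} (hφ : IsTest P φ) (h : IsFlip s t U V)
    (w : H1 V) : pairX (w.pull h) φ = s * pairX w (fun p => φ (flip s t p)) :=
  integral_pullX h _ _ hφ

lemma pairY_pull {P : Set (ℝ × ℝ)} {φ : ℝ × ℝ → ℝ} (hφ : IsTest P φ) (h : IsFlip s t U V)
    (w : H1 V) : pairY (w.pull h) φ = t * pairY w (fun p => φ (flip s t p)) :=
  integral_pullY h _ _ hφ

lemma normalPairing_pull {P : Set (ℝ × ℝ)} {φ : ℝ × ℝ → ℝ} (hφ : IsTest P φ)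
    (h : IsFlip s t U V) (w : HDelta V) :
    normalPairing (w.pull h) φ = normalPairing w (fun p => φ (flip s t p)) := by
  rw [normalPairing_eq, normalPairing_eq]
  exact h.act _ _ _ hφ

/-- The restriction of a Sobolev function to a smaller set. -/
def H1.res (hV : MeasurableSet V) (h : U ⊆ V) (w : H1 V) : H1 U where
  val := w.val
  dx := w.dx
  dy := w.dy
  memLp_val := w.memLp_val.mono_measure (Measure.restrict_mono_set _ h)
  memLp_dx := w.memLp_dx.mono_measure (Measure.restrict_mono_set _ h)
  memLp_dy := w.memLp_dy.mono_measure (Measure.restrict_mono_set _ h)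
  weak_dx φ hφ := by
    rw [weakX_iff (w.memLp_val.mono_measure (Measure.restrict_mono_set _ h))
      (w.memLp_dx.mono_measure (Measure.restrict_mono_set _ h)) hφ,
      ← act_eq_of_subset hV h hφ]
    exact pairX_eq_zero w (hφ.mono h)
  weak_dy φ hφ := by
    rw [weakY_iff (w.memLp_val.mono_measure (Measure.restrict_mono_set _ h))
      (w.memLp_dy.mono_measure (Measure.restrict_mono_set _ h)) hφ,
      ← act_eq_of_subset hV h hφ]
    exact pairY_eq_zero w (hφ.mono h)

/-- The restriction of a Sobolev function to a smaller set. -/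
def HDelta.res (hV : MeasurableSet V) (h : U ⊆ V) (w : HDelta V) : HDelta U where
  toH1 := w.toH1.res hV h
  lap := w.lap
  memLp_lap := w.memLp_lap.mono_measure (Measure.restrict_mono_set _ h)
  weak_lap φ hφ := by
    rw [weakLap_iff (w.memLp_lap.mono_measure (Measure.restrict_mono_set _ h))
      (w.toH1.res hV h).memLp_dx (w.toH1.res hV h).memLp_dy hφ]
    simp only [H1.res]
    rw [← act_eq_of_subset hV h hφ, ← normalPairing_eq]
    exact normalPairing_eq_zero w (hφ.mono h)

/-- An `H²` function has its Laplacian in `L²`. -/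
lemma MemH2.exists_hDelta {w : H1 U} (hw : MemH2 w) : ∃ W : HDelta U, W.toH1 = w := by
  obtain ⟨wx, wy, hx, hy⟩ := hw
  refine ⟨⟨w, fun p => wx.dx p + wy.dy p, wx.memLp_dx.add wy.memLp_dy, fun φ hφ => ?_⟩, rfl⟩
  have h1 := wx.weak_dx φ hφ
  have h2 := wy.weak_dy φ hφ
  rw [hx] at h1
  rw [hy] at h2
  rw [integral_add (integrable_mul_fun w.memLp_dx (hφ.pdx.memLp U))
    (integrable_mul_fun w.memLp_dy (hφ.pdy.memLp U)), h1, h2, ← neg_add,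
    ← integral_add (integrable_mul_fun wx.memLp_dx (hφ.memLp U))
    (integrable_mul_fun wy.memLp_dy (hφ.memLp U))]
  congr 1
  exact integral_congr_ae (Eventually.of_forall fun p => by simp only; ring)

/-! ### Outer traces -/

variable {Q Q' : Set (ℝ × ℝ)}

lemma hasOuterTrace_iff {w : H1 U} {g : ℝ × ℝ → ℝ} : HasOuterTrace Q w g ↔
    ∀ φ, IsTest Q φ → pairX w φ = boundaryX g φ ∧ pairY w φ = boundaryY g φ := by
  simp only [HasOuterTrace, pairX_eq, pairY_eq]

lemma boundaryX_zero (φ : ℝ × ℝ → ℝ) : boundaryX 0 φ = 0 := by simp [boundaryX]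

lemma boundaryY_zero (φ : ℝ × ℝ → ℝ) : boundaryY 0 φ = 0 := by simp [boundaryY]

lemma hasOuterTrace_zero_iff {w : H1 U} : HasOuterTrace Q w 0 ↔
    ∀ φ, IsTest Q φ → pairX w φ = 0 ∧ pairY w φ = 0 := by
  simp only [hasOuterTrace_iff, boundaryX_zero, boundaryY_zero]

lemma HasOuterTrace.add_zero {w v : H1 U} {g : ℝ × ℝ → ℝ} (hw : HasOuterTrace Q w g)
    (hv : HasOuterTrace Q v 0) (b : ℝ) : HasOuterTrace Q (H1.comb 1 w b v) g := by
  rw [hasOuterTrace_zero_iff] at hv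
  rw [hasOuterTrace_iff] at hw ⊢
  intro φ hφ
  rw [pairX_comb hφ, pairY_comb hφ, (hv φ hφ).1, (hv φ hφ).2, (hw φ hφ).1, (hw φ hφ).2]
  constructor <;> ring

lemma HasOuterTrace.comb_zero {w v : H1 U} (hw : HasOuterTrace Q w 0)
    (hv : HasOuterTrace Q v 0) (a b : ℝ) : HasOuterTrace Q (H1.comb a w b v) 0 := by
  rw [hasOuterTrace_zero_iff] at hv hw ⊢
  intro φ hφ
  rw [pairX_comb hφ, pairY_comb hφ, (hv φ hφ).1, (hv φ hφ).2, (hw φ hφ).1, (hw φ hφ).2]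
  constructor <;> ring

lemma HasOuterTrace.diff {w v : H1 U} {g : ℝ × ℝ → ℝ} (hw : HasOuterTrace Q w g)
    (hv : HasOuterTrace Q v g) : HasOuterTrace Q (H1.comb 1 w (-1) v) 0 := by
  rw [hasOuterTrace_zero_iff]
  rw [hasOuterTrace_iff] at hw hv
  intro φ hφ
  rw [pairX_comb hφ, pairY_comb hφ, (hv φ hφ).1, (hv φ hφ).2, (hw φ hφ).1, (hw φ hφ).2]
  constructor <;> ring

lemma HasOuterTrace.pull {w : H1 V} (hw : HasOuterTrace Q w 0) (h : IsFlip s t U V)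
    (hQ : IsFlip s t Q' Q) : HasOuterTrace Q' (w.pull h) 0 := by
  rw [hasOuterTrace_zero_iff] at hw ⊢
  intro φ hφ
  rw [pairX_pull hφ, pairY_pull hφ, (hw _ (hQ.symm.isTest hφ)).1, (hw _ (hQ.symm.isTest hφ)).2]
  constructor <;> ring

end Pairings

/-- The restriction of a function on the square to a subdomain. -/
def H1.loc (w : H1 Omega) (i : Fin 4) : H1 (MixedNNM.sub i) :=
  w.res isOpen_Omega.measurableSet (sub_subset i)

/-- The restriction of a function on the square to a subdomain. -/
def HDelta.loc (w : HDelta Omega) (i : Fin 4) : HDelta (MixedNNM.sub i) :=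
  w.res isOpen_Omega.measurableSet (sub_subset i)

lemma HasOuterTrace.loc {w : H1 Omega} {g : ℝ × ℝ → ℝ} (hw : HasOuterTrace univ w g)
    (i : Fin 4) : HasOuterTrace (quadrant i) (w.loc i) g := by
  rw [hasOuterTrace_iff] at hw ⊢
  intro φ hφ
  have key : ∀ α β γ : ℝ × ℝ → ℝ, act (MixedNNM.sub i) α β γ φ = act Omega α β γ φ := by
    intro α β γ
    refine (setIntegral_eq_of_subset_of_forall_sdiff_eq_zero isOpen_Omega.measurableSet
      (sub_subset i) fun p hp => ?_).symm
    have hq : p ∉ quadrant i := fun h => hp.2 ⟨hp.1, h⟩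
    rw [hφ.eq_zero hq, hφ.pdx.eq_zero hq, hφ.pdy.eq_zero hq]
    ring
  have h1 : pairX (w.loc i) φ = pairX w φ := key _ _ _
  have h2 : pairY (w.loc i) φ = pairY w φ := key _ _ _
  rw [h1, h2]
  exact hw φ (hφ.mono (subset_univ _))

lemma ae_fst_ne_zero : ∀ᵐ p : ℝ × ℝ, p.1 ≠ 0 := by
  refine measure_mono_null (t := {0} ×ˢ univ) (fun p hp => ?_) ?_
  · simpa using hp
  · rw [Measure.volume_eq_prod, Measure.prod_prod]
    simp

lemma ae_snd_ne_zero : ∀ᵐ p : ℝ × ℝ, p.2 ≠ 0 := by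
  refine measure_mono_null (t := univ ×ˢ {0}) (fun p hp => ?_) ?_
  · simpa using hp
  · rw [Measure.volume_eq_prod, Measure.prod_prod]
    simp

lemma patch_subset_Omega_nbX (i : Fin 4) : patch i (nbX i) ⊆ Omega := by
  rw [patch_nbX]
  refine prod_mono subset_rfl fun y hy => ?_
  rw [mem_half] at hy
  rcases sy_cases i with h | h <;> rw [h] at hy <;> constructor <;> linarith [hy.1, hy.2]

lemma patch_subset_Omega_nbY (i : Fin 4) : patch i (nbY i) ⊆ Omega := by
  rw [patch_nbY]
  refine prod_mono (fun x hx => ?_) subset_rfl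
  rw [mem_half] at hx
  rcases sx_cases i with h | h <;> rw [h] at hx <;> constructor <;> linarith [hx.1, hx.2]

lemma patch_nbX_symm (i : Fin 4) : patch (nbX i) (nbX (nbX i)) = patch i (nbX i) := by
  rw [patch_nbX, patch_nbX, sy_nbX]

lemma patch_nbY_symm (i : Fin 4) : patch (nbY i) (nbY (nbY i)) = patch i (nbY i) := by
  rw [patch_nbY, patch_nbY, sx_nbY]

lemma act_add_nbX (i : Fin 4) {α β γ φ : ℝ × ℝ → ℝ}
    (hα : MemLp α 2 (volume.restrict Omega)) (hβ : MemLp β 2 (volume.restrict Omega))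
    (hγ : MemLp γ 2 (volume.restrict Omega)) (hφ : IsTest (patch i (nbX i)) φ) :
    act (sub i) α β γ φ + act (sub (nbX i)) α β γ φ = act Omega α β γ φ := by
  have hint := act_integrable hα hβ hγ hφ
  have hdisj : Disjoint (sub i) (sub (nbX i)) := by
    rw [Set.disjoint_left]
    intro p h1 h2
    have h3 := ((mem_sub _ p).1 h1).1.1
    have h4 := ((mem_sub _ p).1 h2).1.1
    rw [sx_nbX] at h4
    linarith
  rw [act_eq_of_subset isOpen_Omega.measurableSet (patch_subset_Omega_nbX i) hφ]
  unfold act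
  rw [← setIntegral_union hdisj (isOpen_sub _).measurableSet
    (IntegrableOn.mono_set hint (sub_subset i)) (IntegrableOn.mono_set hint (sub_subset _))]
  refine setIntegral_congr_set ?_
  filter_upwards [ae_fst_ne_zero] with p hp
  refine propext ⟨?_, fun h => ?_⟩
  · rintro (h | h)
    · exact sub_subset_patch_nbX i h
    · have := sub_subset_patch_nbX _ h
      rwa [patch_nbX_symm] at this
  · by_cases hs : 0 < sx i * p.1
    · exact Or.inl ((sub_iff_patch_nbX i p).2 ⟨h, by simpa using hs⟩)
    · refine Or.inr ((sub_iff_patch_nbX _ p).2 ⟨(patch_nbX_symm i).symm ▸ h, ?_⟩)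
      have h1 : sx i * p.1 ≠ 0 := mul_ne_zero (by
        rcases sx_cases i with h | h <;> rw [h] <;> norm_num) hp
      have h2 : sx i * p.1 < 0 := lt_of_le_of_ne (not_lt.1 hs) h1
      simpa [sx_nbX] using h2

lemma act_add_nbY (i : Fin 4) {α β γ φ : ℝ × ℝ → ℝ}
    (hα : MemLp α 2 (volume.restrict Omega)) (hβ : MemLp β 2 (volume.restrict Omega))
    (hγ : MemLp γ 2 (volume.restrict Omega)) (hφ : IsTest (patch i (nbY i)) φ) :
    act (sub i) α β γ φ + act (sub (nbY i)) α β γ φ = act Omega α β γ φ := by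
  have hint := act_integrable hα hβ hγ hφ
  have hdisj : Disjoint (sub i) (sub (nbY i)) := by
    rw [Set.disjoint_left]
    intro p h1 h2
    have h3 := ((mem_sub _ p).1 h1).2.1
    have h4 := ((mem_sub _ p).1 h2).2.1
    rw [sy_nbY] at h4
    linarith
  rw [act_eq_of_subset isOpen_Omega.measurableSet (patch_subset_Omega_nbY i) hφ]
  unfold act
  rw [← setIntegral_union hdisj (isOpen_sub _).measurableSet
    (IntegrableOn.mono_set hint (sub_subset i)) (IntegrableOn.mono_set hint (sub_subset _))]
  refine setIntegral_congr_set ?_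
  filter_upwards [ae_snd_ne_zero] with p hp
  refine propext ⟨?_, fun h => ?_⟩
  · rintro (h | h)
    · exact sub_subset_patch_nbY i h
    · have := sub_subset_patch_nbY _ h
      rwa [patch_nbY_symm] at this
  · by_cases hs : 0 < sy i * p.2
    · exact Or.inl ((sub_iff_patch_nbY i p).2 ⟨h, by simpa using hs⟩)
    · refine Or.inr ((sub_iff_patch_nbY _ p).2 ⟨(patch_nbY_symm i).symm ▸ h, ?_⟩)
      have h1 : sy i * p.2 ≠ 0 := mul_ne_zero (by
        rcases sy_cases i with h | h <;> rw [h] <;> norm_num) hp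
      have h2 : sy i * p.2 < 0 := lt_of_le_of_ne (not_lt.1 hs) h1
      simpa [sy_nbY] using h2

/-! ### Traces and normal derivatives from the two sides of an interface -/

lemma pairX_loc_add (w : H1 Omega) (i : Fin 4) {φ : ℝ × ℝ → ℝ}
    (hφ : IsTest (patch i (nbX i)) φ) :
    pairX (w.loc i) φ + pairX (w.loc (nbX i)) φ = 0 := by
  refine (act_add_nbX i w.memLp_dx w.memLp_val memLp_zero_fun hφ).trans ?_
  exact pairX_eq_zero w (hφ.mono (patch_subset_Omega_nbX i))

lemma pairY_loc_add (w : H1 Omega) (i : Fin 4) {φ : ℝ × ℝ → ℝ}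
    (hφ : IsTest (patch i (nbY i)) φ) :
    pairY (w.loc i) φ + pairY (w.loc (nbY i)) φ = 0 := by
  refine (act_add_nbY i w.memLp_dy memLp_zero_fun w.memLp_val hφ).trans ?_
  exact pairY_eq_zero w (hφ.mono (patch_subset_Omega_nbY i))

lemma normalPairing_loc_addX (w : HDelta Omega) (i : Fin 4) {φ : ℝ × ℝ → ℝ}
    (hφ : IsTest (patch i (nbX i)) φ) :
    normalPairing (w.loc i) φ + normalPairing (w.loc (nbX i)) φ = 0 := by
  rw [normalPairing_eq, normalPairing_eq]
  refine (act_add_nbX i w.memLp_lap w.memLp_dx w.memLp_dy hφ).trans ?_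
  rw [← normalPairing_eq]
  exact normalPairing_eq_zero w (hφ.mono (patch_subset_Omega_nbX i))

lemma normalPairing_loc_addY (w : HDelta Omega) (i : Fin 4) {φ : ℝ × ℝ → ℝ}
    (hφ : IsTest (patch i (nbY i)) φ) :
    normalPairing (w.loc i) φ + normalPairing (w.loc (nbY i)) φ = 0 := by
  rw [normalPairing_eq, normalPairing_eq]
  refine (act_add_nbY i w.memLp_lap w.memLp_dx w.memLp_dy hφ).trans ?_
  rw [← normalPairing_eq]
  exact normalPairing_eq_zero w (hφ.mono (patch_subset_Omega_nbY i))

/-- The mirror image in `Ω_i` of a function on the neighbour across the vertical interface. -/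
def reflX (i : Fin 4) (w : HDelta (sub (nbX i))) : HDelta (sub i) := w.pull (isFlip_nbX i)

/-- The mirror image in `Ω_i` of a function on the neighbour across the horizontal interface. -/
def reflY (i : Fin 4) (w : HDelta (sub (nbY i))) : HDelta (sub i) := w.pull (isFlip_nbY i)

lemma pairX_flip (i : Fin 4) (w : H1 (sub i)) {φ : ℝ × ℝ → ℝ}
    (hφ : IsTest (patch i (nbX i)) φ) :
    pairX w (fun p => φ (flip (-1) 1 p)) = pairX w φ :=
  act_flipX w.memLp_dx w.memLp_val memLp_zero_fun (fun _ h => pairX_eq_zero w h) hφ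

lemma pairY_flip (i : Fin 4) (w : H1 (sub i)) {φ : ℝ × ℝ → ℝ}
    (hφ : IsTest (patch i (nbY i)) φ) :
    pairY w (fun p => φ (flip 1 (-1) p)) = pairY w φ :=
  act_flipY w.memLp_dy memLp_zero_fun w.memLp_val (fun _ h => pairY_eq_zero w h) hφ

lemma normalPairing_flipX (i : Fin 4) (w : HDelta (sub i)) {φ : ℝ × ℝ → ℝ}
    (hφ : IsTest (patch i (nbX i)) φ) :
    normalPairing w (fun p => φ (flip (-1) 1 p)) = normalPairing w φ := by
  rw [normalPairing_eq, normalPairing_eq]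
  exact act_flipX w.memLp_lap w.memLp_dx w.memLp_dy
    (fun ψ h => by rw [← normalPairing_eq]; exact normalPairing_eq_zero w h) hφ

lemma normalPairing_flipY (i : Fin 4) (w : HDelta (sub i)) {φ : ℝ × ℝ → ℝ}
    (hφ : IsTest (patch i (nbY i)) φ) :
    normalPairing w (fun p => φ (flip 1 (-1) p)) = normalPairing w φ := by
  rw [normalPairing_eq, normalPairing_eq]
  exact act_flipY w.memLp_lap w.memLp_dx w.memLp_dy
    (fun ψ h => by rw [← normalPairing_eq]; exact normalPairing_eq_zero w h) hφ

lemma pairX_reflX (i : Fin 4) (w : HDelta (sub (nbX i))) {φ : ℝ × ℝ → ℝ}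
    (hφ : IsTest (patch i (nbX i)) φ) :
    pairX (reflX i w).toH1 φ = -pairX w.toH1 φ := by
  have h := pairX_pull hφ (isFlip_nbX i) w.toH1
  rw [pairX_flip (nbX i) w.toH1 (by rwa [patch_nbX_symm]), neg_one_mul] at h
  exact h

lemma pairY_reflY (i : Fin 4) (w : HDelta (sub (nbY i))) {φ : ℝ × ℝ → ℝ}
    (hφ : IsTest (patch i (nbY i)) φ) :
    pairY (reflY i w).toH1 φ = -pairY w.toH1 φ := by
  have h := pairY_pull hφ (isFlip_nbY i) w.toH1
  rw [pairY_flip (nbY i) w.toH1 (by rwa [patch_nbY_symm]), neg_one_mul] at h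
  exact h

lemma normalPairing_reflX (i : Fin 4) (w : HDelta (sub (nbX i))) {φ : ℝ × ℝ → ℝ}
    (hφ : IsTest (patch i (nbX i)) φ) :
    normalPairing (reflX i w) φ = normalPairing w φ := by
  have h := normalPairing_pull hφ (isFlip_nbX i) w
  rwa [normalPairing_flipX (nbX i) w (by rwa [patch_nbX_symm])] at h

lemma normalPairing_reflY (i : Fin 4) (w : HDelta (sub (nbY i))) {φ : ℝ × ℝ → ℝ}
    (hφ : IsTest (patch i (nbY i)) φ) :
    normalPairing (reflY i w) φ = normalPairing w φ := by
  have h := normalPairing_pull hφ (isFlip_nbY i) w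
  rwa [normalPairing_flipY (nbY i) w (by rwa [patch_nbY_symm])] at h

lemma isFlip_quadrant_nbX (i : Fin 4) : IsFlip (-1) 1 (quadrant i) (quadrant (nbX i)) :=
  ⟨Or.inr rfl, Or.inl rfl, fun p => by simp [mem_quadrant, flip, sx_nbX, sy_nbX]⟩

lemma isFlip_quadrant_nbY (i : Fin 4) : IsFlip 1 (-1) (quadrant i) (quadrant (nbY i)) :=
  ⟨Or.inl rfl, Or.inr rfl, fun p => by simp [mem_quadrant, flip, sx_nbY, sy_nbY]⟩

/-! ### The steps of the method -/

lemma tracePairing_nbX (i : Fin 4) (w : H1 (sub i)) (φ : ℝ × ℝ → ℝ) :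
    tracePairing (nbX i) w φ = -sx i * pairX w φ := by
  rw [tracePairing, normal_nbX, pairX_eq]
  ring

lemma tracePairing_nbX' (i : Fin 4) (w : H1 (sub (nbX i))) (φ : ℝ × ℝ → ℝ) :
    tracePairing i w φ = sx i * pairX w φ := by
  have := tracePairing_nbX (nbX i) w φ
  rw [nbX_nbX, sx_nbX, neg_neg] at this
  exact this

lemma tracePairing_nbY (i : Fin 4) (w : H1 (sub i)) (φ : ℝ × ℝ → ℝ) :
    tracePairing (nbY i) w φ = -sy i * pairY w φ := by
  rw [tracePairing, normal_nbY, pairY_eq]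
  ring

lemma tracePairing_nbY' (i : Fin 4) (w : H1 (sub (nbY i))) (φ : ℝ × ℝ → ℝ) :
    tracePairing i w φ = sy i * pairY w φ := by
  have := tracePairing_nbY (nbY i) w φ
  rw [nbY_nbY, sy_nbY, neg_neg] at this
  exact this

lemma sx_ne_zero (i : Fin 4) : sx i ≠ 0 := by rcases sx_cases i with h | h <;> rw [h] <;> norm_num

lemma sy_ne_zero (i : Fin 4) : sy i ≠ 0 := by rcases sy_cases i with h | h <;> rw [h] <;> norm_num

lemma firstStep_iff {f g : ℝ × ℝ → ℝ} {θ : ℝ} {u psi : ∀ i : Fin 4, HDelta (sub i)} {i : Fin 4}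
    {w : HDelta (sub i)} : FirstStep f g θ u psi i w ↔
    (∀ᵐ p ∂volume.restrict (sub i), -w.lap p = f p) ∧
    HasOuterTrace (quadrant i) w.toH1 g ∧
    (∀ φ, IsTest (patch i (nbY i)) φ → pairY w.toH1 φ = pairY (u i).toH1 φ
      - θ * (pairY (psi i).toH1 φ - pairY (psi (nbY i)).toH1 φ)) ∧
    (∀ φ, IsTest (patch i (nbX i)) φ → normalPairing w φ = normalPairing (u i) φ
      - θ * (normalPairing (psi i) φ - normalPairing (psi (nbX i)) φ)) := by
  unfold FirstStep GammaD1 GammaN1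
  simp only [mem_horizontal, mem_vertical, forall_eq, tracePairing_nbY, tracePairing_nbY']
  refine and_congr_right fun _ => and_congr_right fun _ => and_congr ?_ ?_
  · refine forall_congr' fun φ => imp_congr_right fun _ => ?_
    constructor
    · intro h
      refine mul_left_cancel₀ (neg_ne_zero.2 (sy_ne_zero i)) ?_
      linear_combination h
    · intro h
      linear_combination (-sy i) * h
  · simp only [← sub_eq_add_neg]

lemma secondStep_iff {u : ∀ i : Fin 4, HDelta (sub i)} {i : Fin 4}
    {w : HDelta (sub i)} : SecondStep u i w ↔
    (∀ᵐ p ∂volume.restrict (sub i), -w.lap p = 0) ∧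
    HasOuterTrace (quadrant i) w.toH1 0 ∧
    (∀ φ, IsTest (patch i (nbX i)) φ → pairX w.toH1 φ = pairX (u i).toH1 φ
      + pairX (u (nbX i)).toH1 φ) ∧
    (∀ φ, IsTest (patch i (nbY i)) φ → normalPairing w φ = normalPairing (u i) φ
      + normalPairing (u (nbY i)) φ) := by
  unfold SecondStep GammaD2 GammaN2
  simp only [mem_horizontal, mem_vertical, forall_eq, tracePairing_nbX, tracePairing_nbX']
  refine and_congr_right fun _ => and_congr_right fun _ => and_congr_left fun _ => ?_
  refine forall_congr' fun φ => imp_congr_right fun _ => ?_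
  constructor
  · intro h
    refine mul_left_cancel₀ (neg_ne_zero.2 (sx_ne_zero i)) ?_
    linear_combination h
  · intro h
    linear_combination (-sx i) * h

/-! ### Completeness of the trigonometric systems -/

/-- Stone-Weierstrass for a family of weights `v n` which is stable under multiplication by two
functions which separate the points: if the weights have mean zero, they annihilate all
continuous functions. -/
lemma integral_mul_eq_zero_of_stable {X : Type*} [TopologicalSpace X] [CompactSpace X]
    [MeasurableSpace X] [BorelSpace X] {μ : Measure X} {ι : Type*} {v : ι → X → ℝ}
    (hv : ∀ n, Integrable (v n) μ) (c d : C(X, ℝ))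
    (hc : ∀ n, ∃ a b, ∀ x, c x * v n x = (v a x + v b x) / 2)
    (hd : ∀ n, ∃ a b, ∀ x, d x * v n x = (v a x + v b x) / 2)
    (hsep : ∀ x y, c x = c y → d x = d y → x = y)
    (h0 : ∀ n, ∫ x, v n x ∂μ = 0) (n : ι) (g : C(X, ℝ)) : ∫ x, v n x * g x ∂μ = 0 := by
  have hint : ∀ (n : ι) (g : C(X, ℝ)), Integrable (fun x => v n x * g x) μ := fun n g =>
    (hv n).mul_bdd (c := ‖g‖) g.continuous.aestronglyMeasurable
      (Eventually.of_forall fun x => g.norm_coe_le_norm x)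
  have hstep : ∀ e : C(X, ℝ), (∀ n, ∃ a b, ∀ x, e x * v n x = (v a x + v b x) / 2) →
      ∀ p : C(X, ℝ), (∀ n, ∫ x, v n x * p x ∂μ = 0) → ∀ n, ∫ x, v n x * (e * p) x ∂μ = 0 := by
    intro e he p hp n
    obtain ⟨a, b, hab⟩ := he n
    have : ∀ x, v n x * (e * p) x = (1 / 2) * (v a x * p x) + (1 / 2) * (v b x * p x) := by
      intro x
      rw [ContinuousMap.mul_apply]
      linear_combination (p x) * hab x
    simp only [this]
    rw [integral_add ((hint a p).const_mul _) ((hint b p).const_mul _), integral_const_mul,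
      integral_const_mul, hp, hp]
    ring
  -- The functions which preserve the property of being annihilated by all weights form an algebra.
  have hadj : ∀ q ∈ Algebra.adjoin ℝ {c, d}, ∀ p : C(X, ℝ), (∀ n, ∫ x, v n x * p x ∂μ = 0) →
      ∀ n, ∫ x, v n x * (q * p) x ∂μ = 0 := by
    intro q hq
    induction hq using Algebra.adjoin_induction with
    | mem e he =>
      rcases he with rfl | rfl
      · exact hstep _ hc
      · exact hstep _ hd
    | algebraMap r =>
      intro p hp n
      have : ∀ x, v n x * (algebraMap ℝ C(X, ℝ) r * p) x = r * (v n x * p x) := fun x => by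
        have hr : (algebraMap ℝ C(X, ℝ) r) x = r := rfl
        rw [ContinuousMap.mul_apply, hr]
        ring
      simp only [this]
      rw [integral_const_mul, hp, mul_zero]
    | add x y _ _ hx hy =>
      intro p hp n
      have : ∀ z, v n z * ((x + y) * p) z = v n z * (x * p) z + v n z * (y * p) z := fun z => by
        simp only [ContinuousMap.mul_apply, ContinuousMap.add_apply]
        ring
      simp only [this]
      rw [integral_add (hint n _) (hint n _), hx p hp, hy p hp, add_zero]
    | mul x y _ _ hx hy =>
      intro p hp n
      rw [mul_assoc]
      exact hx _ (hy p hp) n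
  have hq0 : ∀ q ∈ Algebra.adjoin ℝ {c, d}, ∫ x, v n x * q x ∂μ = 0 := fun q hq => by
    simpa using hadj q hq 1 (by simpa using h0) n
  have hS : (Algebra.adjoin ℝ {c, d}).SeparatesPoints := by
    intro x y hxy
    by_contra hne
    push Not at hne
    refine hxy (hsep x y ?_ ?_)
    · exact hne c ⟨c, Algebra.subset_adjoin (by simp), rfl⟩
    · exact hne d ⟨d, Algebra.subset_adjoin (by simp), rfl⟩
  have hle : ∀ ε > 0, |∫ x, v n x * g x ∂μ| ≤ ε * ∫ x, |v n x| ∂μ := by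
    intro ε hε
    obtain ⟨q, hq⟩ :=
      ContinuousMap.exists_mem_subalgebra_near_continuousMap_of_separatesPoints _ hS g ε hε
    have h1 : ∫ x, v n x * g x ∂μ = ∫ x, v n x * (g - q) x ∂μ := by
      have : ∀ x, v n x * (g - q) x = v n x * g x - v n x * (q : C(X, ℝ)) x := fun x => by
        rw [ContinuousMap.sub_apply, mul_sub]
      simp only [this]
      rw [integral_sub (hint n g) (hint n q), hq0 q q.2, sub_zero]
    rw [h1, ← integral_const_mul]
    refine (abs_integral_le_integral_abs).trans ?_
    refine integral_mono (hint n _).abs ((hv n).abs.const_mul ε) fun x => ?_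
    simp only [abs_mul]
    rw [mul_comm]
    gcongr
    have := (g - (q : C(X, ℝ))).norm_coe_le_norm x
    rw [norm_sub_rev] at hq
    exact this.trans hq.le
  have hlim : Tendsto (fun ε : ℝ => ε * ∫ x, |v n x| ∂μ) (𝓝[>] 0) (𝓝 0) := by
    have : Tendsto (fun ε : ℝ => ε * ∫ x, |v n x| ∂μ) (𝓝 0) (𝓝 (0 * ∫ x, |v n x| ∂μ)) :=
      (continuous_id.mul continuous_const).tendsto 0
    rw [zero_mul] at this
    exact this.mono_left nhdsWithin_le_nhds
  have := ge_of_tendsto hlim (eventually_mem_nhdsWithin.mono fun ε hε => hle ε hε)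
  exact abs_nonpos_iff.1 this

/-- The eigenfunctions `sin (ω_n x + φ_n)` of the second derivative, with frequencies and phases
which are affine in `n`. -/
def wave (α β γ δ : ℝ) (n : ℤ) (x : ℝ) : ℝ := Real.sin ((α * n + β) * x + (γ * n + δ))

/-- The family of the waves is stable under multiplication by one cosine: the frequencies and
phases form arithmetic progressions. -/
lemma wave_rec (α β γ δ : ℝ) (n : ℤ) (x : ℝ) :
    Real.cos (α * x + γ) * wave α β γ δ n x =
      (wave α β γ δ (n + 1) x + wave α β γ δ (n - 1) x) / 2 := by
  unfold wave
  rw [show (α * ((n + 1 : ℤ) : ℝ) + β) * x + (γ * ((n + 1 : ℤ) : ℝ) + δ) =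
      ((α * n + β) * x + (γ * n + δ)) + (α * x + γ) by push_cast; ring,
    show (α * ((n - 1 : ℤ) : ℝ) + β) * x + (γ * ((n - 1 : ℤ) : ℝ) + δ) =
      ((α * n + β) * x + (γ * n + δ)) - (α * x + γ) by push_cast; ring,
    Real.sin_add _ (α * x + γ), Real.sin_sub _ (α * x + γ)]
  ring

lemma contDiff_wave (α β γ δ : ℝ) (n : ℤ) : ContDiff ℝ ∞ (wave α β γ δ n) := by
  unfold wave
  fun_prop

/-- The derivative of `wave`. -/
def waveD (α β γ δ : ℝ) (n : ℤ) (x : ℝ) : ℝ :=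
  (α * n + β) * Real.cos ((α * n + β) * x + (γ * n + δ))

lemma contDiff_waveD (α β γ δ : ℝ) (n : ℤ) : ContDiff ℝ ∞ (waveD α β γ δ n) := by
  unfold waveD
  fun_prop

lemma deriv_wave (α β γ δ : ℝ) (n : ℤ) : deriv (wave α β γ δ n) = waveD α β γ δ n := by
  ext x
  have h1 : HasDerivAt (fun x : ℝ => (α * n + β) * x + (γ * n + δ)) (α * n + β) x := by
    simpa using ((hasDerivAt_id x).const_mul (α * n + β)).add_const (γ * n + δ)
  have := h1.sin.deriv
  rw [show wave α β γ δ n = fun x : ℝ => Real.sin ((α * n + β) * x + (γ * n + δ)) from rfl, this,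
    waveD, mul_comm]

lemma deriv_waveD (α β γ δ : ℝ) (n : ℤ) (x : ℝ) :
    deriv (waveD α β γ δ n) x = -(α * n + β) ^ 2 * wave α β γ δ n x := by
  have h1 : HasDerivAt (fun x : ℝ => (α * n + β) * x + (γ * n + δ)) (α * n + β) x := by
    simpa using ((hasDerivAt_id x).const_mul (α * n + β)).add_const (γ * n + δ)
  have := (h1.cos.const_mul (α * n + β)).deriv
  rw [show waveD α β γ δ n = fun x : ℝ => (α * n + β) *
    Real.cos ((α * n + β) * x + (γ * n + δ)) from rfl, this, wave]
  ring

lemma memLp_of_continuous {U : Set (ℝ × ℝ)} (hU : U ⊆ Omega) {F : ℝ × ℝ → ℝ}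
    (hF : Continuous F) : MemLp F 2 (volume.restrict U) := by
  obtain ⟨C, hC⟩ := ((isCompact_Icc (a := (-1 : ℝ)) (b := 1)).prod
    (isCompact_Icc (a := (-1 : ℝ)) (b := 1))).exists_bound_of_continuousOn hF.continuousOn
  refine MemLp.mono_measure (Measure.restrict_mono_set _ hU) ?_
  refine MemLp.of_bound hF.aestronglyMeasurable C ?_
  filter_upwards [ae_restrict_mem isOpen_Omega.measurableSet] with p hp
  exact hC p ⟨Ioo_subset_Icc_self hp.1, Ioo_subset_Icc_self hp.2⟩

/-- A function which is orthogonal to a complete system of eigenfunctions vanishes. -/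
lemma ae_eq_zero_of_waves {U K : Set (ℝ × ℝ)} (hU : IsOpen U) (hUO : U ⊆ Omega)
    (hK : IsCompact K) (hUK : U ⊆ K) {w : ℝ × ℝ → ℝ} (hw : MemLp w 2 (volume.restrict U))
    {α β γ δ α' β' γ' δ' : ℝ}
    (hsep : ∀ p ∈ K, ∀ q ∈ K, Real.cos (α * p.1 + γ) = Real.cos (α * q.1 + γ) →
      Real.cos (α' * p.2 + γ') = Real.cos (α' * q.2 + γ') → p = q)
    {n₀ m₀ : ℤ} (hA : ∀ p ∈ U, wave α β γ δ n₀ p.1 ≠ 0)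
    (hB : ∀ p ∈ U, wave α' β' γ' δ' m₀ p.2 ≠ 0)
    (h : ∀ n m, ∫ p in U, w p * (wave α β γ δ n p.1 * wave α' β' γ' δ' m p.2) = 0) :
    w =ᵐ[volume.restrict U] 0 := by
  have hcont : ∀ n m, Continuous fun p : ℝ × ℝ =>
      wave α β γ δ n p.1 * wave α' β' γ' δ' m p.2 := fun n m =>
    ((contDiff_wave α β γ δ n).continuous.comp continuous_fst).mul
      ((contDiff_wave α' β' γ' δ' m).continuous.comp continuous_snd)
  have hint : ∀ n m, IntegrableOn
      (fun p => w p * (wave α β γ δ n p.1 * wave α' β' γ' δ' m p.2)) U := fun n m =>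
    integrable_mul_fun hw (memLp_of_continuous hUO (hcont n m))
  have : CompactSpace K := isCompact_iff_compactSpace.1 hK
  have he : MeasurableEmbedding ((↑) : K → ℝ × ℝ) :=
    MeasurableEmbedding.subtype_coe hK.measurableSet
  have hmap : Measure.map ((↑) : K → ℝ × ℝ) (Measure.comap (↑) (volume.restrict U)) =
      volume.restrict U := by
    rw [he.map_comap, Subtype.range_coe, Measure.restrict_restrict hK.measurableSet,
      inter_eq_self_of_subset_right hUK]
  have hI : ∀ F : ℝ × ℝ → ℝ, ∫ p in U, F p =
      ∫ x : K, F x ∂(Measure.comap (↑) (volume.restrict U)) := fun F => by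
    rw [← he.integral_map, hmap]
  have hInt : ∀ F : ℝ × ℝ → ℝ, IntegrableOn F U →
      Integrable (fun x : K => F x) (Measure.comap (↑) (volume.restrict U)) := fun F hF => by
    rw [IntegrableOn, ← hmap, he.integrable_map_iff] at hF
    exact hF
  have key := integral_mul_eq_zero_of_stable (X := K)
    (μ := Measure.comap (↑) (volume.restrict U)) (ι := ℤ × ℤ)
    (v := fun n x => w x * (wave α β γ δ n.1 x.1.1 * wave α' β' γ' δ' n.2 x.1.2))
    (fun n => hInt _ (hint n.1 n.2))
    ⟨fun x => Real.cos (α * x.1.1 + γ), by fun_prop⟩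
    ⟨fun x => Real.cos (α' * x.1.2 + γ'), by fun_prop⟩
    (fun n => ⟨(n.1 + 1, n.2), (n.1 - 1, n.2), fun x => by
      have := wave_rec α β γ δ n.1 x.1.1
      simp only [ContinuousMap.coe_mk]
      linear_combination (w x * wave α' β' γ' δ' n.2 x.1.2) * this⟩)
    (fun n => ⟨(n.1, n.2 + 1), (n.1, n.2 - 1), fun x => by
      have := wave_rec α' β' γ' δ' n.2 x.1.2
      simp only [ContinuousMap.coe_mk]
      linear_combination (w x * wave α β γ δ n.1 x.1.1) * this⟩)
    (fun x y h1 h2 => Subtype.ext (hsep x x.2 y y.2 h1 h2))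
    (fun n => by rw [← hI (fun p => w p * (wave α β γ δ n.1 p.1 * wave α' β' γ' δ' n.2 p.2))]
                 exact h n.1 n.2)
  have hz : (fun p => w p * (wave α β γ δ n₀ p.1 * wave α' β' γ' δ' m₀ p.2))
      =ᵐ[volume.restrict U] 0 := by
    refine ae_eq_zero_of_test hU (hint n₀ m₀) fun φ hφ => ?_
    rw [hI]
    exact key (n₀, m₀) ⟨fun x => φ x, hφ.1.continuous.comp continuous_subtype_val⟩
  filter_upwards [hz, ae_restrict_mem hU.measurableSet] with p hp hpU
  have h1 : wave α β γ δ n₀ p.1 * wave α' β' γ' δ' m₀ p.2 ≠ 0 :=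
    mul_ne_zero (hA p hpU) (hB p hpU)
  exact (mul_eq_zero.1 hp).resolve_right h1

/-! ### Green's formula for products -/

/-- A weakly harmonic function is orthogonal to the eigenfunctions, if the boundary terms in
Green's formula vanish. -/
lemma integral_mul_wave_eq_zero {U : Set (ℝ × ℝ)} (hUO : U ⊆ Omega) (w : H1 U)
    {A B A' B' : ℝ → ℝ} {a b : ℝ} (hA : ContDiff ℝ ∞ A) (hB : ContDiff ℝ ∞ B)
    (hA' : ContDiff ℝ ∞ A') (hB' : ContDiff ℝ ∞ B')
    (hA2 : ∀ x, deriv A' x = -a * A x) (hB2 : ∀ x, deriv B' x = -b * B x) (hab : a + b ≠ 0)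
    (hTx : ∫ p in U, (w.val p * (deriv A' p.1 * B p.2) + w.dx p * (A' p.1 * B p.2)) = 0)
    (hTy : ∫ p in U, (w.val p * (A p.1 * deriv B' p.2) + w.dy p * (A p.1 * B' p.2)) = 0)
    (hG : ∫ p in U, (w.dx p * (A' p.1 * B p.2) + w.dy p * (A p.1 * B' p.2)) = 0) :
    ∫ p in U, w.val p * (A p.1 * B p.2) = 0 := by
  have hc : ∀ {f g : ℝ → ℝ}, ContDiff ℝ ∞ f → ContDiff ℝ ∞ g →
      MemLp (fun p : ℝ × ℝ => f p.1 * g p.2) 2 (volume.restrict U) := fun hf hg =>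
    memLp_of_continuous hUO ((hf.continuous.comp continuous_fst).mul
      (hg.continuous.comp continuous_snd))
  have i1 := integrable_mul_fun w.memLp_val (hc hA hB)
  have i2 := integrable_mul_fun w.memLp_dx (hc hA' hB)
  have i3 := integrable_mul_fun w.memLp_dy (hc hA hB')
  have e1 : ∀ p : ℝ × ℝ, w.val p * (deriv A' p.1 * B p.2) + w.dx p * (A' p.1 * B p.2) =
      (-a) * (w.val p * (A p.1 * B p.2)) + w.dx p * (A' p.1 * B p.2) := fun p => by
    rw [hA2]; ring
  have e2 : ∀ p : ℝ × ℝ, w.val p * (A p.1 * deriv B' p.2) + w.dy p * (A p.1 * B' p.2) =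
      (-b) * (w.val p * (A p.1 * B p.2)) + w.dy p * (A p.1 * B' p.2) := fun p => by
    rw [hB2]; ring
  simp only [e1] at hTx
  simp only [e2] at hTy
  rw [integral_add (i1.const_mul _) i2, integral_const_mul] at hTx
  rw [integral_add (i1.const_mul _) i3, integral_const_mul] at hTy
  rw [integral_add i2 i3] at hG
  refine (mul_eq_zero.1 (?_ : (a + b) * _ = 0)).resolve_left hab
  linear_combination hG - hTx - hTy

lemma setIntegral_congr_forall {U : Set (ℝ × ℝ)} {F G : ℝ × ℝ → ℝ} (h : ∀ p, F p = G p) :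
    ∫ p in U, F p = ∫ p in U, G p := by
  simp only [h]

/-- Green's formula without boundary terms for products of functions which vanish at the end
points. -/
lemma integral_grad_tensor_eq_zero {U : Set (ℝ × ℝ)} (hUm : MeasurableSet U) (hUO : U ⊆ Omega)
    (w : HDelta U) (hlap : ∀ᵐ p ∂volume.restrict U, w.lap p = 0) {p q r s : ℝ}
    (hU : U ⊆ Ioo p q ×ˢ Ioo r s)
    (h : ∀ φ, IsTest (Ioo p q ×ˢ Ioo r s) φ → normalPairing w φ = 0) {A B : ℝ → ℝ}
    (hA : ContDiff ℝ ∞ A) (hB : ContDiff ℝ ∞ B) (hp : A p = 0) (hq : A q = 0) (hr : B r = 0)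
    (hs : B s = 0) :
    ∫ z in U, (w.dx z * (deriv A z.1 * B z.2) + w.dy z * (A z.1 * deriv B z.2)) = 0 := by
  have hdA : Continuous (deriv A) := hA.continuous_deriv (by simp)
  have hdB : Continuous (deriv B) := hB.continuous_deriv (by simp)
  have hc : ∀ {f : ℝ → ℝ}, Continuous f →
      MemLp (fun p : ℝ × ℝ => f p.1) 2 (volume.restrict U) ∧
      MemLp (fun p : ℝ × ℝ => f p.2) 2 (volume.restrict U) := fun hf =>
    ⟨memLp_of_continuous hUO (hf.comp continuous_fst),
      memLp_of_continuous hUO (hf.comp continuous_snd)⟩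
  have hX : ∀ᵐ z ∂volume.restrict U, z.1 ∈ Ioo p q := by
    filter_upwards [ae_restrict_mem hUm] with z hz using (hU hz).1
  have hY : ∀ᵐ z ∂volume.restrict U, z.2 ∈ Ioo r s := by
    filter_upwards [ae_restrict_mem hUm] with z hz using (hU hz).2
  have h1 : ∀ b, IsTest1 (Ioo r s) b →
      ∫ z in U, (w.dx z * b z.2 * deriv A z.1 + w.dy z * deriv b z.2 * A z.1) = 0 := by
    intro b hb
    refine integral_deriv_eq_zero_of_test measurable_fst hX
      (integrable_mul_fun w.memLp_dx (hc hb.1.continuous).2)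
      (integrable_mul_fun w.memLp_dy (hc (hb.1.continuous_deriv (by simp))).2) ?_ hA hp hq
    intro a ha
    rw [← h _ (ha.tensor hb), normalPairing]
    refine integral_congr_ae ?_
    filter_upwards [hlap] with z hz
    rw [hz, pdx_tensor ha.differentiable hb.differentiable,
      pdy_tensor ha.differentiable hb.differentiable]
    ring
  have h2 : ∫ z in U, (w.dy z * A z.1 * deriv B z.2 + w.dx z * deriv A z.1 * B z.2) = 0 := by
    refine integral_deriv_eq_zero_of_test measurable_snd hY
      (integrable_mul_fun w.memLp_dy (hc hA.continuous).1)
      (integrable_mul_fun w.memLp_dx (hc hdA).1) ?_ hB hr hs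
    intro b hb
    rw [← h1 b hb]
    exact setIntegral_congr_forall fun z => by ring
  rw [← h2]
  exact setIntegral_congr_forall fun z => by ring

/-- A plateau function: smooth, with compact support in `(-2 r, 2 r)` and equal to one on
`[-r, r]`. -/
lemma exists_plateau {r : ℝ} (hr : 0 < r) : ∃ τ : ℝ → ℝ, ContDiff ℝ ∞ τ ∧
    HasCompactSupport τ ∧ (∀ x, |x| ≤ r → τ x = 1) ∧ (∀ x, 2 * r ≤ |x| → τ x = 0) ∧
    tsupport τ ⊆ Icc (-(2 * r)) (2 * r) := by
  let f : ContDiffBump (0 : ℝ) := ⟨r, 2 * r, hr, by linarith⟩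
  refine ⟨f, f.contDiff, f.hasCompactSupport, fun x hx => ?_, fun x hx => ?_, ?_⟩
  · exact f.one_of_mem_closedBall (by simpa [Real.dist_eq] using hx)
  · exact f.zero_of_le_dist (by simpa [Real.dist_eq] using hx)
  · rw [f.tsupport_eq, Real.closedBall_eq_Icc]
    simp [f]

lemma half_eq_Ioo {s : ℝ} (hs : s = 1 ∨ s = -1) :
    ∃ p q, half s = Ioo p q ∧ ((p = 0 ∧ q = s) ∨ (p = s ∧ q = 0)) := by
  rcases hs with rfl | rfl
  · exact ⟨0, 1, half_one, Or.inl ⟨rfl, rfl⟩⟩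
  · exact ⟨-1, 0, half_neg_one, Or.inr ⟨rfl, rfl⟩⟩

lemma isTest1_mul {P : Set ℝ} {a τ : ℝ → ℝ} (ha : ContDiff ℝ ∞ a) (hτ : IsTest1 P τ) :
    IsTest1 P (fun x => τ x * a x) :=
  ⟨hτ.1.mul ha, hτ.2.1.mul_right, (tsupport_mul_subset_left).trans hτ.2.2⟩

/-- An identity which holds for test functions on the ray `0 < s x` extends to smooth functions
which vanish at the end points of `(0, 2 s)`, and to all smooth functions if it also holds for
test functions on `(-1, 1)`. -/
lemma integral_deriv_eq_zero_of_ray {E : Type*} [MeasurableSpace E] {μ : Measure E} {X : E → ℝ}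
    (hX : Measurable X) {s : ℝ} (hs : s = 1 ∨ s = -1) (hXI : ∀ᵐ e ∂μ, X e ∈ half s) {u v : E → ℝ}
    (hu : Integrable u μ) (hv : Integrable v μ)
    (h : ∀ a, IsTest1 {x | 0 < s * x} a → ∫ e, (u e * deriv a (X e) + v e * a (X e)) ∂μ = 0)
    {a : ℝ → ℝ} (ha : ContDiff ℝ ∞ a)
    (h' : (a 0 = 0 ∧ a (2 * s) = 0) ∨
      ∀ a, IsTest1 (Ioo (-1) 1) a → ∫ e, (u e * deriv a (X e) + v e * a (X e)) ∂μ = 0) :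
    ∫ e, (u e * deriv a (X e) + v e * a (X e)) ∂μ = 0 := by
  -- The far end point is `2 s`, not `s`: the test functions on the ray need not vanish near `s`,
  -- and `X` takes its values in `(0, s)`, so that `(0, 2 s)` is as good as the ray.
  have hN : ∀ a, ContDiff ℝ ∞ a → a 0 = 0 → a (2 * s) = 0 →
      ∫ e, (u e * deriv a (X e) + v e * a (X e)) ∂μ = 0 := by
    intro a ha h0 h2
    rcases hs with rfl | rfl
    · refine integral_deriv_eq_zero_of_test (p := 0) (q := 2) hX ?_ hu hv ?_ ha h0
        (by simpa using h2)
      · filter_upwards [hXI] with e he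
        rw [mem_half] at he
        constructor <;> linarith [he.1, he.2]
      · exact fun b hb => h b ⟨hb.1, hb.2.1, hb.2.2.trans fun x hx => by simpa using hx.1⟩
    · refine integral_deriv_eq_zero_of_test (p := -2) (q := 0) hX ?_ hu hv ?_ ha
        (by simpa using h2) h0
      · filter_upwards [hXI] with e he
        rw [mem_half] at he
        constructor <;> linarith [he.1, he.2]
      · exact fun b hb => h b ⟨hb.1, hb.2.1, hb.2.2.trans fun x hx => by simpa using hx.2⟩
  rcases h' with ⟨h0, h2⟩ | hD
  · exact hN a ha h0 h2
  -- Near the values of `X`, `a` is the sum of `τ a`, a test function on `(-1, 1)`, and of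
  -- `σ (1 - τ) a`, which vanishes at `0` and `2 s`.
  obtain ⟨τ, hτ, hτc, hτ1, hτ0, hτs⟩ := exists_plateau (r := 1 / 4) (by norm_num)
  obtain ⟨σ, hσ, hσc, hσ1, hσ0, hσs⟩ := exists_plateau (r := 1) (by norm_num)
  have hT : IsTest1 (Ioo (-1) 1) τ := ⟨hτ, hτc, hτs.trans fun x hx => by
    constructor <;> linarith [hx.1, hx.2]⟩
  have e1 := hD _ (isTest1_mul ha hT)
  have hb : ContDiff ℝ ∞ (fun x => σ x * ((1 - τ x) * a x)) :=
    hσ.mul ((contDiff_const.sub hτ).mul ha)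
  have e2 := hN _ hb (by simp [hτ1]) (by
    rw [hσ0 _ (by rcases hs with rfl | rfl <;> norm_num), zero_mul])
  have hda : Differentiable ℝ a := ha.differentiable (by simp)
  have hdτ : Differentiable ℝ τ := hτ.differentiable (by simp)
  have hdσ : Differentiable ℝ σ := hσ.differentiable (by simp)
  have hmeas : ∀ f : ℝ → ℝ, ContDiff ℝ ∞ f → HasCompactSupport f →
      Integrable (fun e => u e * deriv f (X e) + v e * f (X e)) μ := by
    intro f hf hfc
    obtain ⟨C, hC⟩ := hfc.exists_bound_of_continuous hf.continuous
    obtain ⟨D, hD⟩ := hfc.deriv.exists_bound_of_continuous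
      (hf.continuous_deriv (by simp))
    refine (hu.mul_bdd (c := D) ?_ (Eventually.of_forall fun e => hD _)).add
      (hv.mul_bdd (c := C) ?_ (Eventually.of_forall fun e => hC _))
    · exact ((measurable_deriv f).comp hX).aestronglyMeasurable
    · exact (hf.continuous.measurable.comp hX).aestronglyMeasurable
  refine Eq.trans ?_ ((congrArg₂ (· + ·) e1 e2).trans (add_zero 0))
  rw [← integral_add (hmeas _ (isTest1_mul ha hT).1 (isTest1_mul ha hT).2.1)
    (hmeas _ hb hσc.mul_right)]
  refine integral_congr_ae ?_
  filter_upwards [hXI] with e he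
  have hx : |X e| < 1 := by
    rw [mem_half] at he
    rw [abs_lt]
    rcases hs with rfl | rfl <;> constructor <;> linarith [he.1, he.2]
  have hsum : (fun x => τ x * a x + σ x * ((1 - τ x) * a x)) =ᶠ[𝓝 (X e)] a := by
    filter_upwards [(isOpen_lt continuous_abs continuous_const).mem_nhds hx] with x hx
    rw [hσ1 x (le_of_lt hx)]
    ring
  have e3 := hsum.deriv_eq
  rw [deriv_fun_add ((hdτ _).fun_mul (hda _)) ((hb.differentiable (by simp)) _)] at e3
  have e4 := hsum.eq_of_nhds
  rw [← e3]
  linear_combination (-v e) * e4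

/-! ### Traces tested with products -/

lemma memLp_fst {U : Set (ℝ × ℝ)} (hUO : U ⊆ Omega) {f : ℝ → ℝ} (hf : Continuous f) :
    MemLp (fun p : ℝ × ℝ => f p.1) 2 (volume.restrict U) :=
  memLp_of_continuous hUO (hf.comp continuous_fst)

lemma memLp_snd {U : Set (ℝ × ℝ)} (hUO : U ⊆ Omega) {f : ℝ → ℝ} (hf : Continuous f) :
    MemLp (fun p : ℝ × ℝ => f p.2) 2 (volume.restrict U) :=
  memLp_of_continuous hUO (hf.comp continuous_snd)

lemma ae_fst_mem_half (i : Fin 4) : ∀ᵐ p ∂volume.restrict (sub i), p.1 ∈ half (sx i) := by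
  filter_upwards [ae_restrict_mem (isOpen_sub i).measurableSet] with p hp
  exact ((mem_sub i p).1 hp).1

lemma ae_snd_mem_half (i : Fin 4) : ∀ᵐ p ∂volume.restrict (sub i), p.2 ∈ half (sy i) := by
  filter_upwards [ae_restrict_mem (isOpen_sub i).measurableSet] with p hp
  exact ((mem_sub i p).1 hp).2

/-- Zero trace in the `x` direction, tested with products: either the first factor vanishes on
the interface, or the trace of `w` does. -/
lemma integral_traceX_tensor (i : Fin 4) (w : H1 (sub i))
    (hO : ∀ φ, IsTest (quadrant i) φ → pairX w φ = 0) {a b : ℝ → ℝ} (ha : ContDiff ℝ ∞ a)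
    (hb : ContDiff ℝ ∞ b)
    (h : (a 0 = 0 ∧ a (2 * sx i) = 0) ∨ ∀ φ, IsTest (patch i (nbX i)) φ → pairX w φ = 0) :
    ∫ p in sub i, (w.val p * (deriv a p.1 * b p.2) + w.dx p * (a p.1 * b p.2)) = 0 := by
  have hda : Continuous (deriv a) := ha.continuous_deriv (by simp)
  have key : ∀ {a b : ℝ → ℝ} {P Q : Set ℝ}, IsTest1 P a → IsTest1 Q b →
      pairX w (fun p => a p.1 * b p.2) = ∫ p in sub i,
        (w.val p * b p.2 * deriv a p.1 + w.dx p * b p.2 * a p.1) := by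
    intro a b P Q ha hb
    rw [pairX_eq]
    refine setIntegral_congr_forall fun p => ?_
    rw [pdx_tensor ha.differentiable hb.differentiable]
    ring
  -- The factors are extended one at a time: `a` while `b` is a test function, then `b`.
  have h1 : ∀ b, IsTest1 (half (sy i)) b → ∫ p in sub i,
      (w.val p * b p.2 * deriv a p.1 + w.dx p * b p.2 * a p.1) = 0 := by
    intro b hb
    refine integral_deriv_eq_zero_of_ray measurable_fst (sx_cases i) (ae_fst_mem_half i)
      (integrable_mul_fun w.memLp_val (memLp_snd (sub_subset i) hb.1.continuous))
      (integrable_mul_fun w.memLp_dx (memLp_snd (sub_subset i) hb.1.continuous)) ?_ ha ?_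
    · intro a ha
      rw [← key ha hb]
      refine hO _ ((ha.tensor hb).mono fun p hp => (mem_quadrant i p).2 ⟨hp.1, hp.2.1⟩)
    · refine h.imp_right fun h a ha => ?_
      rw [← key ha hb]
      refine h _ ?_
      rw [patch_nbX]
      exact ha.tensor hb
  obtain ⟨p, q, hpq, -⟩ := half_eq_Ioo (sy_cases i)
  have h2 : ∫ p in sub i, (w.val p * deriv a p.1 + w.dx p * a p.1) * b p.2 = 0 := by
    refine integral_eq_zero_of_test (p := p) (q := q) measurable_snd
      (by simpa only [hpq] using ae_snd_mem_half i) ?_ ?_ hb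
    · exact (integrable_mul_fun w.memLp_val (memLp_fst (sub_subset i) hda)).add
        (integrable_mul_fun w.memLp_dx (memLp_fst (sub_subset i) ha.continuous))
    · intro b hb
      rw [← h1 b (by rwa [hpq])]
      exact setIntegral_congr_forall fun z => by ring
  rw [← h2]
  exact setIntegral_congr_forall fun z => by ring

/-- Zero trace in the `y` direction, tested with products: either the second factor vanishes on
the interface, or the trace of `w` does. -/
lemma integral_traceY_tensor (i : Fin 4) (w : H1 (sub i))
    (hO : ∀ φ, IsTest (quadrant i) φ → pairY w φ = 0) {a b : ℝ → ℝ} (ha : ContDiff ℝ ∞ a)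
    (hb : ContDiff ℝ ∞ b)
    (h : (b 0 = 0 ∧ b (2 * sy i) = 0) ∨ ∀ φ, IsTest (patch i (nbY i)) φ → pairY w φ = 0) :
    ∫ p in sub i, (w.val p * (a p.1 * deriv b p.2) + w.dy p * (a p.1 * b p.2)) = 0 := by
  have hdb : Continuous (deriv b) := hb.continuous_deriv (by simp)
  have key : ∀ {a b : ℝ → ℝ} {P Q : Set ℝ}, IsTest1 P a → IsTest1 Q b →
      pairY w (fun p => a p.1 * b p.2) = ∫ p in sub i,
        (w.val p * a p.1 * deriv b p.2 + w.dy p * a p.1 * b p.2) := by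
    intro a b P Q ha hb
    rw [pairY_eq]
    refine setIntegral_congr_forall fun p => ?_
    rw [pdy_tensor ha.differentiable hb.differentiable]
    ring
  have h1 : ∀ a, IsTest1 (half (sx i)) a → ∫ p in sub i,
      (w.val p * a p.1 * deriv b p.2 + w.dy p * a p.1 * b p.2) = 0 := by
    intro a ha
    refine integral_deriv_eq_zero_of_ray measurable_snd (sy_cases i) (ae_snd_mem_half i)
      (integrable_mul_fun w.memLp_val (memLp_fst (sub_subset i) ha.1.continuous))
      (integrable_mul_fun w.memLp_dy (memLp_fst (sub_subset i) ha.1.continuous)) ?_ hb ?_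
    · intro b hb
      rw [← key ha hb]
      refine hO _ ((ha.tensor hb).mono fun p hp => (mem_quadrant i p).2 ⟨hp.1.1, hp.2⟩)
    · refine h.imp_right fun h b hb => ?_
      rw [← key ha hb]
      refine h _ ?_
      rw [patch_nbY]
      exact ha.tensor hb
  obtain ⟨p, q, hpq, -⟩ := half_eq_Ioo (sx_cases i)
  have h2 : ∫ p in sub i, (w.val p * deriv b p.2 + w.dy p * b p.2) * a p.1 = 0 := by
    refine integral_eq_zero_of_test (p := p) (q := q) measurable_fst
      (by simpa only [hpq] using ae_fst_mem_half i) ?_ ?_ ha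
    · exact (integrable_mul_fun w.memLp_val (memLp_snd (sub_subset i) hdb)).add
        (integrable_mul_fun w.memLp_dy (memLp_snd (sub_subset i) hb.continuous))
    · intro a ha
      rw [← h1 a (by rwa [hpq])]
      exact setIntegral_congr_forall fun z => by ring
  rw [← h2]
  exact setIntegral_congr_forall fun z => by ring

/-! ### Uniqueness -/

lemma contDiff_deriv {a : ℝ → ℝ} (ha : ContDiff ℝ ∞ a) : ContDiff ℝ ∞ (deriv a) :=
  ((contDiff_infty_iff_deriv).1 ha).2

/-- The closed square `closure Ω_i`, in a form convenient for the separation of points. -/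
lemma exists_compact_sub (i : Fin 4) : ∃ K : Set (ℝ × ℝ), IsCompact K ∧ sub i ⊆ K ∧
    ∀ p ∈ K, sx i * p.1 ∈ Icc (0 : ℝ) 1 ∧ sy i * p.2 ∈ Icc (0 : ℝ) 1 := by
  refine ⟨closure (sub i), ?_, subset_closure, fun p hp => ?_⟩
  · refine (isCompact_Icc.prod isCompact_Icc).of_isClosed_subset isClosed_closure
      (closure_minimal ?_ ((isClosed_Icc (a := (-1 : ℝ)) (b := 1)).prod
        (isClosed_Icc (a := (-1 : ℝ)) (b := 1))))
    exact (sub_subset i).trans (prod_mono Ioo_subset_Icc_self Ioo_subset_Icc_self)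
  · have hcl : IsClosed ({p : ℝ × ℝ | sx i * p.1 ∈ Icc (0 : ℝ) 1} ∩
        {p : ℝ × ℝ | sy i * p.2 ∈ Icc (0 : ℝ) 1}) :=
      (isClosed_Icc.preimage (f := fun p : ℝ × ℝ => sx i * p.1) (by fun_prop)).inter
        (isClosed_Icc.preimage (f := fun p : ℝ × ℝ => sy i * p.2) (by fun_prop))
    refine closure_minimal (fun q hq => ?_) hcl hp
    obtain ⟨h1, h2⟩ := (mem_sub i q).1 hq
    exact ⟨⟨h1.1.le, h1.2.le⟩, ⟨h2.1.le, h2.2.le⟩⟩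

lemma cos_pi_mul_inj {s x y : ℝ} (hs : s = 1 ∨ s = -1) (hx : s * x ∈ Icc (0 : ℝ) 1)
    (hy : s * y ∈ Icc (0 : ℝ) 1) (h : Real.cos (Real.pi * x + 0) = Real.cos (Real.pi * y + 0)) :
    x = y := by
  have hπ := Real.pi_pos
  have h1 : Real.cos (Real.pi * (s * x)) = Real.cos (Real.pi * (s * y)) := by
    rw [add_zero, add_zero] at h
    rcases hs with rfl | rfl
    · simpa using h
    · simpa using h
  have h2 := Real.injOn_cos ⟨mul_nonneg hπ.le hx.1, by nlinarith [hx.2]⟩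
    ⟨mul_nonneg hπ.le hy.1, by nlinarith [hy.2]⟩ h1
  have h3 := mul_left_cancel₀ hπ.ne' h2
  refine mul_left_cancel₀ (a := s) ?_ h3
  rcases hs with rfl | rfl <;> norm_num

/-- Eigenfunctions on an interval with Dirichlet conditions: `sin (n π x)`. -/
lemma sinWave_zero_of {n : ℤ} {x : ℝ} (hx : x = 0 ∨ x = 1 ∨ x = -1) :
    wave Real.pi 0 0 0 n x = 0 := by
  unfold wave
  rcases hx with rfl | rfl | rfl
  · simp
  · simpa [mul_comm] using Real.sin_int_mul_pi n
  · simpa [mul_comm] using Real.sin_int_mul_pi n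

lemma sinWave_ne_zero {s x : ℝ} (hs : s = 1 ∨ s = -1) (hx : x ∈ half s) :
    wave Real.pi 0 0 0 1 x ≠ 0 := by
  have hπ := Real.pi_pos
  have h0 : 0 < Real.sin (Real.pi * (s * x)) := by
    rw [mem_half] at hx
    refine Real.sin_pos_of_pos_of_lt_pi (mul_pos hπ hx.1) ?_
    nlinarith [hx.2]
  unfold wave
  rcases hs with rfl | rfl
  · simpa using h0.ne'
  · simp only [neg_one_mul, mul_neg, Real.sin_neg] at h0
    simpa using (neg_pos.1 h0).ne

/-- Eigenfunctions on an interval with a Neumann condition at `0` and a Dirichlet condition at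
`±1`: `cos ((n + 1/2) π x)`. -/
lemma cosWave_zero_of {n : ℤ} {x : ℝ} (hx : x = 1 ∨ x = -1) :
    wave Real.pi (Real.pi / 2) 0 (Real.pi / 2) n x = 0 := by
  unfold wave
  rcases hx with rfl | rfl
  · rw [show (Real.pi * n + Real.pi / 2) * 1 + (0 * (n : ℝ) + Real.pi / 2) =
      ((n + 1 : ℤ) : ℝ) * Real.pi by push_cast; ring]
    exact Real.sin_int_mul_pi _
  · rw [show (Real.pi * n + Real.pi / 2) * -1 + (0 * (n : ℝ) + Real.pi / 2) =
      ((-n : ℤ) : ℝ) * Real.pi by push_cast; ring]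
    exact Real.sin_int_mul_pi _

lemma cosWaveD_zero_of {n : ℤ} {x : ℝ} (hx : x = 0 ∨ x = 2 ∨ x = -2) :
    waveD Real.pi (Real.pi / 2) 0 (Real.pi / 2) n x = 0 := by
  unfold waveD
  have key : ∀ m : ℤ, Real.cos (m * Real.pi + Real.pi / 2) = 0 := fun m => by
    rw [Real.cos_add_pi_div_two, Real.sin_int_mul_pi, neg_zero]
  refine mul_eq_zero_of_right _ ?_
  rcases hx with rfl | rfl | rfl
  · simp
  · refine (congrArg Real.cos ?_).trans (key (2 * n + 1))
    push_cast
    ring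
  · refine (congrArg Real.cos ?_).trans (key (-(2 * n) - 1))
    push_cast
    ring

lemma cosWave_ne_zero {x : ℝ} (hx : x ∈ Ioo (-1 : ℝ) 1) :
    wave Real.pi (Real.pi / 2) 0 (Real.pi / 2) 0 x ≠ 0 := by
  have hπ := Real.pi_pos
  unfold wave
  simp only [Int.cast_zero, mul_zero, zero_add, Real.sin_add_pi_div_two]
  refine (Real.cos_pos_of_mem_Ioo ⟨?_, ?_⟩).ne' <;> nlinarith [hx.1, hx.2]

lemma int_add_half_sq_pos (n : ℤ) : 0 < (Real.pi * n + Real.pi / 2) ^ 2 := by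
  have : Real.pi * n + Real.pi / 2 ≠ 0 := by
    intro h
    have h1 : (2 * n + 1 : ℝ) = 0 := by
      refine mul_left_cancel₀ Real.pi_pos.ne' ?_
      linarith
    have h2 : (2 * n + 1 : ℤ) = 0 := by exact_mod_cast h1
    omega
  positivity

lemma ends_of_half {s p q : ℝ} (hs : s = 1 ∨ s = -1) (h : (p = 0 ∧ q = s) ∨ (p = s ∧ q = 0)) :
    (p = 0 ∨ p = 1 ∨ p = -1) ∧ (q = 0 ∨ q = 1 ∨ q = -1) := by
  rcases h with ⟨rfl, rfl⟩ | ⟨rfl, rfl⟩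
  · exact ⟨Or.inl rfl, Or.inr hs⟩
  · exact ⟨Or.inr hs, Or.inl rfl⟩

lemma half_subset {s : ℝ} (hs : s = 1 ∨ s = -1) : half s ⊆ Ioo (-1) 1 := fun x hx => by
  rw [mem_half] at hx
  rcases hs with rfl | rfl <;> constructor <;> linarith [hx.1, hx.2]

lemma two_mul_sign {s : ℝ} (hs : s = 1 ∨ s = -1) : 2 * s = 0 ∨ 2 * s = 2 ∨ 2 * s = -2 := by
  rcases hs with rfl | rfl <;> norm_num

/-- Uniqueness for the mixed problem with a Dirichlet condition on the horizontal and a Neumann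
condition on the vertical interface. -/
lemma ae_eq_zero_of_mixedY (i : Fin 4) (w : HDelta (sub i))
    (hlap : ∀ᵐ p ∂volume.restrict (sub i), w.lap p = 0)
    (hO : HasOuterTrace (quadrant i) w.toH1 0)
    (hD : ∀ φ, IsTest (patch i (nbY i)) φ → pairY w.toH1 φ = 0)
    (hN : ∀ φ, IsTest (patch i (nbX i)) φ → normalPairing w φ = 0) :
    w.val =ᵐ[volume.restrict (sub i)] 0 := by
  rw [hasOuterTrace_zero_iff] at hO
  obtain ⟨K, hK, hUK, hKs⟩ := exists_compact_sub i
  obtain ⟨r, s, hrs, hends⟩ := half_eq_Ioo (sy_cases i)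
  obtain ⟨hr, hs⟩ := ends_of_half (sy_cases i) hends
  -- The eigenfunctions `cos ((n + 1/2) π x) sin (m π y)`: in `x` the derivative vanishes at `0` and
  -- the value at `±1`, in `y` the value vanishes at both ends.
  refine ae_eq_zero_of_waves (α := Real.pi) (β := Real.pi / 2) (γ := 0) (δ := Real.pi / 2)
    (α' := Real.pi) (β' := 0) (γ' := 0) (δ' := 0) (n₀ := 0) (m₀ := 1)
    (isOpen_sub i) (sub_subset i) hK hUK w.memLp_val ?_ ?_ ?_ ?_
  · intro p hp q hq h1 h2
    exact Prod.ext (cos_pi_mul_inj (sx_cases i) (hKs p hp).1 (hKs q hq).1 h1)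
      (cos_pi_mul_inj (sy_cases i) (hKs p hp).2 (hKs q hq).2 h2)
  · exact fun p hp => cosWave_ne_zero (half_subset (sx_cases i) ((mem_sub i p).1 hp).1)
  · exact fun p hp => sinWave_ne_zero (sy_cases i) ((mem_sub i p).1 hp).2
  · intro n m
    have hA := contDiff_wave Real.pi (Real.pi / 2) 0 (Real.pi / 2) n
    have hA' := contDiff_waveD Real.pi (Real.pi / 2) 0 (Real.pi / 2) n
    have hB := contDiff_wave Real.pi 0 0 0 m
    have hB' := contDiff_waveD Real.pi 0 0 0 m
    refine integral_mul_wave_eq_zero (sub_subset i) w.toH1 hA hB hA' hB'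
      (a := (Real.pi * n + Real.pi / 2) ^ 2) (b := (Real.pi * m + 0) ^ 2)
      (deriv_waveD _ _ _ _ n) (deriv_waveD _ _ _ _ m)
      (by have := int_add_half_sq_pos n; positivity) ?_ ?_ ?_
    · exact integral_traceX_tensor i w.toH1 (fun φ hφ => (hO φ hφ).1) hA' hB
        (Or.inl ⟨cosWaveD_zero_of (Or.inl rfl), cosWaveD_zero_of (two_mul_sign (sx_cases i))⟩)
    · exact integral_traceY_tensor i w.toH1 (fun φ hφ => (hO φ hφ).2) hA hB' (Or.inr hD)
    · rw [← deriv_wave, ← deriv_wave]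
      refine integral_grad_tensor_eq_zero (isOpen_sub i).measurableSet (sub_subset i) w hlap
        (p := -1) (q := 1) (r := r) (s := s) ?_ ?_ hA hB (cosWave_zero_of (Or.inr rfl))
        (cosWave_zero_of (Or.inl rfl)) (sinWave_zero_of hr) (sinWave_zero_of hs)
      · rw [← hrs, ← patch_nbX]
        exact sub_subset_patch_nbX i
      · rw [← hrs, ← patch_nbX]
        exact hN

/-- Uniqueness for the mixed problem with a Dirichlet condition on the vertical and a Neumann
condition on the horizontal interface. -/
lemma ae_eq_zero_of_mixedX (i : Fin 4) (w : HDelta (sub i))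
    (hlap : ∀ᵐ p ∂volume.restrict (sub i), w.lap p = 0)
    (hO : HasOuterTrace (quadrant i) w.toH1 0)
    (hD : ∀ φ, IsTest (patch i (nbX i)) φ → pairX w.toH1 φ = 0)
    (hN : ∀ φ, IsTest (patch i (nbY i)) φ → normalPairing w φ = 0) :
    w.val =ᵐ[volume.restrict (sub i)] 0 := by
  rw [hasOuterTrace_zero_iff] at hO
  obtain ⟨K, hK, hUK, hKs⟩ := exists_compact_sub i
  obtain ⟨r, s, hrs, hends⟩ := half_eq_Ioo (sx_cases i)
  obtain ⟨hr, hs⟩ := ends_of_half (sx_cases i) hends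
  -- The eigenfunctions `sin (n π x) cos ((m + 1/2) π y)`.
  refine ae_eq_zero_of_waves (α := Real.pi) (β := 0) (γ := 0) (δ := 0)
    (α' := Real.pi) (β' := Real.pi / 2) (γ' := 0) (δ' := Real.pi / 2) (n₀ := 1) (m₀ := 0)
    (isOpen_sub i) (sub_subset i) hK hUK w.memLp_val ?_ ?_ ?_ ?_
  · intro p hp q hq h1 h2
    exact Prod.ext (cos_pi_mul_inj (sx_cases i) (hKs p hp).1 (hKs q hq).1 h1)
      (cos_pi_mul_inj (sy_cases i) (hKs p hp).2 (hKs q hq).2 h2)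
  · exact fun p hp => sinWave_ne_zero (sx_cases i) ((mem_sub i p).1 hp).1
  · exact fun p hp => cosWave_ne_zero (half_subset (sy_cases i) ((mem_sub i p).1 hp).2)
  · intro n m
    have hA := contDiff_wave Real.pi 0 0 0 n
    have hA' := contDiff_waveD Real.pi 0 0 0 n
    have hB := contDiff_wave Real.pi (Real.pi / 2) 0 (Real.pi / 2) m
    have hB' := contDiff_waveD Real.pi (Real.pi / 2) 0 (Real.pi / 2) m
    refine integral_mul_wave_eq_zero (sub_subset i) w.toH1 hA hB hA' hB'
      (a := (Real.pi * n + 0) ^ 2) (b := (Real.pi * m + Real.pi / 2) ^ 2)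
      (deriv_waveD _ _ _ _ n) (deriv_waveD _ _ _ _ m)
      (by have := int_add_half_sq_pos m; positivity) ?_ ?_ ?_
    · exact integral_traceX_tensor i w.toH1 (fun φ hφ => (hO φ hφ).1) hA' hB (Or.inr hD)
    · exact integral_traceY_tensor i w.toH1 (fun φ hφ => (hO φ hφ).2) hA hB'
        (Or.inl ⟨cosWaveD_zero_of (Or.inl rfl), cosWaveD_zero_of (two_mul_sign (sy_cases i))⟩)
    · rw [← deriv_wave, ← deriv_wave]
      refine integral_grad_tensor_eq_zero (isOpen_sub i).measurableSet (sub_subset i) w hlap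
        (p := r) (q := s) (r := -1) (s := 1) ?_ ?_ hA hB (sinWave_zero_of hr)
        (sinWave_zero_of hs) (cosWave_zero_of (Or.inr rfl)) (cosWave_zero_of (Or.inl rfl))
      · rw [← hrs, ← patch_nbY]
        exact sub_subset_patch_nbY i
      · rw [← hrs, ← patch_nbY]
        exact hN

lemma squareWave_zero_of {n : ℤ} {x : ℝ} (hx : x = 1 ∨ x = -1) :
    wave (Real.pi / 2) 0 (Real.pi / 2) 0 n x = 0 := by
  unfold wave
  rcases hx with rfl | rfl
  · rw [show (Real.pi / 2 * n + 0) * 1 + (Real.pi / 2 * n + 0) = (n : ℝ) * Real.pi by ring]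
    exact Real.sin_int_mul_pi n
  · rw [show (Real.pi / 2 * n + 0) * -1 + (Real.pi / 2 * n + 0) = 0 by ring]
    exact Real.sin_zero

lemma squareWave_ne_zero {x : ℝ} (hx : x ∈ Ioo (-1 : ℝ) 1) :
    wave (Real.pi / 2) 0 (Real.pi / 2) 0 1 x ≠ 0 := by
  have hπ := Real.pi_pos
  unfold wave
  refine (Real.sin_pos_of_pos_of_lt_pi ?_ ?_).ne' <;> push_cast <;> nlinarith [hx.1, hx.2]

lemma cos_square_inj {x y : ℝ} (hx : x ∈ Icc (-1 : ℝ) 1) (hy : y ∈ Icc (-1 : ℝ) 1)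
    (h : Real.cos (Real.pi / 2 * x + Real.pi / 2) = Real.cos (Real.pi / 2 * y + Real.pi / 2)) :
    x = y := by
  have hπ := Real.pi_pos
  have h2 := Real.injOn_cos
    (show Real.pi / 2 * x + Real.pi / 2 ∈ Icc 0 Real.pi by
      constructor <;> nlinarith [hx.1, hx.2])
    (show Real.pi / 2 * y + Real.pi / 2 ∈ Icc 0 Real.pi by
      constructor <;> nlinarith [hy.1, hy.2]) h
  have h3 : Real.pi / 2 * x = Real.pi / 2 * y := by linarith
  exact mul_left_cancel₀ (by positivity) h3

/-- Uniqueness for the Dirichlet problem in the square. -/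
lemma ae_eq_zero_of_dirichlet (w : HDelta Omega)
    (hlap : ∀ᵐ p ∂volume.restrict Omega, w.lap p = 0)
    (hO : HasOuterTrace univ w.toH1 0) : w.val =ᵐ[volume.restrict Omega] 0 := by
  rw [hasOuterTrace_zero_iff] at hO
  obtain ⟨σ, hσ, hσc, hσ1, hσ0, hσs⟩ := exists_plateau (r := 1) (by norm_num)
  have hT : IsTest1 univ σ := ⟨hσ, hσc, subset_univ _⟩
  -- The outer trace is tested on the whole plane, so a product of smooth functions becomes
  -- admissible by cutting it off outside the square.
  have htest : ∀ {a b : ℝ → ℝ}, ContDiff ℝ ∞ a → ContDiff ℝ ∞ b →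
      IsTest univ (fun p => (σ p.1 * a p.1) * (σ p.2 * b p.2)) := fun ha hb => by
    simpa using (isTest1_mul ha hT).tensor (isTest1_mul hb hT)
  have hev : ∀ {a b : ℝ → ℝ} {p : ℝ × ℝ}, p ∈ Omega →
      (fun p : ℝ × ℝ => (σ p.1 * a p.1) * (σ p.2 * b p.2)) =ᶠ[𝓝 p]
        fun p => a p.1 * b p.2 := fun hp => by
    filter_upwards [isOpen_Omega.mem_nhds hp] with q hq
    rw [hσ1 q.1 (abs_le.2 ⟨hq.1.1.le, hq.1.2.le⟩), hσ1 q.2 (abs_le.2 ⟨hq.2.1.le, hq.2.2.le⟩),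
      one_mul, one_mul]
  have hTx : ∀ {a b : ℝ → ℝ}, ContDiff ℝ ∞ a → ContDiff ℝ ∞ b →
      ∫ p in Omega, (w.val p * (deriv a p.1 * b p.2) + w.dx p * (a p.1 * b p.2)) = 0 := by
    intro a b ha hb
    rw [← (hO _ (htest ha hb)).1, pairX_eq]
    refine setIntegral_congr_fun isOpen_Omega.measurableSet fun p hp => ?_
    rw [pdx, (hev hp).fderiv_eq, ← pdx, pdx_tensor (ha.differentiable (by simp))
      (hb.differentiable (by simp)), (hev (a := a) (b := b) hp).eq_of_nhds]
  have hTy : ∀ {a b : ℝ → ℝ}, ContDiff ℝ ∞ a → ContDiff ℝ ∞ b →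
      ∫ p in Omega, (w.val p * (a p.1 * deriv b p.2) + w.dy p * (a p.1 * b p.2)) = 0 := by
    intro a b ha hb
    rw [← (hO _ (htest ha hb)).2, pairY_eq]
    refine setIntegral_congr_fun isOpen_Omega.measurableSet fun p hp => ?_
    rw [pdy, (hev hp).fderiv_eq, ← pdy, pdy_tensor (ha.differentiable (by simp))
      (hb.differentiable (by simp)), (hev (a := a) (b := b) hp).eq_of_nhds]
  -- The eigenfunctions `sin (n π (x + 1) / 2) sin (m π (y + 1) / 2)`.
  refine ae_eq_zero_of_waves (α := Real.pi / 2) (β := 0) (γ := Real.pi / 2) (δ := 0)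
    (α' := Real.pi / 2) (β' := 0) (γ' := Real.pi / 2) (δ' := 0) (n₀ := 1) (m₀ := 1)
    isOpen_Omega subset_rfl (K := Icc (-1) 1 ×ˢ Icc (-1) 1) (isCompact_Icc.prod isCompact_Icc)
    (prod_mono Ioo_subset_Icc_self Ioo_subset_Icc_self) w.memLp_val ?_ ?_ ?_ ?_
  · intro p hp q hq h1 h2
    exact Prod.ext (cos_square_inj hp.1 hq.1 h1) (cos_square_inj hp.2 hq.2 h2)
  · exact fun p hp => squareWave_ne_zero hp.1
  · exact fun p hp => squareWave_ne_zero hp.2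
  · intro n m
    by_cases hnm : (Real.pi / 2 * n + 0) ^ 2 + (Real.pi / 2 * m + 0) ^ 2 = 0
    · -- the constant mode: `sin 0 = 0`
      have hn : (n : ℝ) = 0 := by
        have h1 : (Real.pi / 2 * n + 0) ^ 2 = 0 := by
          nlinarith [sq_nonneg (Real.pi / 2 * n + 0), sq_nonneg (Real.pi / 2 * m + 0)]
        have h2 := pow_eq_zero_iff (two_ne_zero) |>.1 h1
        rw [add_zero] at h2
        exact (mul_eq_zero.1 h2).resolve_left (by positivity)
      have : ∀ x, wave (Real.pi / 2) 0 (Real.pi / 2) 0 n x = 0 := fun x => by simp [wave, hn]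
      simp [this]
    · have hA := contDiff_wave (Real.pi / 2) 0 (Real.pi / 2) 0 n
      have hA' := contDiff_waveD (Real.pi / 2) 0 (Real.pi / 2) 0 n
      have hB := contDiff_wave (Real.pi / 2) 0 (Real.pi / 2) 0 m
      have hB' := contDiff_waveD (Real.pi / 2) 0 (Real.pi / 2) 0 m
      refine integral_mul_wave_eq_zero subset_rfl w.toH1 hA hB hA' hB'
        (deriv_waveD _ _ _ _ n) (deriv_waveD _ _ _ _ m) hnm (hTx hA' hB) (hTy hA hB') ?_
      rw [← deriv_wave, ← deriv_wave]
      exact integral_grad_tensor_eq_zero isOpen_Omega.measurableSet subset_rfl w hlap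
        (p := -1) (q := 1) (r := -1) (s := 1) subset_rfl
        (fun φ hφ => normalPairing_eq_zero w hφ) hA hB (squareWave_zero_of (Or.inr rfl))
        (squareWave_zero_of (Or.inl rfl)) (squareWave_zero_of (Or.inr rfl))
        (squareWave_zero_of (Or.inl rfl))

/-! ### Existence -/

lemma integrable_of_isTest {P : Set (ℝ × ℝ)} {φ : ℝ × ℝ → ℝ} (hφ : IsTest P φ) :
    Integrable φ := hφ.1.continuous.integrable_of_hasCompactSupport hφ.2.1

lemma integral_fderiv_isTest {U : Set (ℝ × ℝ)} {φ : ℝ × ℝ → ℝ} (hφ : IsTest U φ) (v : ℝ × ℝ) :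
    ∫ p in U, fderiv ℝ φ p v = 0 := by
  have hv : Integrable (fun p => fderiv ℝ φ p v) := by
    have h1 : Continuous fun p => fderiv ℝ φ p v :=
      (hφ.1.continuous_fderiv (by simp)).clm_apply continuous_const
    exact h1.integrable_of_hasCompactSupport
      (hφ.2.1.of_isClosed_subset (isClosed_tsupport _) (tsupport_fderiv_apply_subset φ v))
  rw [setIntegral_eq_integral_of_forall_compl_eq_zero]
  · have := integral_mul_fderiv_eq_neg_fderiv_mul_of_integrable (μ := volume)
      (f := fun _ : ℝ × ℝ => (1 : ℝ)) (g := φ) (v := v) (by simp) (by simpa using hv)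
      (by simpa using integrable_of_isTest hφ) (by fun_prop)
      (fun p _ => hφ.differentiable p)
    simpa using this
  · intro p hp
    exact image_eq_zero_of_notMem_tsupport (f := fun p => fderiv ℝ φ p v)
      fun h => hp (hφ.2.2 (tsupport_fderiv_apply_subset φ v h))

lemma integral_pdx_isTest {U : Set (ℝ × ℝ)} {φ : ℝ × ℝ → ℝ} (hφ : IsTest U φ) :
    ∫ p in U, pdx φ p = 0 := integral_fderiv_isTest hφ _

lemma integral_pdy_isTest {U : Set (ℝ × ℝ)} {φ : ℝ × ℝ → ℝ} (hφ : IsTest U φ) :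
    ∫ p in U, pdy φ p = 0 := integral_fderiv_isTest hφ _

lemma IsTest.mul {P Q U : Set (ℝ × ℝ)} (hU : P ∩ Q ⊆ U) {φ ψ : ℝ × ℝ → ℝ} (hφ : IsTest P φ)
    (hψ : IsTest Q ψ) : IsTest U (fun p => φ p * ψ p) :=
  ⟨hφ.1.mul hψ.1, hφ.2.1.mul_right, fun _ hp =>
    hU ⟨hφ.2.2 (tsupport_mul_subset_left hp), hψ.2.2 (tsupport_mul_subset_right hp)⟩⟩

/-- Poincaré's inequality for test functions, on the part `L > 0` of their domain. -/
lemma poincare {P U : Set (ℝ × ℝ)} (L : ℝ × ℝ →L[ℝ] ℝ) (v : ℝ × ℝ) (hLv : L v = 1)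
    (hv : v.1 ^ 2 + v.2 ^ 2 = 1) (hU : ∀ p, p ∈ U ↔ p ∈ P ∧ 0 < L p) (hLU : ∀ p ∈ U, L p ≤ 1)
    (hUm : MeasurableSet U) (hfin : volume U ≠ ⊤) {φ : ℝ × ℝ → ℝ} (hφ : IsTest P φ) :
    ∫ p in U, φ p ^ 2 ≤ 4 * ((∫ p in U, pdx φ p ^ 2) + ∫ p in U, pdy φ p ^ 2) := by
  have hfm : IsFiniteMeasure (volume.restrict U) := ⟨by simpa [lt_top_iff_ne_top] using hfin⟩
  have hc : ∀ c : ℝ, MemLp (fun _ : ℝ × ℝ => c) 2 (volume.restrict U) := fun c => memLp_const c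
  have hψ : IsTest P (fun p => L p * (φ p * φ p)) :=
    (hφ.mul (by simp) hφ).mul_left L.contDiff
  obtain ⟨M, hM⟩ := hφ.bound
  -- The integral over `U` of the derivative of `L φ²` in the direction `v` vanishes: the factor `L`
  -- removes the boundary term on the line `L = 0`.
  have hz := act_eq_zero_of_abs_le L hU hUm hfin (hc 0) (hc v.1) (hc v.2) (fun χ hχ => by
    have e : ∀ p, 0 * χ p + v.1 * pdx χ p + v.2 * pdy χ p =
      v.1 * pdx χ p + v.2 * pdy χ p := fun p => by ring
    rw [act]
    simp only [e]
    rw [integral_add ((integrable_of_isTest hχ.pdx).restrict.const_mul _)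
      ((integrable_of_isTest hχ.pdy).restrict.const_mul _), integral_const_mul,
      integral_const_mul, integral_pdx_isTest hχ, integral_pdy_isTest hχ]
    ring) hψ (C := M * M) (fun p => by
      rw [abs_mul, abs_mul, mul_comm]
      have h1 := hM p
      have h0 := abs_nonneg (φ p)
      have hM0 := h0.trans h1
      gcongr)
  set D : ℝ × ℝ → ℝ := fun p => v.1 * pdx φ p + v.2 * pdy φ p with hD
  have hder : ∀ p, (0 : ℝ) * (L p * (φ p * φ p)) + v.1 * pdx (fun p => L p * (φ p * φ p)) p +
      v.2 * pdy (fun p => L p * (φ p * φ p)) p = φ p ^ 2 + 2 * (L p * φ p * D p) := by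
    intro p
    have h1 : HasFDerivAt (fun p => L p * (φ p * φ p)) (L p • (φ p • fderiv ℝ φ p +
        φ p • fderiv ℝ φ p) + (φ p * φ p) • L) p :=
      L.hasFDerivAt.mul ((hφ.differentiable p).hasFDerivAt.mul (hφ.differentiable p).hasFDerivAt)
    have h2 : v.1 * L (1, 0) + v.2 * L (0, 1) = 1 := by
      rw [← smul_eq_mul, ← smul_eq_mul, ← map_smul, ← map_smul, ← map_add]
      simpa using hLv
    rw [pdx, pdy, h1.fderiv]
    simp only [hD, pdx, pdy, add_apply, smul_apply, smul_eq_mul]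
    linear_combination (φ p * φ p) * h2
  have isq : ∀ {χ : ℝ × ℝ → ℝ}, IsTest P χ → Integrable (fun p => χ p ^ 2) (volume.restrict U) :=
    fun hχ => by
      have := integrable_mul_fun (hχ.memLp U) (hχ.memLp U)
      simpa only [sq] using this
  have hDt : IsTest P D := by
    have hx := hφ.pdx.mul_left (contDiff_const (c := v.1))
    have hy := hφ.pdy.mul_left (contDiff_const (c := v.2))
    exact ⟨hx.1.add hy.1, hx.2.1.add hy.2.1,
      (tsupport_add _ _).trans (union_subset hx.2.2 hy.2.2)⟩
  have i2 : Integrable (fun p => L p * φ p * D p) (volume.restrict U) :=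
    integrable_mul_fun ((hφ.mul_left L.contDiff).memLp U) (hDt.memLp U)
  rw [act] at hz
  simp only [hder] at hz
  rw [integral_add (isq hφ) (i2.const_mul 2)] at hz
  -- Young's inequality, with `0 < L ≤ 1`
  have h4 : ∫ p in U, -(2 * (L p * φ p * D p)) ≤
      ∫ p in U, ((1 / 2) * φ p ^ 2 + 2 * (pdx φ p ^ 2 + pdy φ p ^ 2)) := by
    refine setIntegral_mono_on (i2.const_mul 2).neg (((isq hφ).const_mul _).add
      (((isq hφ.pdx).add (isq hφ.pdy)).const_mul _)) hUm fun p hp => ?_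
    have hL0 := ((hU p).1 hp).2
    have hL1 := hLU p hp
    have hDle : D p ^ 2 ≤ pdx φ p ^ 2 + pdy φ p ^ 2 := by
      have : pdx φ p ^ 2 + pdy φ p ^ 2 = D p ^ 2 + (v.1 * pdy φ p - v.2 * pdx φ p) ^ 2 := by
        simp only [hD]
        linear_combination (-(pdx φ p ^ 2 + pdy φ p ^ 2)) * hv
      nlinarith [sq_nonneg (v.1 * pdy φ p - v.2 * pdx φ p)]
    have hLD : (L p * D p) ^ 2 ≤ D p ^ 2 := by
      rw [mul_pow]
      have : L p ^ 2 ≤ 1 := by nlinarith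
      nlinarith [sq_nonneg (D p)]
    nlinarith [sq_nonneg (φ p + 2 * (L p * D p))]
  have i3 : Integrable (fun p => pdx φ p ^ 2 + pdy φ p ^ 2) (volume.restrict U) :=
    (isq hφ.pdx).add (isq hφ.pdy)
  rw [integral_neg, integral_add ((isq hφ).const_mul _) (i3.const_mul _), integral_const_mul,
    integral_const_mul, integral_const_mul, integral_add (isq hφ.pdx) (isq hφ.pdy)] at h4
  rw [integral_const_mul] at hz
  linarith

section Energy
variable (U : Set (ℝ × ℝ))

/-- Triples of square integrable functions: a function together with its two partial
derivatives. -/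
abbrev Triple := PiLp 2 fun _ : Fin 3 => Lp ℝ 2 (volume.restrict U)

variable {U}

/-- The triple of three square integrable functions. -/
def mkTriple {α β γ : ℝ × ℝ → ℝ} (hα : MemLp α 2 (volume.restrict U))
    (hβ : MemLp β 2 (volume.restrict U)) (hγ : MemLp γ 2 (volume.restrict U)) : Triple U :=
  WithLp.toLp 2 ![hα.toLp α, hβ.toLp β, hγ.toLp γ]

/-- The triple `x` consists of `φ` and its partial derivatives. -/
def Represents (x : Triple U) (φ : ℝ × ℝ → ℝ) : Prop :=
  x 0 =ᵐ[volume.restrict U] φ ∧ x 1 =ᵐ[volume.restrict U] pdx φ ∧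
    x 2 =ᵐ[volume.restrict U] pdy φ

/-- The triples of test functions in `P`. -/
def testTriples (U P : Set (ℝ × ℝ)) : Submodule ℝ (Triple U) where
  carrier := {x | ∃ φ, IsTest P φ ∧ Represents x φ}
  zero_mem' := by
    refine ⟨fun _ => 0, ⟨contDiff_const, HasCompactSupport.zero, by simp [tsupport]⟩, ?_, ?_, ?_⟩
    · exact Lp.coeFn_zero _ _ _
    · refine (Lp.coeFn_zero _ _ _).trans (Eventually.of_forall fun p => ?_)
      simp [pdx]
    · refine (Lp.coeFn_zero _ _ _).trans (Eventually.of_forall fun p => ?_)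
      simp [pdy]
  add_mem' := by
    rintro x y ⟨φ, hφ, h0, h1, h2⟩ ⟨ψ, hψ, k0, k1, k2⟩
    refine ⟨fun p => φ p + ψ p, ⟨hφ.1.add hψ.1, hφ.2.1.add hψ.2.1,
      (tsupport_add φ ψ).trans (union_subset hφ.2.2 hψ.2.2)⟩, ?_, ?_, ?_⟩
    · filter_upwards [Lp.coeFn_add (x 0) (y 0), h0, k0] with p h h' h''
      rw [PiLp.add_apply, h, Pi.add_apply, h', h'']
    · filter_upwards [Lp.coeFn_add (x 1) (y 1), h1, k1] with p h h' h''
      rw [PiLp.add_apply, h, Pi.add_apply, h', h'', pdx, pdx, pdx,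
        fderiv_fun_add (hφ.differentiable p) (hψ.differentiable p), add_apply]
    · filter_upwards [Lp.coeFn_add (x 2) (y 2), h2, k2] with p h h' h''
      rw [PiLp.add_apply, h, Pi.add_apply, h', h'', pdy, pdy, pdy,
        fderiv_fun_add (hφ.differentiable p) (hψ.differentiable p), add_apply]
  smul_mem' := by
    rintro c x ⟨φ, hφ, h0, h1, h2⟩
    refine ⟨fun p => c * φ p, hφ.mul_left contDiff_const, ?_, ?_, ?_⟩
    · filter_upwards [Lp.coeFn_smul c (x 0), h0] with p h h'
      rw [PiLp.smul_apply, h, Pi.smul_apply, h', smul_eq_mul]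
    · filter_upwards [Lp.coeFn_smul c (x 1), h1] with p h h'
      rw [PiLp.smul_apply, h, Pi.smul_apply, h', smul_eq_mul, pdx, pdx,
        fderiv_const_mul (hφ.differentiable p), smul_apply, smul_eq_mul]
    · filter_upwards [Lp.coeFn_smul c (x 2), h2] with p h h'
      rw [PiLp.smul_apply, h, Pi.smul_apply, h', smul_eq_mul, pdy, pdy,
        fderiv_const_mul (hφ.differentiable p), smul_apply, smul_eq_mul]

lemma inner_mkTriple {α β γ : ℝ × ℝ → ℝ} (hα : MemLp α 2 (volume.restrict U))
    (hβ : MemLp β 2 (volume.restrict U)) (hγ : MemLp γ 2 (volume.restrict U)) (x : Triple U) :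
    inner ℝ (mkTriple hα hβ hγ) x = ∫ p in U, (α p * x 0 p + β p * x 1 p + γ p * x 2 p) := by
  have h : ∀ {f : ℝ × ℝ → ℝ} (hf : MemLp f 2 (volume.restrict U)) (g : Lp ℝ 2 (volume.restrict U)),
      inner ℝ (hf.toLp f) g = ∫ p in U, f p * g p := by
    intro f hf g
    rw [L2.inner_def]
    refine integral_congr_ae ?_
    filter_upwards [hf.coeFn_toLp] with p hp
    rw [hp]
    simp [mul_comm]
  rw [PiLp.inner_apply, Fin.sum_univ_three]
  simp only [mkTriple, Matrix.cons_val_zero, Matrix.cons_val_one, Matrix.cons_val]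
  rw [h, h, h, ← integral_add, ← integral_add]
  · exact (integrable_mul_fun hα (Lp.memLp _)).add (integrable_mul_fun hβ (Lp.memLp _))
  · exact integrable_mul_fun hγ (Lp.memLp _)
  · exact integrable_mul_fun hα (Lp.memLp _)
  · exact integrable_mul_fun hβ (Lp.memLp _)

lemma inner_mkTriple_represents {α β γ φ : ℝ × ℝ → ℝ} (hα : MemLp α 2 (volume.restrict U))
    (hβ : MemLp β 2 (volume.restrict U)) (hγ : MemLp γ 2 (volume.restrict U)) {x : Triple U}
    (hx : Represents x φ) : inner ℝ (mkTriple hα hβ hγ) x = act U α β γ φ := by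
  rw [inner_mkTriple]
  refine integral_congr_ae ?_
  filter_upwards [hx.1, hx.2.1, hx.2.2] with p h0 h1 h2
  rw [h0, h1, h2]

lemma norm_sq_eq_of_ae {f : Lp ℝ 2 (volume.restrict U)} {g : ℝ × ℝ → ℝ}
    (h : f =ᵐ[volume.restrict U] g) : ‖f‖ ^ 2 = ∫ p in U, g p ^ 2 := by
  rw [← real_inner_self_eq_norm_sq, L2.inner_def]
  refine integral_congr_ae ?_
  filter_upwards [h] with p hp
  rw [hp]
  simp [sq]

/-- Lax-Milgram in the closure of the test functions with their gradients, where the Dirichlet form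
is coercive by Poincaré's inequality. -/
lemma exists_mem_closure_bilin {P : Set (ℝ × ℝ)}
    (hpoin : ∀ φ, IsTest P φ →
      ∫ p in U, φ p ^ 2 ≤ 4 * ((∫ p in U, pdx φ p ^ 2) + ∫ p in U, pdy φ p ^ 2))
    (F : Triple U) : ∃ w ∈ (testTriples U P).topologicalClosure,
      ∀ x ∈ (testTriples U P).topologicalClosure,
        inner ℝ (w 1) (x 1) + inner ℝ (w 2) (x 2) = inner ℝ F x := by
  set V := (testTriples U P).topologicalClosure with hV
  have hVc : IsClosed (V : Set (Triple U)) := (testTriples U P).isClosed_topologicalClosure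
  have : CompleteSpace V := hVc.completeSpace_coe
  let pr : Fin 3 → V →L[ℝ] Lp ℝ 2 (volume.restrict U) := fun k =>
    (PiLp.proj (𝕜 := ℝ) 2 (fun _ : Fin 3 => Lp ℝ 2 (volume.restrict U)) k).comp V.subtypeL
  let B : V →L[ℝ] V →L[ℝ] ℝ := (innerSL ℝ).bilinearComp (pr 1) (pr 1) +
    (innerSL ℝ).bilinearComp (pr 2) (pr 2)
  have hB : ∀ x y : V, B x y = inner ℝ (x.1 1) (y.1 1) + inner ℝ (x.1 2) (y.1 2) :=
    fun x y => rfl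
  have hnorm : ∀ x ∈ V, ‖x‖ ^ 2 ≤ 5 * (‖x 1‖ ^ 2 + ‖x 2‖ ^ 2) := by
    have hcl : IsClosed {x : Triple U | ‖x‖ ^ 2 ≤ 5 * (‖x 1‖ ^ 2 + ‖x 2‖ ^ 2)} := by
      refine isClosed_le (by fun_prop) ?_
      have hk : ∀ k : Fin 3, Continuous fun x : Triple U => x k := fun k =>
        (PiLp.proj (𝕜 := ℝ) 2 (fun _ : Fin 3 => Lp ℝ 2 (volume.restrict U)) k).continuous
      exact continuous_const.mul (((hk 1).norm.pow 2).add ((hk 2).norm.pow 2))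
    have hsub : (testTriples U P : Set (Triple U)) ⊆
        {x : Triple U | ‖x‖ ^ 2 ≤ 5 * (‖x 1‖ ^ 2 + ‖x 2‖ ^ 2)} := by
      rintro x ⟨φ, hφ, hx⟩
      have h1 := hpoin φ hφ
      rw [← norm_sq_eq_of_ae hx.1, ← norm_sq_eq_of_ae hx.2.1, ← norm_sq_eq_of_ae hx.2.2] at h1
      have h2 : ‖x‖ ^ 2 = ‖x 0‖ ^ 2 + ‖x 1‖ ^ 2 + ‖x 2‖ ^ 2 := by
        rw [PiLp.norm_sq_eq_of_L2, Fin.sum_univ_three]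
      change ‖x‖ ^ 2 ≤ 5 * (‖x 1‖ ^ 2 + ‖x 2‖ ^ 2)
      linarith
    exact fun x hx => closure_minimal hsub hcl hx
  have hcoer : IsCoercive B := by
    refine ⟨1 / 5, by norm_num, fun x => ?_⟩
    rw [hB, real_inner_self_eq_norm_sq, real_inner_self_eq_norm_sq]
    have h1 := hnorm x x.2
    have h2 : ‖x‖ = ‖(x : Triple U)‖ := rfl
    rw [h2]
    nlinarith
  let ℓ : V →L[ℝ] ℝ := (innerSL ℝ F).comp V.subtypeL
  let f : V := (InnerProductSpace.toDual ℝ V).symm ℓ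
  let w : V := hcoer.continuousLinearEquivOfBilin.symm f
  refine ⟨w, w.2, fun x hx => ?_⟩
  have h1 := hcoer.continuousLinearEquivOfBilin_apply w ⟨x, hx⟩
  have h2 : hcoer.continuousLinearEquivOfBilin w = f :=
    hcoer.continuousLinearEquivOfBilin.apply_symm_apply f
  rw [h2, hB] at h1
  rw [← h1]
  exact InnerProductSpace.toDual_symm_apply

/-- The Lax-Milgram solution of a mixed problem with homogeneous Dirichlet conditions: `w` is a
limit of test functions in `P`, which vanish near the Dirichlet part of the boundary of `U` and are
arbitrary near the Neumann part. -/
lemma exists_energy {P : Set (ℝ × ℝ)}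
    (hpoin : ∀ φ, IsTest P φ →
      ∫ p in U, φ p ^ 2 ≤ 4 * ((∫ p in U, pdx φ p ^ 2) + ∫ p in U, pdy φ p ^ 2))
    {α β γ : ℝ × ℝ → ℝ} (hα : MemLp α 2 (volume.restrict U))
    (hβ : MemLp β 2 (volume.restrict U)) (hγ : MemLp γ 2 (volume.restrict U)) :
    ∃ w : H1 U, (∀ Q, P ∩ Q ⊆ U → ∀ φ, IsTest Q φ → pairX w φ = 0 ∧ pairY w φ = 0) ∧
      ∀ φ, IsTest P φ → act U (fun _ => 0) w.dx w.dy φ = act U α β γ φ := by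
  obtain ⟨w, hwV, hw⟩ := exists_mem_closure_bilin hpoin (mkTriple hα hβ hγ)
  have hlim : ∀ {a b c : ℝ × ℝ → ℝ} (ha : MemLp a 2 (volume.restrict U))
      (hb : MemLp b 2 (volume.restrict U)) (hc : MemLp c 2 (volume.restrict U)),
      (∀ ψ, IsTest P ψ → act U a b c ψ = 0) →
      ∫ p in U, (a p * w 0 p + b p * w 1 p + c p * w 2 p) = 0 := by
    intro a b c ha hb hc h
    rw [← inner_mkTriple ha hb hc]
    have hcl : IsClosed {x : Triple U | inner ℝ (mkTriple ha hb hc) x = 0} :=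
      isClosed_eq (by fun_prop) continuous_const
    refine closure_minimal ?_ hcl hwV
    rintro x ⟨φ, hφ, hx⟩
    exact (inner_mkTriple_represents ha hb hc hx).trans (h φ hφ)
  -- For `ψ` a test function in `P` and `φ` one in `Q`, `φ ψ` has compact support in `U`, hence the
  -- trace of `ψ` tested with `φ` vanishes; the limit `w` inherits this.
  have hX : ∀ Q, P ∩ Q ⊆ U → ∀ φ, IsTest Q φ → act U (w 1) (w 0) (fun _ => 0) φ = 0 := by
    intro Q hQ φ hφ
    have := hlim (hφ.pdx.memLp U) (hφ.memLp U) memLp_zero_fun (fun ψ hψ => by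
      refine Eq.trans (setIntegral_congr_forall fun p => ?_)
        (integral_pdx_isTest (IsTest.mul (U := U) hQ hψ hφ))
      rw [pdx_mul (hψ.differentiable p) (hφ.differentiable p)]
      ring)
    exact (setIntegral_congr_forall fun p => by ring).trans this
  have hY : ∀ Q, P ∩ Q ⊆ U → ∀ φ, IsTest Q φ → act U (w 2) (fun _ => 0) (w 0) φ = 0 := by
    intro Q hQ φ hφ
    have := hlim (hφ.pdy.memLp U) memLp_zero_fun (hφ.memLp U) (fun ψ hψ => by
      refine Eq.trans (setIntegral_congr_forall fun p => ?_)
        (integral_pdy_isTest (IsTest.mul (U := U) hQ hψ hφ))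
      rw [pdy_mul (hψ.differentiable p) (hφ.differentiable p)]
      ring)
    exact (setIntegral_congr_forall fun p => by ring).trans this
  let W : H1 U := ⟨w 0, w 1, w 2, Lp.memLp _, Lp.memLp _, Lp.memLp _,
    fun φ hφ => (weakX_iff (Lp.memLp _) (Lp.memLp _) hφ).2 (hX U inter_subset_right φ hφ),
    fun φ hφ => (weakY_iff (Lp.memLp _) (Lp.memLp _) hφ).2 (hY U inter_subset_right φ hφ)⟩
  refine ⟨W, fun Q hQ φ hφ => ⟨hX Q hQ φ hφ, hY Q hQ φ hφ⟩, fun φ hφ => ?_⟩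
  have hrep : Represents (mkTriple (hφ.memLp U) (hφ.pdx.memLp U) (hφ.pdy.memLp U)) φ :=
    ⟨(hφ.memLp U).coeFn_toLp, (hφ.pdx.memLp U).coeFn_toLp, (hφ.pdy.memLp U).coeFn_toLp⟩
  have h1 := hw _ ((testTriples U P).le_topologicalClosure ⟨φ, hφ, hrep⟩)
  rw [inner_mkTriple_represents hα hβ hγ hrep] at h1
  rw [← h1, L2.inner_def, L2.inner_def, ← integral_add (L2.integrable_inner _ _)
    (L2.integrable_inner _ _)]
  refine integral_congr_ae ?_
  filter_upwards [hrep.2.1, hrep.2.2] with p e1 e2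
  rw [e1, e2]
  simp only [W, RCLike.inner_apply, conj_trivial]
  ring

/-- Solvability of the mixed problem: `-Δu = f`, the Dirichlet data are those of `l`, the Neumann
data are those of `k`. -/
lemma exists_mixed {P : Set (ℝ × ℝ)} (hUP : U ⊆ P)
    (hpoin : ∀ φ, IsTest P φ →
      ∫ p in U, φ p ^ 2 ≤ 4 * ((∫ p in U, pdx φ p ^ 2) + ∫ p in U, pdy φ p ^ 2))
    {f : ℝ × ℝ → ℝ} (hf : MemLp f 2 (volume.restrict U)) (l : H1 U) (k : HDelta U) :
    ∃ u : HDelta U, (∀ p, -u.lap p = f p) ∧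
      (∀ Q, P ∩ Q ⊆ U → ∀ φ, IsTest Q φ →
        pairX u.toH1 φ = pairX l φ ∧ pairY u.toH1 φ = pairY l φ) ∧
      ∀ φ, IsTest P φ → normalPairing u φ = normalPairing k φ := by
  -- The solution is `l + w`, where `w` corrects the equation and the Neumann data of `l`.
  obtain ⟨w, hw, hwP⟩ := exists_energy hpoin (MemLp.comb k.memLp_lap hf 1 1)
    (MemLp.comb k.memLp_dx l.memLp_dx 1 (-1)) (MemLp.comb k.memLp_dy l.memLp_dy 1 (-1))
  have hN : ∀ φ, IsTest P φ → act U (fun p => -f p) (H1.comb 1 l 1 w).dx (H1.comb 1 l 1 w).dy φ =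
      normalPairing k φ := by
    intro φ hφ
    have h1 := act_comb hf.neg l.memLp_dx l.memLp_dy memLp_zero_fun w.memLp_dx w.memLp_dy hφ 1 1
    have h2 := act_comb k.memLp_lap k.memLp_dx k.memLp_dy hf.neg l.memLp_dx l.memLp_dy hφ 1 (-1)
    simp only [Pi.neg_apply, mul_neg, neg_mul, one_mul, mul_zero, add_zero, neg_neg] at h1 h2
    have h3 := hwP φ hφ
    simp only [one_mul, neg_mul] at h3
    simp only [H1.comb, one_mul]
    rw [h1, h3, h2, ← normalPairing_eq]
    change act U (fun p => -f p) _ _ φ + (_ + -act U (fun p => -f p) _ _ φ) = _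
    ring
  refine ⟨⟨H1.comb 1 l 1 w, fun p => -f p, hf.neg, fun φ hφ => ?_⟩, fun p => neg_neg _, ?_, ?_⟩
  · refine (weakLap_iff hf.neg (H1.comb 1 l 1 w).memLp_dx (H1.comb 1 l 1 w).memLp_dy hφ).2 ?_
    exact (hN φ (hφ.mono hUP)).trans (normalPairing_eq_zero k hφ)
  · intro Q hQ φ hφ
    obtain ⟨h1, h2⟩ := hw Q hQ φ hφ
    rw [pairX_comb hφ, pairY_comb hφ, h1, h2]
    constructor <;> ring
  · intro φ hφ
    rw [normalPairing_eq]
    exact hN φ hφ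

end Energy

lemma poincare_nbX (i : Fin 4) {φ : ℝ × ℝ → ℝ} (hφ : IsTest (patch i (nbX i)) φ) :
    ∫ p in sub i, φ p ^ 2 ≤
      4 * ((∫ p in sub i, pdx φ p ^ 2) + ∫ p in sub i, pdy φ p ^ 2) :=
  poincare _ (sx i, 0) (by simpa using sx_mul_self i) (by simp [sq, sx_mul_self])
    (sub_iff_patch_nbX i) (fun p hp => by simpa using ((mem_sub i p).1 hp).1.2.le)
    (isOpen_sub i).measurableSet (volume_sub_ne_top i) hφ

lemma poincare_nbY (i : Fin 4) {φ : ℝ × ℝ → ℝ} (hφ : IsTest (patch i (nbY i)) φ) :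
    ∫ p in sub i, φ p ^ 2 ≤
      4 * ((∫ p in sub i, pdx φ p ^ 2) + ∫ p in sub i, pdy φ p ^ 2) :=
  poincare _ (0, sy i) (by simpa using sy_mul_self i) (by simp [sq, sy_mul_self])
    (sub_iff_patch_nbY i) (fun p hp => by simpa using ((mem_sub i p).1 hp).2.2.le)
    (isOpen_sub i).measurableSet (volume_sub_ne_top i) hφ

lemma patch_inter_patch (i : Fin 4) : patch i (nbX i) ∩ patch i (nbY i) ⊆ sub i := by
  rw [patch_nbX, patch_nbY, sub_eq]
  exact fun p hp => ⟨hp.2.1, hp.1.2⟩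

lemma patch_inter_quadrant_nbX (i : Fin 4) : patch i (nbX i) ∩ quadrant i ⊆ sub i :=
  fun _ hp => ⟨patch_subset_Omega_nbX i hp.1, hp.2⟩

lemma patch_inter_quadrant_nbY (i : Fin 4) : patch i (nbY i) ∩ quadrant i ⊆ sub i :=
  fun _ hp => ⟨patch_subset_Omega_nbY i hp.1, hp.2⟩

/-- Existence for the mixed problem with a Dirichlet condition on the horizontal and a Neumann
condition on the vertical interface. -/
lemma exists_mixedY (i : Fin 4) {f g : ℝ × ℝ → ℝ} (hf : MemLp f 2 (volume.restrict (sub i)))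
    (l : H1 (sub i)) (hl : HasOuterTrace (quadrant i) l g) (k : HDelta (sub i)) :
    ∃ u : HDelta (sub i), (∀ᵐ p ∂volume.restrict (sub i), -u.lap p = f p) ∧
      HasOuterTrace (quadrant i) u.toH1 g ∧
      (∀ φ, IsTest (patch i (nbY i)) φ → pairY u.toH1 φ = pairY l φ) ∧
      ∀ φ, IsTest (patch i (nbX i)) φ → normalPairing u φ = normalPairing k φ := by
  obtain ⟨u, h1, h2, h3⟩ := exists_mixed (sub_subset_patch_nbX i)
    (fun φ hφ => poincare_nbX i hφ) hf l k
  refine ⟨u, Eventually.of_forall h1, ?_, fun φ hφ => (h2 _ (patch_inter_patch i) φ hφ).2, h3⟩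
  rw [hasOuterTrace_iff] at hl ⊢
  intro φ hφ
  obtain ⟨e1, e2⟩ := h2 _ (patch_inter_quadrant_nbX i) φ hφ
  rw [e1, e2]
  exact hl φ hφ

/-- Existence for the mixed problem with a Dirichlet condition on the vertical and a Neumann
condition on the horizontal interface. -/
lemma exists_mixedX (i : Fin 4) {f g : ℝ × ℝ → ℝ} (hf : MemLp f 2 (volume.restrict (sub i)))
    (l : H1 (sub i)) (hl : HasOuterTrace (quadrant i) l g) (k : HDelta (sub i)) :
    ∃ u : HDelta (sub i), (∀ᵐ p ∂volume.restrict (sub i), -u.lap p = f p) ∧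
      HasOuterTrace (quadrant i) u.toH1 g ∧
      (∀ φ, IsTest (patch i (nbX i)) φ → pairX u.toH1 φ = pairX l φ) ∧
      ∀ φ, IsTest (patch i (nbY i)) φ → normalPairing u φ = normalPairing k φ := by
  obtain ⟨u, h1, h2, h3⟩ := exists_mixed (sub_subset_patch_nbY i)
    (fun φ hφ => poincare_nbY i hφ) hf l k
  refine ⟨u, Eventually.of_forall h1, ?_,
    fun φ hφ => (h2 _ (by rw [inter_comm]; exact patch_inter_patch i) φ hφ).1, h3⟩
  rw [hasOuterTrace_iff] at hl ⊢
  intro φ hφ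
  obtain ⟨e1, e2⟩ := h2 _ (patch_inter_quadrant_nbY i) φ hφ
  rw [e1, e2]
  exact hl φ hφ

/-! ### Boundary layers -/

lemma deriv_cut_nonneg (n : ℕ) (t : ℝ) : 0 ≤ deriv (cut n) t := by
  have : Monotone (cut n) := fun a b h => Real.smoothTransition.monotone (by gcongr)
  exact this.deriv_nonneg

lemma continuous_deriv_cut (n : ℕ) : Continuous (deriv (cut n)) :=
  (cut_contDiff n).continuous_deriv (by simp)

lemma deriv_cut_eq_zero_of_le {n : ℕ} {t : ℝ} (h : t ≤ 0) : deriv (cut n) t = 0 := by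
  rw [deriv_cut_eq, deriv_smoothTransition_of_lt, zero_mul]
  nlinarith [(Nat.cast_nonneg n : (0 : ℝ) ≤ n)]

lemma deriv_cut_eq_zero_of_lt {n : ℕ} {t : ℝ} (h : 2 < n * t) : deriv (cut n) t = 0 := by
  rw [deriv_cut_eq, deriv_smoothTransition_of_gt (by linarith), zero_mul]

/-- The position `t₀` and the direction `σ` of a boundary layer in `[-1, 1]`. -/
structure IsLayer (σ t₀ : ℝ) : Prop where
  sign : σ = 1 ∨ σ = -1
  mem : t₀ ∈ Icc (-1 : ℝ) 1
  add_mem : t₀ + σ ∈ Icc (-1 : ℝ) 1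

lemma IsLayer.integral_eq_one {σ t₀ : ℝ} (h : IsLayer σ t₀) {n : ℕ} (hn : 2 ≤ n) :
    ∫ t in Icc (-1 : ℝ) 1, deriv (cut n) (σ * (t - t₀)) = 1 := by
  have hn' : (2 : ℝ) ≤ n := by exact_mod_cast hn
  have hd : ∀ t : ℝ, HasDerivAt (fun t => σ * cut n (σ * (t - t₀)))
      (deriv (cut n) (σ * (t - t₀))) t := by
    intro t
    have h1 : HasDerivAt (fun t : ℝ => σ * (t - t₀)) σ t := by
      simpa using ((hasDerivAt_id t).sub_const t₀).const_mul σ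
    have h2 := ((cut_hasDerivAt n (σ * (t - t₀))).comp t h1).const_mul σ
    refine h2.congr_deriv ?_
    rcases h.sign with h | h <;> rw [h] <;> ring
  rw [integral_Icc_eq_integral_Ioc, ← intervalIntegral.integral_of_le (by norm_num),
    intervalIntegral.integral_eq_sub_of_hasDerivAt (fun t _ => hd t)
      (((continuous_deriv_cut n).comp (by fun_prop)).intervalIntegrable _ _)]
  obtain ⟨hσ, h1, h2⟩ := h
  rcases hσ with rfl | rfl
  · rw [cut_eq_one (t := 1 * (1 - t₀)) (by nlinarith [h2.2]),
      cut_eq_zero (t := 1 * (-1 - t₀)) (by nlinarith [h1.1])]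
    norm_num
  · rw [cut_eq_zero (t := -1 * (1 - t₀)) (by nlinarith [h1.2]),
      cut_eq_one (t := -1 * (-1 - t₀)) (by nlinarith [h2.1])]
    norm_num

lemma IsLayer.tendsto {σ t₀ : ℝ} (h : IsLayer σ t₀) {F : ℝ → ℝ}
    (hF : ContinuousOn F (Icc (-1) 1)) :
    Tendsto (fun n : ℕ => ∫ t in Icc (-1 : ℝ) 1, deriv (cut n) (σ * (t - t₀)) * F t) atTop
      (𝓝 (F t₀)) := by
  refine tendsto_setIntegral_peak_smul_of_integrableOn_of_tendsto (φ := fun n t =>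
    deriv (cut n) (σ * (t - t₀))) measurableSet_Icc measurableSet_Icc subset_rfl
    self_mem_nhdsWithin (by simp) (Eventually.of_forall fun n t _ => deriv_cut_nonneg n _) ?_ ?_ ?_
    (hF.integrableOn_compact isCompact_Icc) (hF t₀ h.mem)
  · intro u hu htu
    obtain ⟨ε, hε, hball⟩ := Metric.isOpen_iff.1 hu t₀ htu
    rw [Metric.tendstoUniformlyOn_iff]
    intro δ hδ
    have h1 : Tendsto (fun n : ℕ => (n : ℝ) * ε) atTop atTop :=
      tendsto_natCast_atTop_atTop.atTop_mul_const hε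
    filter_upwards [h1.eventually_gt_atTop 2] with n hn t ht
    have hz : deriv (cut n) (σ * (t - t₀)) = 0 := by
      rcases le_or_gt (σ * (t - t₀)) 0 with hs | hs
      · exact deriv_cut_eq_zero_of_le hs
      · refine deriv_cut_eq_zero_of_lt (hn.trans_le ?_)
        have h2 : ε ≤ |t - t₀| := by
          by_contra hlt
          exact ht.2 (hball (by simpa [Real.dist_eq] using not_le.1 hlt))
        have h3 : σ * (t - t₀) = |t - t₀| := by
          rw [← abs_of_pos hs, abs_mul]
          rcases h.sign with h | h <;> simp [h]
        rw [h3]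
        gcongr
    simpa [hz] using hδ
  · refine tendsto_const_nhds.congr' ?_
    filter_upwards [eventually_ge_atTop 2] with n hn
    exact (h.integral_eq_one hn).symm
  · exact Eventually.of_forall fun n =>
      ((continuous_deriv_cut n).comp (by fun_prop)).aestronglyMeasurable

lemma closure_Omega : closure Omega = Icc (-1) 1 ×ˢ Icc (-1) 1 := by
  rw [Omega, closure_prod_eq, closure_Ioo (by norm_num)]

lemma restrict_Omega : (volume : Measure (ℝ × ℝ)).restrict Omega =
    (volume.restrict (Icc (-1 : ℝ) 1)).prod (volume.restrict (Icc (-1 : ℝ) 1)) := by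
  rw [Measure.prod_restrict, ← Measure.volume_eq_prod]
  exact Measure.restrict_congr_set (Measure.set_prod_ae_eq Ioo_ae_eq_Icc Ioo_ae_eq_Icc)

lemma integrableOn_Omega_of_continuousOn {H : ℝ × ℝ → ℝ} (hH : ContinuousOn H (closure Omega)) :
    IntegrableOn H Omega := by
  refine (hH.integrableOn_compact ?_).mono_set subset_closure
  rw [closure_Omega]
  exact isCompact_Icc.prod isCompact_Icc

/-- A boundary layer of `p ↦ cut n (σ (p.1 - t₀))` concentrates on the line `p.1 = t₀`. -/
lemma IsLayer.tendsto_fst {σ t₀ : ℝ} (h : IsLayer σ t₀) {H : ℝ × ℝ → ℝ}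
    (hH : ContinuousOn H (closure Omega)) {c : ℕ → ℝ → ℝ} {c' : ℝ → ℝ}
    (hc : ∀ n, Continuous (c n)) (hc1 : ∀ n y, |c n y| ≤ 1)
    (hc' : ∀ᵐ y : ℝ ∂volume.restrict (Icc (-1 : ℝ) 1), Tendsto (fun n => c n y) atTop (𝓝 (c' y))) :
    Tendsto (fun n : ℕ => ∫ p in Omega, c n p.2 * (deriv (cut n) (σ * (p.1 - t₀)) * H p)) atTop
      (𝓝 (∫ y in Icc (-1 : ℝ) 1, c' y * H (t₀, y))) := by
  have hslice : ∀ y ∈ Icc (-1 : ℝ) 1, ContinuousOn (fun t => H (t, y)) (Icc (-1) 1) := by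
    intro y hy
    refine hH.comp (by fun_prop) fun t ht => ?_
    rw [closure_Omega]
    exact ⟨ht, hy⟩
  obtain ⟨M, hM⟩ := (closure_Omega ▸ isCompact_Icc.prod isCompact_Icc :
    IsCompact (closure Omega)).exists_bound_of_continuousOn hH
  rw [closure_Omega] at hM
  have hint : ∀ n, IntegrableOn
      (fun p : ℝ × ℝ => c n p.2 * (deriv (cut n) (σ * (p.1 - t₀)) * H p)) Omega := fun n =>
    integrableOn_Omega_of_continuousOn ((((hc n).comp continuous_snd).continuousOn).mul
      ((((continuous_deriv_cut n).comp (by fun_prop)).continuousOn).mul hH))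
  have hEq : ∀ n, ∫ p in Omega, c n p.2 * (deriv (cut n) (σ * (p.1 - t₀)) * H p) =
      ∫ y in Icc (-1 : ℝ) 1, c n y *
        ∫ t in Icc (-1 : ℝ) 1, deriv (cut n) (σ * (t - t₀)) * H (t, y) := by
    intro n
    have h1 := hint n
    rw [IntegrableOn, restrict_Omega] at h1
    rw [restrict_Omega, integral_prod_symm _ h1]
    simp only [integral_const_mul]
  simp only [hEq]
  refine tendsto_integral_filter_of_dominated_convergence (fun _ => M) ?_ ?_
    (integrable_const M) ?_
  · refine Eventually.of_forall fun n => ?_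
    have h1 := hint n
    rw [IntegrableOn, restrict_Omega] at h1
    have h2 := h1.integral_prod_right.aestronglyMeasurable
    simpa only [integral_const_mul] using h2
  · filter_upwards [eventually_ge_atTop 2] with n hn
    filter_upwards [ae_restrict_mem measurableSet_Icc] with y hy
    rw [norm_mul, Real.norm_eq_abs]
    refine (mul_le_of_le_one_left (norm_nonneg _) (hc1 n y)).trans ?_
    calc ‖∫ t in Icc (-1 : ℝ) 1, deriv (cut n) (σ * (t - t₀)) * H (t, y)‖
        ≤ ∫ t in Icc (-1 : ℝ) 1, deriv (cut n) (σ * (t - t₀)) * M := by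
          refine norm_integral_le_of_norm_le ?_ ?_
          · exact (((continuous_deriv_cut n).comp (by fun_prop)).continuousOn.mul
              continuousOn_const).integrableOn_compact isCompact_Icc
          · filter_upwards [ae_restrict_mem measurableSet_Icc] with t ht
            rw [norm_mul, Real.norm_of_nonneg (deriv_cut_nonneg n _)]
            exact mul_le_mul_of_nonneg_left (hM (t, y) ⟨ht, hy⟩) (deriv_cut_nonneg n _)
      _ = M := by rw [integral_mul_const, h.integral_eq_one hn, one_mul]
  · filter_upwards [ae_restrict_mem measurableSet_Icc, hc'] with y hy hcy
    exact hcy.mul (h.tendsto (hslice y hy))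

lemma integral_Omega_swap (F : ℝ × ℝ → ℝ) :
    ∫ p in Omega, F p.swap = ∫ p in Omega, F p := by
  rw [restrict_Omega]
  exact integral_prod_swap F

lemma IsLayer.tendsto_snd {σ t₀ : ℝ} (h : IsLayer σ t₀) {H : ℝ × ℝ → ℝ}
    (hH : ContinuousOn H (closure Omega)) {c : ℕ → ℝ → ℝ} {c' : ℝ → ℝ}
    (hc : ∀ n, Continuous (c n)) (hc1 : ∀ n x, |c n x| ≤ 1)
    (hc' : ∀ᵐ x : ℝ ∂volume.restrict (Icc (-1 : ℝ) 1), Tendsto (fun n => c n x) atTop (𝓝 (c' x))) :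
    Tendsto (fun n : ℕ => ∫ p in Omega, c n p.1 * (deriv (cut n) (σ * (p.2 - t₀)) * H p)) atTop
      (𝓝 (∫ x in Icc (-1 : ℝ) 1, c' x * H (x, t₀))) := by
  have hH' : ContinuousOn (fun p : ℝ × ℝ => H p.swap) (closure Omega) := by
    refine hH.comp continuous_swap.continuousOn fun p hp => ?_
    rw [closure_Omega] at hp ⊢
    exact ⟨hp.2, hp.1⟩
  refine (h.tendsto_fst hH' hc hc1 hc').congr fun n => ?_
  rw [← integral_Omega_swap fun p => c n p.1 * (deriv (cut n) (σ * (p.2 - t₀)) * H p)]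
  rfl

/-! ### Traces of continuous Sobolev functions -/

lemma deriv_cutI_eq {n : ℕ} (hn : 2 ≤ n) (x : ℝ) :
    deriv (cutI (-1) 1 n) x = deriv (cut n) (1 * (x - -1)) - deriv (cut n) (-1 * (x - 1)) := by
  have hn' : (2 : ℝ) ≤ n := by exact_mod_cast hn
  have e1 : -1 * (x - 1) = 1 - x := by ring
  rw [(hasDerivAt_cutI (-1) 1 n x).deriv, one_mul, e1]
  congr 1
  · by_cases h : 2 < n * (x - -1)
    · rw [deriv_cut_eq_zero_of_lt h, zero_mul]
    · rw [cut_eq_one (t := 1 - x), mul_one]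
      nlinarith
  · by_cases h : 2 < n * (1 - x)
    · rw [deriv_cut_eq_zero_of_lt h, mul_zero]
    · rw [cut_eq_one (t := x - -1), one_mul]
      nlinarith

lemma isLayer_left : IsLayer 1 (-1) := ⟨Or.inl rfl, by norm_num, by norm_num⟩

lemma isLayer_right : IsLayer (-1) 1 := ⟨Or.inr rfl, by norm_num, by norm_num⟩

lemma isLayer_zero {σ : ℝ} (h : σ = 1 ∨ σ = -1) : IsLayer σ 0 :=
  ⟨h, by norm_num, by rcases h with rfl | rfl <;> norm_num⟩

lemma ae_cutI_tendsto : ∀ᵐ x : ℝ ∂volume.restrict (Icc (-1 : ℝ) 1),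
    Tendsto (fun n => cutI (-1) 1 n x) atTop (𝓝 1) := by
  rw [← restrict_Ioo_eq_restrict_Icc]
  filter_upwards [ae_restrict_mem measurableSet_Ioo] with x hx
  refine tendsto_const_nhds.congr' ?_
  filter_upwards [cutI_eventually hx] with n hn
  exact hn.1.symm

lemma tendsto_integral_cutI_mul {A : ℝ × ℝ → ℝ} (hA : IntegrableOn A Omega) :
    Tendsto (fun n => ∫ p in Omega, cutI (-1) 1 n p.1 * cutI (-1) 1 n p.2 * A p) atTop
      (𝓝 (∫ p in Omega, A p)) := by
  refine tendsto_integral_of_dominated_convergence (fun p => ‖A p‖) (fun n => ?_) hA.norm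
    (fun n => Eventually.of_forall fun p => ?_) ?_
  · exact (Continuous.aestronglyMeasurable (((cutI_contDiff (-1) 1 n).continuous.comp
      continuous_fst).mul ((cutI_contDiff (-1) 1 n).continuous.comp continuous_snd))).mul hA.1
  · rw [norm_mul]
    refine mul_le_of_le_one_left (norm_nonneg _) ?_
    rw [Real.norm_eq_abs, abs_mul]
    exact mul_le_one₀ (abs_cutI_le_one _ _ _ _) (abs_nonneg _) (abs_cutI_le_one _ _ _ _)
  · filter_upwards [ae_restrict_mem isOpen_Omega.measurableSet] with p hp
    refine tendsto_const_nhds.congr' ?_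
    filter_upwards [cutI_eventually hp.1, cutI_eventually hp.2] with n h1 h2
    rw [h1.1, h2.1]
    ring

/-- If the cutoff functions of the square are inserted into a divergence and the result is zero,
then their boundary layers turn into a boundary integral. -/
lemma integral_eq_boundary_fst {H A : ℝ × ℝ → ℝ} (hH : ContinuousOn H (closure Omega))
    (hA : IntegrableOn A Omega)
    (h : ∀ n, ∫ p in Omega, (cutI (-1) 1 n p.2 * (deriv (cutI (-1) 1 n) p.1 * H p) +
      cutI (-1) 1 n p.1 * cutI (-1) 1 n p.2 * A p) = 0) :
    ∫ p in Omega, A p = ∫ y in (-1 : ℝ)..1, (H (1, y) - H (-1, y)) := by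
  have hc : ∀ n, Continuous (cutI (-1) 1 n) := fun n => (cutI_contDiff (-1) 1 n).continuous
  have hline : ∀ t ∈ Icc (-1 : ℝ) 1, IntegrableOn (fun y => H (t, y)) (Icc (-1) 1) := fun t ht =>
    (hH.comp (by fun_prop) fun y hy => by
      rw [closure_Omega]; exact ⟨ht, hy⟩).integrableOn_compact isCompact_Icc
  have h1 := isLayer_left.tendsto_fst hH hc (fun n y => abs_cutI_le_one _ _ n y) ae_cutI_tendsto
  have h2 := isLayer_right.tendsto_fst hH hc (fun n y => abs_cutI_le_one _ _ n y) ae_cutI_tendsto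
  have h3 := (h1.sub h2).add (tendsto_integral_cutI_mul hA)
  have hintL : ∀ (σ t₀ : ℝ) (n : ℕ), IntegrableOn (fun p : ℝ × ℝ =>
      cutI (-1) 1 n p.2 * (deriv (cut n) (σ * (p.1 - t₀)) * H p)) Omega := fun σ t₀ n =>
    integrableOn_Omega_of_continuousOn ((((hc n).comp continuous_snd).continuousOn).mul
      ((((continuous_deriv_cut n).comp (by fun_prop)).continuousOn).mul hH))
  have hintA : ∀ n, IntegrableOn (fun p : ℝ × ℝ =>
      cutI (-1) 1 n p.1 * cutI (-1) 1 n p.2 * A p) Omega := by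
    intro n
    refine hA.bdd_mul (c := 1) (Continuous.aestronglyMeasurable
      (((hc n).comp continuous_fst).mul ((hc n).comp continuous_snd))) ?_
    refine Eventually.of_forall fun p => ?_
    rw [Real.norm_eq_abs, abs_mul]
    exact mul_le_one₀ (abs_cutI_le_one _ _ _ _) (abs_nonneg _) (abs_cutI_le_one _ _ _ _)
  have h4 := tendsto_nhds_unique (h3.congr' (f₂ := fun _ => (0 : ℝ)) ?_) tendsto_const_nhds
  · have e1 := hline 1 (by norm_num)
    have e2 := hline (-1) (by norm_num)
    rw [intervalIntegral.integral_of_le (by norm_num), ← integral_Icc_eq_integral_Ioc,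
      integral_sub e1 e2]
    simp only [one_mul] at h4
    linarith
  · filter_upwards [eventually_ge_atTop 2] with n hn
    rw [← integral_sub (hintL 1 (-1) n) (hintL (-1) 1 n), ← integral_add
      (f := fun p : ℝ × ℝ => cutI (-1) 1 n p.2 * (deriv (cut n) (1 * (p.1 - -1)) * H p) -
        cutI (-1) 1 n p.2 * (deriv (cut n) (-1 * (p.1 - 1)) * H p))
      ((hintL 1 (-1) n).sub (hintL (-1) 1 n)) (hintA n), ← h n]
    refine setIntegral_congr_fun isOpen_Omega.measurableSet fun p _ => ?_
    rw [deriv_cutI_eq hn]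
    ring

lemma integral_eq_boundary_snd {H A : ℝ × ℝ → ℝ} (hH : ContinuousOn H (closure Omega))
    (hA : IntegrableOn A Omega)
    (h : ∀ n, ∫ p in Omega, (cutI (-1) 1 n p.1 * (deriv (cutI (-1) 1 n) p.2 * H p) +
      cutI (-1) 1 n p.1 * cutI (-1) 1 n p.2 * A p) = 0) :
    ∫ p in Omega, A p = ∫ x in (-1 : ℝ)..1, (H (x, 1) - H (x, -1)) := by
  rw [← integral_Omega_swap A]
  refine integral_eq_boundary_fst (H := fun p => H p.swap) (A := fun p => A p.swap) ?_ ?_ ?_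
  · refine hH.comp continuous_swap.continuousOn fun p hp => ?_
    rw [closure_Omega] at hp ⊢
    exact ⟨hp.2, hp.1⟩
  · rw [IntegrableOn, restrict_Omega] at hA ⊢
    exact hA.swap
  · intro n
    rw [← h n, ← integral_Omega_swap]
    refine setIntegral_congr_forall fun p => ?_
    simp only [Prod.swap_swap, Prod.fst_swap, Prod.snd_swap]
    ring

lemma isTest_cutI_mul (n : ℕ) {φ : ℝ × ℝ → ℝ} (hφ : IsTest univ φ) :
    IsTest Omega (fun p => cutI (-1) 1 n p.1 * cutI (-1) 1 n p.2 * φ p) := by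
  have h1 := (cutI_mul_isTest1 (-1) 1 n contDiff_const (a := fun _ => (1 : ℝ))).tensor
    (cutI_mul_isTest1 (-1) 1 n contDiff_const (a := fun _ => (1 : ℝ)))
  simp only [mul_one] at h1
  have h2 := h1.mul_left hφ.1
  simpa only [mul_comm, Omega] using h2

/-- The outer trace of a continuous function is its restriction to the boundary. -/
lemma hasOuterTrace_of_continuousOn (w : H1 Omega) (hw : ContinuousOn w.val (closure Omega))
    {g : ℝ × ℝ → ℝ} (hg : ∀ p ∈ frontier Omega, w.val p = g p) : HasOuterTrace univ w g := by
  have hfr : ∀ p : ℝ × ℝ, p ∈ closure Omega → p ∉ Omega → w.val p = g p := fun p h1 h2 =>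
    hg p ⟨h1, by rwa [isOpen_Omega.interior_eq]⟩
  rw [hasOuterTrace_iff]
  intro φ hφ
  have hφc : ContinuousOn (fun p => w.val p * φ p) (closure Omega) :=
    hw.mul hφ.1.continuous.continuousOn
  have hd : ∀ (n : ℕ) (p : ℝ × ℝ), DifferentiableAt ℝ
      (fun p : ℝ × ℝ => cutI (-1) 1 n p.1 * cutI (-1) 1 n p.2) p := fun n p =>
    (hasFDerivAt_tensor ((cutI_contDiff (-1) 1 n).differentiable (by simp))
      ((cutI_contDiff (-1) 1 n).differentiable (by simp)) p).differentiableAt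
  constructor
  · have := integral_eq_boundary_fst hφc
      (act_integrable w.memLp_dx w.memLp_val memLp_zero_fun hφ) fun n => ?_
    · refine this.trans (intervalIntegral.integral_congr fun y hy => ?_)
      rw [uIcc_of_le (by norm_num)] at hy
      rw [hfr (1, y) (by rw [closure_Omega]; exact ⟨by norm_num, hy⟩)
        (fun h => absurd h.1.2 (lt_irrefl _)),
        hfr (-1, y) (by rw [closure_Omega]; exact ⟨by norm_num, hy⟩)
        (fun h => absurd h.1.1 (lt_irrefl _))]
    · refine Eq.trans ?_ (pairX_eq_zero w (isTest_cutI_mul n hφ))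
      refine setIntegral_congr_forall fun p => ?_
      rw [pdx_mul (hd n p) (hφ.differentiable p), pdx_tensor
        ((cutI_contDiff (-1) 1 n).differentiable (by simp))
        ((cutI_contDiff (-1) 1 n).differentiable (by simp))]
      ring
  · have := integral_eq_boundary_snd hφc
      (act_integrable w.memLp_dy memLp_zero_fun w.memLp_val hφ) fun n => ?_
    · refine this.trans (intervalIntegral.integral_congr fun y hy => ?_)
      rw [uIcc_of_le (by norm_num)] at hy
      rw [hfr (y, 1) (by rw [closure_Omega]; exact ⟨hy, by norm_num⟩)
        (fun h => absurd h.2.2 (lt_irrefl _)),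
        hfr (y, -1) (by rw [closure_Omega]; exact ⟨hy, by norm_num⟩)
        (fun h => absurd h.2.1 (lt_irrefl _))]
    · refine Eq.trans ?_ (pairY_eq_zero w (isTest_cutI_mul n hφ))
      refine setIntegral_congr_forall fun p => ?_
      rw [pdy_mul (hd n p) (hφ.differentiable p), pdy_tensor
        ((cutI_contDiff (-1) 1 n).differentiable (by simp))
        ((cutI_contDiff (-1) 1 n).differentiable (by simp))]
      ring

lemma tendsto_integral_cut_mul (s : ℝ) {A : ℝ × ℝ → ℝ} (hA : IntegrableOn A Omega) :
    Tendsto (fun n => ∫ p in Omega, cut n (s * p.2) * A p) atTop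
      (𝓝 (∫ p in Omega, {p : ℝ × ℝ | 0 < s * p.2}.indicator A p)) := by
  refine tendsto_integral_of_dominated_convergence (fun p => ‖A p‖) (fun n => ?_) hA.norm
    (fun n => Eventually.of_forall fun p => ?_) (Eventually.of_forall fun p => ?_)
  · exact (((cut_contDiff n).continuous.comp
      (by fun_prop : Continuous fun p : ℝ × ℝ => s * p.2)).aestronglyMeasurable).mul hA.1
  · rw [norm_mul]
    exact mul_le_of_le_one_left (norm_nonneg _) (abs_cut_le_one _ _)
  · by_cases hp : 0 < s * p.2
    · rw [indicator_of_mem (show p ∈ {p : ℝ × ℝ | 0 < s * p.2} from hp)]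
      refine tendsto_const_nhds.congr' ?_
      filter_upwards [cut_eventually hp] with n hn
      rw [hn, one_mul]
    · rw [indicator_of_notMem (show p ∉ {p : ℝ × ℝ | 0 < s * p.2} from hp)]
      refine tendsto_const_nhds.congr fun n => ?_
      rw [cut_eq_zero, zero_mul]
      nlinarith [(Nat.cast_nonneg n : (0 : ℝ) ≤ n)]

lemma isTest_cut_mul (i : Fin 4) (n : ℕ) {φ : ℝ × ℝ → ℝ} (hφ : IsTest (patch i (nbY i)) φ) :
    IsTest (sub i) (fun p => cut n (sy i * p.2) * φ p) := by
  have h1 := hφ.mul_left ((cut_contDiff n).comp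
    (by fun_prop : ContDiff ℝ ∞ fun p : ℝ × ℝ => sy i * p.2))
  refine ⟨h1.1, h1.2.1, fun p hp => (sub_iff_patch_nbY i p).2 ⟨h1.2.2 hp, ?_⟩⟩
  have : tsupport (fun p : ℝ × ℝ => cut n (sy i * p.2) * φ p) ⊆
      {q | (1 : ℝ) ≤ n * (sy i * q.2)} := by
    refine closure_minimal (fun q hq => ?_) (isClosed_le continuous_const (by fun_prop))
    by_contra hlt
    exact hq (by simp [cut_eq_zero (le_of_lt (not_le.1 hlt))])
  have h2 : (1 : ℝ) ≤ n * (sy i * p.2) := this hp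
  by_contra hneg
  simp at hneg
  nlinarith [(Nat.cast_nonneg n : (0 : ℝ) ≤ n)]

/-- The trace on a horizontal interface of a continuous function which vanishes there is zero. -/
lemma pairY_loc_eq_zero (w : H1 Omega) (hw : ContinuousOn w.val (closure Omega))
    (h0 : ∀ x ∈ Icc (-1 : ℝ) 1, w.val (x, 0) = 0) (i : Fin 4) {φ : ℝ × ℝ → ℝ}
    (hφ : IsTest (patch i (nbY i)) φ) : pairY (w.loc i) φ = 0 := by
  have hφc : ContinuousOn (fun p => w.val p * φ p) (closure Omega) :=
    hw.mul hφ.1.continuous.continuousOn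
  have hA := act_integrable w.memLp_dy memLp_zero_fun w.memLp_val hφ
  have h1 := ((isLayer_zero (sy_cases i)).tendsto_snd hφc (c := fun _ _ => 1) (c' := fun _ => 1)
    (fun n => continuous_const) (fun n y => by simp)
    (Eventually.of_forall fun _ => tendsto_const_nhds)).const_mul (sy i)
  have h2 := h1.add (tendsto_integral_cut_mul (sy i) hA)
  have hint : ∀ n : ℕ, IntegrableOn (fun p : ℝ × ℝ =>
      (1 : ℝ) * (deriv (cut n) (sy i * (p.2 - 0)) * (w.val p * φ p))) Omega := fun n =>
    integrableOn_Omega_of_continuousOn (continuousOn_const.mul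
      ((((continuous_deriv_cut n).comp (by fun_prop)).continuousOn).mul hφc))
  have hint2 : ∀ n : ℕ, IntegrableOn (fun p : ℝ × ℝ => cut n (sy i * p.2) *
      (w.dy p * φ p + 0 * pdx φ p + w.val p * pdy φ p)) Omega := fun n =>
    Integrable.bdd_mul (c := 1) hA (((cut_contDiff n).continuous.comp
      (by fun_prop : Continuous fun p : ℝ × ℝ => sy i * p.2)).aestronglyMeasurable)
      (Eventually.of_forall fun p => abs_cut_le_one _ _)
  have h3 := tendsto_nhds_unique (h2.congr (f₂ := fun _ => (0 : ℝ)) fun n => ?_)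
    tendsto_const_nhds
  · have h4 : ∫ x in Icc (-1 : ℝ) 1, (1 : ℝ) * (w.val (x, 0) * φ (x, 0)) = 0 := by
      rw [setIntegral_congr_fun (g := fun _ => (0 : ℝ)) measurableSet_Icc fun x hx => by
        simp [h0 x hx]]
      simp
    rw [h4, mul_zero, zero_add] at h3
    refine Eq.trans ?_ h3
    rw [setIntegral_indicator (measurableSet_lt measurable_const (by fun_prop))]
    refine (setIntegral_eq_of_subset_of_forall_sdiff_eq_zero
      (isOpen_Omega.measurableSet.inter (measurableSet_lt measurable_const (by fun_prop)))
      (fun p hp => ⟨sub_subset i hp, ?_⟩) fun p hp => ?_).symm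
    · exact ((mem_sub i p).1 hp).2.1
    · have hq : p ∉ patch i (nbY i) := fun h => hp.2 ((sub_iff_patch_nbY i p).2
        ⟨h, by simpa using hp.1.2⟩)
      rw [hφ.eq_zero hq, hφ.pdx.eq_zero hq, hφ.pdy.eq_zero hq]
      ring
  · rw [← integral_const_mul, ← integral_add ((hint n).const_mul (sy i)) (hint2 n)]
    refine Eq.trans ?_ (pairY_eq_zero w ((isTest_cut_mul i n hφ).mono (sub_subset i)))
    refine setIntegral_congr_forall fun p => ?_
    have hd : HasFDerivAt (fun p : ℝ × ℝ => cut n (sy i * p.2)) (deriv (cut n) (sy i * p.2) •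
        (sy i • ContinuousLinearMap.snd ℝ ℝ ℝ)) p := by
      have h1 : HasFDerivAt (fun p : ℝ × ℝ => sy i * p.2)
          (sy i • ContinuousLinearMap.snd ℝ ℝ ℝ) p := hasFDerivAt_snd.const_mul (sy i)
      have h2 := (cut_hasDerivAt n (sy i * p.2)).comp_hasFDerivAt p h1
      exact h2
    rw [pdy_mul hd.differentiableAt (hφ.differentiable p)]
    have : pdy (fun p : ℝ × ℝ => cut n (sy i * p.2)) p = deriv (cut n) (sy i * p.2) * sy i := by
      rw [pdy, hd.fderiv]
      simp
    rw [this, sub_zero]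
    ring

/-! ### Lifting of compatible boundary values -/

lemma IsTest1.deriv {P : Set ℝ} {a : ℝ → ℝ} (ha : IsTest1 P a) : IsTest1 P (deriv a) :=
  ⟨contDiff_deriv ha.1, ha.2.1.deriv, tsupport_deriv_subset.trans ha.2.2⟩

lemma MemLp.mul_of_bound {U : Set (ℝ × ℝ)} {f b : ℝ × ℝ → ℝ} (hf : MemLp f 2 (volume.restrict U))
    (hb : Continuous b) {C : ℝ} (hC : ∀ᵐ p ∂volume.restrict U, |b p| ≤ C) :
    MemLp (fun p => b p * f p) 2 (volume.restrict U) := by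
  refine MemLp.of_le_mul (c := C) hf (hb.aestronglyMeasurable.mul hf.1) ?_
  filter_upwards [hC] with p hp
  rw [norm_mul]
  gcongr
  exact hp

lemma sq_integral_le {f : ℝ → ℝ} (hf : Integrable f (volume.restrict (Icc (-1) 1)))
    (hf2 : Integrable (fun t => f t ^ 2) (volume.restrict (Icc (-1) 1))) :
    (∫ t in Icc (-1 : ℝ) 1, f t) ^ 2 ≤ 2 * ∫ t in Icc (-1 : ℝ) 1, f t ^ 2 := by
  set I := ∫ t in Icc (-1 : ℝ) 1, f t with hI
  have h1 : 0 ≤ ∫ t in Icc (-1 : ℝ) 1, (f t - I / 2) ^ 2 :=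
    integral_nonneg fun t => sq_nonneg _
  have h2 : ∀ t, (f t - I / 2) ^ 2 = f t ^ 2 - (I * f t - (I / 2) ^ 2) := fun t => by ring
  simp only [h2] at h1
  have h3 : Integrable (fun t => I * f t - (I / 2) ^ 2) (volume.restrict (Icc (-1) 1)) :=
    (hf.const_mul I).sub (integrable_const _)
  rw [integral_sub hf2 h3,
    integral_sub (hf.const_mul I) (integrable_const _), integral_const_mul, ← hI] at h1
  simp at h1
  nlinarith

/-- Integration over one variable maps `L²` to `L²`. -/
lemma memLp_integral_snd {M : ℝ × ℝ → ℝ} (hM : MemLp M 2 (volume.restrict Omega)) :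
    MemLp (fun x => ∫ y in Icc (-1 : ℝ) 1, M (x, y)) 2 (volume.restrict (Icc (-1) 1)) := by
  have h1 := hM.integrable one_le_two
  have h2 := (memLp_two_iff_integrable_sq hM.1).1 hM
  rw [restrict_Omega] at h1 h2
  have h3 := h1.integral_prod_left.aestronglyMeasurable
  refine (memLp_two_iff_integrable_sq h3).2 ((h2.integral_prod_left.const_mul 2).mono'
    (h3.pow 2) ?_)
  filter_upwards [h1.prod_right_ae, h2.prod_right_ae] with x hx1 hx2
  rw [Real.norm_of_nonneg (sq_nonneg _)]
  exact sq_integral_le hx1 hx2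

/-- The trace on the line `y = 0` of a continuous `H²` function has a square integrable weak
derivative. -/
lemma exists_trace_deriv (w wx : H1 Omega) (hwx : wx.val = w.dx)
    (hw : ContinuousOn w.val (closure Omega)) : ∃ d : ℝ → ℝ,
    MemLp d 2 (volume.restrict (Icc (-1) 1)) ∧ ∀ a, IsTest1 (Ioo (-1) 1) a →
      ∫ x in Icc (-1 : ℝ) 1, w.val (x, 0) * deriv a x = -∫ x in Icc (-1 : ℝ) 1, d x * a x := by
  -- The derivative is minus the integral of `∂_y (κ(y) ∂_x w)` over `0 < y < 1`.
  obtain ⟨κ, hκ, hκc, hκ1, -, hκs⟩ := exists_plateau (r := 1 / 4) (by norm_num)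
  have hκT : IsTest1 (Ioo (-1) 1) κ := ⟨hκ, hκc, hκs.trans fun x hx => by
    constructor <;> linarith [hx.1, hx.2]⟩
  have hκ0 : κ 0 = 1 := hκ1 0 (by norm_num)
  have hκ'c : Continuous (deriv κ) := hκT.deriv.1.continuous
  obtain ⟨C, hC⟩ := hκc.exists_bound_of_continuous hκ.continuous
  obtain ⟨C', hC'⟩ := hκT.deriv.2.1.exists_bound_of_continuous hκ'c
  have hm1 : MemLp (fun p => κ p.2 * wx.dy p) 2 (volume.restrict Omega) :=
    MemLp.mul_of_bound wx.memLp_dy (b := fun p => κ p.2) (hκ.continuous.comp continuous_snd)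
      (Eventually.of_forall fun p => hC p.2)
  have hm2 : MemLp (fun p => deriv κ p.2 * wx.val p) 2 (volume.restrict Omega) :=
    MemLp.mul_of_bound wx.memLp_val (b := fun p => deriv κ p.2) (hκ'c.comp continuous_snd)
      (Eventually.of_forall fun p => hC' p.2)
  have hm : MemLp (fun p => κ p.2 * wx.dy p + deriv κ p.2 * wx.val p) 2 (volume.restrict Omega) :=
    hm1.add hm2
  have hS : MeasurableSet {p : ℝ × ℝ | 0 < 1 * p.2} :=
    measurableSet_lt measurable_const (by fun_prop)
  have hM := hm.indicator hS
  set m : ℝ × ℝ → ℝ := fun p => κ p.2 * wx.dy p + deriv κ p.2 * wx.val p with hmdef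
  set M := {p : ℝ × ℝ | 0 < 1 * p.2}.indicator m with hMdef
  refine ⟨fun x => -∫ y in Icc (-1 : ℝ) 1, M (x, y), (memLp_integral_snd hM).neg, fun a ha => ?_⟩
  have hac : Continuous a := ha.1.continuous
  have ha'c : Continuous (deriv a) := ha.deriv.1.continuous
  obtain ⟨Ca, hCa⟩ := ha.2.1.exists_bound_of_continuous hac
  have hma : MemLp (fun p => a p.1 * m p) 2 (volume.restrict Omega) :=
    MemLp.mul_of_bound hm (b := fun p => a p.1) (hac.comp continuous_fst)
      (Eventually.of_forall fun p => hCa p.1)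
  have hMa : MemLp (fun p => a p.1 * M p) 2 (volume.restrict Omega) :=
    MemLp.mul_of_bound hM (b := fun p => a p.1) (hac.comp continuous_fst)
      (Eventually.of_forall fun p => hCa p.1)
  have hH : ContinuousOn (fun p : ℝ × ℝ => κ p.2 * (deriv a p.1 * w.val p)) (closure Omega) :=
    (hκ.continuous.comp continuous_snd).continuousOn.mul
      ((ha'c.comp continuous_fst).continuousOn.mul hw)
  have h1 := (isLayer_zero (Or.inl rfl)).tendsto_snd hH (c := fun _ _ => 1) (c' := fun _ => 1)
    (fun n => continuous_const) (fun n y => by simp)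
    (Eventually.of_forall fun _ => tendsto_const_nhds)
  have h2 := tendsto_integral_cut_mul 1 (hma.integrable one_le_two)
  -- With `b = κ cut n`, two integrations by parts turn `∂_y ∂_x w` tested with `a(x) b(y)` into `w`
  -- tested with `a'(x) b'(y)`.  As `n → ∞`, the derivative of `cut n` concentrates at `y = 0`, and
  -- `κ` removes the boundary term at `y = 1`.
  have key : ∀ n : ℕ, ∫ p in Omega, cut n (1 * p.2) * (a p.1 * m p) =
      ∫ p in Omega, 1 * (deriv (cut n) (1 * (p.2 - 0)) * (κ p.2 * (deriv a p.1 * w.val p))) := by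
    intro n
    have hb : IsTest1 (Ioo (-1) 1) (fun y => κ y * cut n y) := isTest1_mul (cut_contDiff n) hκT
    have hb' : IsTest1 (Ioo (-1) 1) (fun y => deriv κ y * cut n y) :=
      isTest1_mul (cut_contDiff n) hκT.deriv
    have hdb : ∀ y, deriv (fun y => κ y * cut n y) y =
        deriv κ y * cut n y + κ y * deriv (cut n) y := fun y =>
      ((hκT.differentiable y).hasDerivAt.mul (cut_hasDerivAt n y)).deriv
    have e1 := w.weak_dx _ (ha.tensor hb.deriv)
    have e2 := wx.weak_dy _ (ha.tensor hb)
    have e3 := w.weak_dx _ (ha.tensor hb')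
    simp only [pdx_tensor ha.differentiable hb.deriv.differentiable,
      pdy_tensor ha.differentiable hb.differentiable,
      pdx_tensor ha.differentiable hb'.differentiable, hwx] at e1 e2 e3
    have hI : ∀ {f : ℝ × ℝ → ℝ} {a b : ℝ → ℝ}, MemLp f 2 (volume.restrict Omega) → Continuous a →
        Continuous b → Integrable (fun p => f p * (a p.1 * b p.2)) (volume.restrict Omega) :=
      fun hf ha hb => integrable_mul_fun hf (memLp_of_continuous subset_rfl
        ((ha.comp continuous_fst).mul (hb.comp continuous_snd)))
    have e4 : ∫ p in Omega, cut n (1 * p.2) * (a p.1 * m p) =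
        (∫ p in Omega, wx.dy p * (a p.1 * (κ p.2 * cut n p.2))) +
          ∫ p in Omega, w.dx p * (a p.1 * (deriv κ p.2 * cut n p.2)) := by
      rw [← integral_add (hI wx.memLp_dy hac hb.1.continuous) (hI w.memLp_dx hac hb'.1.continuous)]
      refine setIntegral_congr_forall fun p => ?_
      rw [one_mul, hmdef, hwx]
      ring
    have e5 : ∫ p in Omega, 1 * (deriv (cut n) (1 * (p.2 - 0)) *
        (κ p.2 * (deriv a p.1 * w.val p))) =
        (∫ p in Omega, w.val p * (deriv a p.1 * deriv (fun y => κ y * cut n y) p.2)) -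
          ∫ p in Omega, w.val p * (deriv a p.1 * (deriv κ p.2 * cut n p.2)) := by
      rw [← integral_sub (hI w.memLp_val ha'c hb.deriv.1.continuous)
        (hI w.memLp_val ha'c hb'.1.continuous)]
      refine setIntegral_congr_forall fun p => ?_
      rw [one_mul, one_mul, sub_zero, hdb]
      ring
    rw [e4, e5]
    linarith
  have h3 := tendsto_nhds_unique (h2.congr key) h1
  have h4 : ∫ p in Omega, {p : ℝ × ℝ | 0 < 1 * p.2}.indicator (fun p => a p.1 * m p) p =
      ∫ x in Icc (-1 : ℝ) 1, a x * ∫ y in Icc (-1 : ℝ) 1, M (x, y) := by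
    have h5 := hMa.integrable one_le_two
    have h6 : ∀ p : ℝ × ℝ, {p : ℝ × ℝ | 0 < 1 * p.2}.indicator (fun p => a p.1 * m p) p =
        a p.1 * M p := fun p => by
      rw [hMdef]
      by_cases hp : p ∈ {p : ℝ × ℝ | 0 < 1 * p.2}
      · rw [indicator_of_mem hp, indicator_of_mem hp]
      · rw [indicator_of_notMem hp, indicator_of_notMem hp, mul_zero]
    rw [setIntegral_congr_forall h6]
    rw [restrict_Omega] at h5 ⊢
    rw [integral_prod _ h5]
    simp only [integral_const_mul]
  rw [h4] at h3
  simp only [hκ0, one_mul] at h3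
  rw [← integral_neg]
  refine Eq.trans ?_ (h3.symm.trans ?_)
  · exact integral_congr_ae (Eventually.of_forall fun x => mul_comm _ _)
  · exact integral_congr_ae (Eventually.of_forall fun x => by simp only; ring)

lemma IsTest.slice_fst {φ : ℝ × ℝ → ℝ} (hφ : IsTest Omega φ) (y : ℝ) :
    IsTest1 (Ioo (-1) 1) (fun x => φ (x, y)) := by
  have hsub : tsupport (fun x => φ (x, y)) ⊆ Ioo (-1) 1 := by
    have : tsupport (fun x => φ (x, y)) ⊆ (fun x => (x, y)) ⁻¹' tsupport φ :=
      closure_minimal (fun x hx => subset_tsupport φ hx)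
        ((isClosed_tsupport φ).preimage (by fun_prop))
    exact fun x hx => (hφ.2.2 (this hx)).1
  exact ⟨hφ.1.comp (by fun_prop), isCompact_Icc.of_isClosed_subset (isClosed_tsupport _)
    (hsub.trans Ioo_subset_Icc_self), hsub⟩

lemma hasDerivAt_slice_fst {φ : ℝ × ℝ → ℝ} (hφ : Differentiable ℝ φ) (x y : ℝ) :
    HasDerivAt (fun x => φ (x, y)) (pdx φ (x, y)) x :=
  (hφ (x, y)).hasFDerivAt.comp_hasDerivAt x ((hasDerivAt_id x).prodMk (hasDerivAt_const x y))

lemma hasDerivAt_slice_snd {φ : ℝ × ℝ → ℝ} (hφ : Differentiable ℝ φ) (x y : ℝ) :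
    HasDerivAt (fun y => φ (x, y)) (pdy φ (x, y)) y :=
  (hφ (x, y)).hasFDerivAt.comp_hasDerivAt y ((hasDerivAt_const y x).prodMk (hasDerivAt_id y))

/-- The function `(x, y) ↦ (1 - y²) q(x)` belongs to `H¹(Ω)` if `q` belongs to `H¹(-1, 1)`. -/
lemma exists_bubble {q d : ℝ → ℝ} (hq : ContinuousOn q (Icc (-1) 1))
    (hd : MemLp d 2 (volume.restrict (Icc (-1) 1)))
    (hqd : ∀ a, IsTest1 (Ioo (-1) 1) a →
      ∫ x in Icc (-1 : ℝ) 1, q x * deriv a x = -∫ x in Icc (-1 : ℝ) 1, d x * a x) :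
    ∃ P : H1 Omega, P.val = fun p => (1 - p.2 ^ 2) * q p.1 := by
  have hq2 : MemLp q 2 (volume.restrict (Icc (-1) 1)) := by
    obtain ⟨C, hC⟩ := isCompact_Icc.exists_bound_of_continuousOn hq
    refine MemLp.of_bound (hq.aestronglyMeasurable measurableSet_Icc) C ?_
    filter_upwards [ae_restrict_mem measurableSet_Icc] with x hx using hC x hx
  have hfst : ∀ {f : ℝ → ℝ} {b : ℝ → ℝ}, MemLp f 2 (volume.restrict (Icc (-1) 1)) →
      Continuous b → MemLp (fun p : ℝ × ℝ => b p.2 * f p.1) 2 (volume.restrict Omega) := by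
    intro f b hf hb
    obtain ⟨C, hC⟩ := isCompact_Icc.exists_bound_of_continuousOn (s := Icc (-1 : ℝ) 1)
      hb.continuousOn
    refine MemLp.mul_of_bound (f := fun p => f p.1) (b := fun p => b p.2) (C := C) ?_
      (hb.comp continuous_snd) ?_
    · rw [restrict_Omega]
      exact hf.comp_fst _
    · filter_upwards [ae_restrict_mem isOpen_Omega.measurableSet] with p hp
      exact hC p.2 (Ioo_subset_Icc_self hp.2)
  have h0 := hfst hq2 (b := fun y => 1 - y ^ 2) (by fun_prop)
  have h1 := hfst hd (b := fun y => 1 - y ^ 2) (by fun_prop)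
  have h2 := hfst hq2 (b := fun y => -2 * y) (by fun_prop)
  refine ⟨⟨_, _, _, h0, h1, h2, fun φ hφ => ?_, fun φ hφ => ?_⟩, rfl⟩
  · rw [weakX_iff h0 h1 hφ]
    have hint := act_integrable h1 h0 memLp_zero_fun hφ
    rw [restrict_Omega] at hint
    rw [act, restrict_Omega, integral_prod_symm _ hint]
    refine integral_eq_zero_of_ae (Eventually.of_forall fun y => ?_)
    have ha := hφ.slice_fst y
    have e := hqd _ ha
    simp only [(hasDerivAt_slice_fst hφ.differentiable _ _).deriv] at e
    have i1 : Integrable (fun x => q x * pdx φ (x, y)) (volume.restrict (Icc (-1) 1)) :=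
      (hq.mul (hφ.pdx.1.continuous.comp
        (by fun_prop : Continuous fun x : ℝ => (x, y))).continuousOn).integrableOn_compact
          isCompact_Icc
    have i2 : Integrable (fun x => d x * φ (x, y)) (volume.restrict (Icc (-1) 1)) :=
      hd.integrable_mul (q := 2) (ha.1.continuous.memLp_of_hasCompactSupport ha.2.1)
    have : ∀ x : ℝ, (1 - y ^ 2) * d x * φ (x, y) + (1 - y ^ 2) * q x * pdx φ (x, y) +
        0 * pdy φ (x, y) = (1 - y ^ 2) * (q x * pdx φ (x, y) + d x * φ (x, y)) := fun x => by ring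
    simp only [this, Pi.zero_apply]
    rw [integral_const_mul, integral_add i1 i2, e]
    ring
  · rw [weakY_iff h0 h2 hφ]
    have hint := act_integrable h2 memLp_zero_fun h0 hφ
    rw [restrict_Omega] at hint
    rw [act, restrict_Omega, integral_prod _ hint]
    refine integral_eq_zero_of_ae (Eventually.of_forall fun x => ?_)
    have hder : ∀ y : ℝ, HasDerivAt (fun y => (1 - y ^ 2) * φ (x, y))
        (-2 * y * φ (x, y) + (1 - y ^ 2) * pdy φ (x, y)) y := by
      intro y
      have e1 : HasDerivAt (fun y : ℝ => 1 - y ^ 2) (-2 * y) y := by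
        refine ((hasDerivAt_pow 2 y).const_sub 1).congr_deriv ?_
        norm_num
      exact e1.mul (hasDerivAt_slice_snd hφ.differentiable x y)
    have hc : Continuous fun y : ℝ => -2 * y * φ (x, y) + (1 - y ^ 2) * pdy φ (x, y) := by
      have c1 : Continuous fun y : ℝ => φ (x, y) := hφ.1.continuous.comp (by fun_prop)
      have c2 : Continuous fun y : ℝ => pdy φ (x, y) := hφ.pdy.1.continuous.comp (by fun_prop)
      exact ((by fun_prop : Continuous fun y : ℝ => -2 * y).mul c1).add
        ((by fun_prop : Continuous fun y : ℝ => 1 - y ^ 2).mul c2)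
    have e : ∫ y in Icc (-1 : ℝ) 1, (-2 * y * φ (x, y) + (1 - y ^ 2) * pdy φ (x, y)) = 0 := by
      rw [integral_Icc_eq_integral_Ioc, ← intervalIntegral.integral_of_le (by norm_num),
        intervalIntegral.integral_eq_sub_of_hasDerivAt (fun y _ => hder y)
          (hc.intervalIntegrable _ _)]
      norm_num
    have : ∀ y : ℝ, -2 * y * q x * φ (x, y) + 0 * pdx φ (x, y) + (1 - y ^ 2) * q x * pdy φ (x, y) =
        q x * (-2 * y * φ (x, y) + (1 - y ^ 2) * pdy φ (x, y)) := fun y => by ring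
    simp only [this, Pi.zero_apply]
    rw [integral_const_mul, e, mul_zero]

/-- If the boundary values of `G` and the values of `u` on the horizontal interfaces are
compatible, then there is a function in `H¹(Ω)` with these values. -/
lemma exists_lift (G u Gx ux : H1 Omega) (hGx : Gx.val = G.dx) (hux : ux.val = u.dx)
    (hG : ContinuousOn G.val (closure Omega)) (hu : ContinuousOn u.val (closure Omega))
    (hl : u.val (-1, 0) = G.val (-1, 0)) (hr : u.val (1, 0) = G.val (1, 0)) {g : ℝ × ℝ → ℝ}
    (hg : ∀ p ∈ frontier Omega, G.val p = g p) :
    ∃ l : H1 Omega, HasOuterTrace univ l g ∧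
      ∀ i φ, IsTest (patch i (nbY i)) φ → pairY (l.loc i) φ = pairY (u.loc i) φ := by
  set w := H1.comb 1 G (-1) u with hwdef
  have hw : ContinuousOn w.val (closure Omega) :=
    (continuousOn_const.mul hG).add (continuousOn_const.mul hu)
  obtain ⟨d, hd, hqd⟩ := exists_trace_deriv w (H1.comb 1 Gx (-1) ux)
    (by simp [hwdef, H1.comb, hGx, hux]) hw
  have hq : ContinuousOn (fun x => w.val (x, 0)) (Icc (-1) 1) :=
    hw.comp (by fun_prop) fun x hx => by
      rw [closure_Omega]
      exact ⟨hx, by norm_num⟩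
  -- `P = (1 - y²) (G - u)(x, 0)` vanishes on `∂Ω`, at `x = ±1` by the compatibility, and `G - P`
  -- agrees with `u` for `y = 0`.
  obtain ⟨P, hP⟩ := exists_bubble hq hd hqd
  have hPc : ContinuousOn P.val (closure Omega) := by
    rw [hP, closure_Omega]
    refine ContinuousOn.mul (by fun_prop) (hq.comp continuous_fst.continuousOn fun p hp => hp.1)
  have hPf : ∀ p ∈ frontier Omega, P.val p = 0 := by
    rintro ⟨x, y⟩ ⟨h1, h2⟩
    rw [closure_Omega] at h1
    rw [isOpen_Omega.interior_eq] at h2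
    obtain ⟨⟨hx1, hx2⟩, hy1, hy2⟩ := h1
    simp only at hx1 hx2 hy1 hy2
    simp only [hP, hwdef, H1.comb]
    rcases eq_or_lt_of_le hx1 with rfl | hx1
    · rw [hl]; ring
    rcases eq_or_lt_of_le hx2 with rfl | hx2
    · rw [hr]; ring
    rcases eq_or_lt_of_le hy1 with rfl | hy1
    · ring
    rcases eq_or_lt_of_le hy2 with rfl | hy2
    · ring
    exact absurd ⟨⟨hx1, hx2⟩, hy1, hy2⟩ h2
  refine ⟨H1.comb 1 G (-1) P, hasOuterTrace_of_continuousOn _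
    ((continuousOn_const.mul hG).add (continuousOn_const.mul hPc)) fun p hp => ?_, fun i φ hφ => ?_⟩
  · simp [H1.comb, hPf p hp, hg p hp]
  · have h1 := pairY_loc_eq_zero (H1.comb 1 w (-1) P)
      ((continuousOn_const.mul hw).add (continuousOn_const.mul hPc))
      (fun x _ => by simp [H1.comb, hP]) i hφ
    have h2 : pairY ((H1.comb 1 w (-1) P).loc i) φ = 1 * pairY (w.loc i) φ +
        -1 * pairY (P.loc i) φ := pairY_comb hφ 1 (w.loc i) (-1) (P.loc i)
    have h3 : pairY (w.loc i) φ = 1 * pairY (G.loc i) φ + -1 * pairY (u.loc i) φ :=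
      pairY_comb hφ 1 (G.loc i) (-1) (u.loc i)
    have h4 : pairY ((H1.comb 1 G (-1) P).loc i) φ = 1 * pairY (G.loc i) φ +
        -1 * pairY (P.loc i) φ := pairY_comb hφ 1 (G.loc i) (-1) (P.loc i)
    linarith

/-! ### Odd functions -/

lemma flip_neg_neg (p : ℝ × ℝ) : flip (-1) (-1) p = -p := by
  ext <;> simp [flip]

/-- The odd symmetric part of a Sobolev function. -/
def H1.odd (w : H1 Omega) : H1 Omega := H1.comb (1 / 2) w (-1 / 2) (w.pull isFlip_Omega)

lemma H1.odd_val (w : H1 Omega) : w.odd.val = oddPart w.val := by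
  funext p
  simp only [H1.odd, H1.comb, H1.pull, oddPart, flip_neg_neg]
  ring

lemma MemH2.odd {w : H1 Omega} (hw : MemH2 w) : MemH2 w.odd := by
  obtain ⟨wx, wy, hx, hy⟩ := hw
  refine ⟨H1.comb (1 / 2) wx (1 / 2) (wx.pull isFlip_Omega),
    H1.comb (1 / 2) wy (1 / 2) (wy.pull isFlip_Omega), ?_, ?_⟩
  · funext p
    simp only [H1.odd, H1.comb, H1.pull, hx]
    ring
  · funext p
    simp only [H1.odd, H1.comb, H1.pull, hy]
    ring

lemma oddPart_neg (h : ℝ × ℝ → ℝ) (p : ℝ × ℝ) : oddPart h (-p) = -oddPart h p := by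
  simp only [oddPart, neg_neg]
  ring

lemma neg_mem_closure_Omega {p : ℝ × ℝ} (hp : p ∈ closure Omega) : -p ∈ closure Omega := by
  rw [closure_Omega] at hp ⊢
  obtain ⟨⟨h1, h2⟩, h3, h4⟩ := hp
  exact ⟨⟨by simpa using neg_le_neg h2, by simpa using neg_le_neg h1⟩,
    by simpa using neg_le_neg h4, by simpa using neg_le_neg h3⟩

lemma neg_mem_frontier_Omega {p : ℝ × ℝ} (hp : p ∈ frontier Omega) : -p ∈ frontier Omega := by
  refine ⟨neg_mem_closure_Omega hp.1, fun h => hp.2 ?_⟩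
  rw [isOpen_Omega.interior_eq] at h ⊢
  exact (isFlip_Omega.mem_iff p).1 (by rwa [flip_neg_neg])

lemma continuousOn_oddPart {h : ℝ × ℝ → ℝ} (hh : ContinuousOn h (closure Omega)) :
    ContinuousOn (oddPart h) (closure Omega) :=
  (hh.sub (hh.comp continuous_neg.continuousOn fun _ hp => neg_mem_closure_Omega hp)).div_const 2

lemma memLp_oddPart {f : ℝ × ℝ → ℝ} (hf : MemLp f 2 (volume.restrict Omega)) :
    MemLp (oddPart f) 2 (volume.restrict Omega) := by
  have h := MemLp.comb hf (isFlip_Omega.memLp hf) (1 / 2) (-1 / 2)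
  convert h using 1
  funext p
  simp only [oddPart, flip_neg_neg]
  ring

lemma boundaryX_oddPart (g φ : ℝ × ℝ → ℝ) :
    boundaryX (oddPart g) (fun p => φ (flip (-1) (-1) p)) = boundaryX (oddPart g) φ := by
  have h : ∀ a y : ℝ, oddPart g (a, y) = -oddPart g (-a, -y) := fun a y => by
    rw [← oddPart_neg, Prod.neg_mk, neg_neg, neg_neg]
  have := intervalIntegral.integral_comp_neg (a := -1) (b := 1) fun y =>
    oddPart g (1, y) * φ (1, y) - oddPart g (-1, y) * φ (-1, y)
  rw [neg_neg] at this
  rw [boundaryX, boundaryX, ← this]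
  refine intervalIntegral.integral_congr fun y _ => ?_
  simp only [flip_neg_neg, Prod.neg_mk, neg_neg]
  rw [h 1 y, h (-1) y, neg_neg]
  ring

lemma boundaryY_oddPart (g φ : ℝ × ℝ → ℝ) :
    boundaryY (oddPart g) (fun p => φ (flip (-1) (-1) p)) = boundaryY (oddPart g) φ := by
  have h : ∀ x a : ℝ, oddPart g (x, a) = -oddPart g (-x, -a) := fun x a => by
    rw [← oddPart_neg, Prod.neg_mk, neg_neg, neg_neg]
  have := intervalIntegral.integral_comp_neg (a := -1) (b := 1) fun x =>
    oddPart g (x, 1) * φ (x, 1) - oddPart g (x, -1) * φ (x, -1)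
  rw [neg_neg] at this
  rw [boundaryY, boundaryY, ← this]
  refine intervalIntegral.integral_congr fun x _ => ?_
  simp only [flip_neg_neg, Prod.neg_mk, neg_neg]
  rw [h x 1, h x (-1), neg_neg]
  ring

/-- The solution of the Dirichlet problem with odd data is odd. -/
lemma SolvesDirichlet.odd {f g : ℝ × ℝ → ℝ} {u : HDelta Omega}
    (hu : SolvesDirichlet (oddPart f) (oddPart g) u) :
    ∀ᵐ p ∂volume.restrict Omega, u.val (flip (-1) (-1) p) = -u.val p := by
  have h := ae_eq_zero_of_dirichlet (HDelta.comb 1 u 1 (u.pull isFlip_Omega)) ?_ ?_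
  · filter_upwards [h] with p hp
    simp only [HDelta.comb, HDelta.pull, H1.comb, H1.pull, Pi.zero_apply] at hp
    linarith
  · filter_upwards [hu.1, isFlip_Omega.ae hu.1] with p h1 h2
    simp only [HDelta.comb, HDelta.pull]
    rw [flip_neg_neg, oddPart_neg] at h2
    rw [flip_neg_neg]
    linarith
  · have h1 := hasOuterTrace_iff.1 hu.2
    rw [hasOuterTrace_zero_iff]
    intro φ hφ
    have e1 : pairX (HDelta.comb 1 u 1 (u.pull isFlip_Omega)).toH1 φ = 1 * pairX u.toH1 φ +
        1 * pairX (u.toH1.pull isFlip_Omega) φ := pairX_comb hφ _ _ _ _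
    have e2 : pairY (HDelta.comb 1 u 1 (u.pull isFlip_Omega)).toH1 φ = 1 * pairY u.toH1 φ +
        1 * pairY (u.toH1.pull isFlip_Omega) φ := pairY_comb hφ _ _ _ _
    have h2 := h1 _ (isFlip_univ.symm.isTest hφ)
    rw [pairX_pull hφ, (h1 φ hφ).1, h2.1, boundaryX_oddPart] at e1
    rw [pairY_pull hφ, (h1 φ hφ).2, h2.2, boundaryY_oddPart] at e2
    rw [e1, e2]
    constructor <;> ring

/-! ### The local problems -/

section Steps
variable {f g : ℝ × ℝ → ℝ} {θ : ℝ} {u psi : ∀ i : Fin 4, HDelta (sub i)}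

lemma lap_comb_ae_zero {U : Set (ℝ × ℝ)} {f : ℝ × ℝ → ℝ} {w v : HDelta U}
    (hw : ∀ᵐ p ∂volume.restrict U, -w.lap p = f p) (hv : ∀ᵐ p ∂volume.restrict U, -v.lap p = f p) :
    ∀ᵐ p ∂volume.restrict U, (HDelta.comb 1 w (-1) v).lap p = 0 := by
  filter_upwards [hw, hv] with p h1 h2
  simp only [HDelta.comb]
  linarith

lemma ae_eq_of_comb {U : Set (ℝ × ℝ)} {w v : H1 U} {c : ℝ}
    (h : (H1.comb 1 w (-c) v).val =ᵐ[volume.restrict U] 0) :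
    ∀ᵐ p ∂volume.restrict U, w.val p = c * v.val p := by
  filter_upwards [h] with p hp
  simp only [H1.comb, Pi.zero_apply] at hp
  linarith

lemma FirstStep.unique {i : Fin 4} {w v : HDelta (sub i)} (hw : FirstStep f g θ u psi i w)
    (hv : FirstStep f g θ u psi i v) : w.val =ᵐ[volume.restrict (sub i)] v.val := by
  rw [firstStep_iff] at hw hv
  have h := ae_eq_zero_of_mixedY i (HDelta.comb 1 w (-1) v) (lap_comb_ae_zero hw.1 hv.1)
    (hw.2.1.diff hv.2.1)
    (fun φ hφ => by
      refine (pairY_comb hφ 1 w.toH1 (-1) v.toH1).trans ?_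
      rw [hw.2.2.1 φ hφ, hv.2.2.1 φ hφ]
      ring)
    (fun φ hφ => by
      rw [normalPairing_comb hφ, hw.2.2.2 φ hφ, hv.2.2.2 φ hφ]
      ring)
  filter_upwards [ae_eq_of_comb h] with p hp
  rw [hp, one_mul]

lemma SecondStep.unique {i : Fin 4} {w v : HDelta (sub i)} (hw : SecondStep u i w)
    (hv : SecondStep u i v) : w.val =ᵐ[volume.restrict (sub i)] v.val := by
  rw [secondStep_iff] at hw hv
  have h := ae_eq_zero_of_mixedX i (HDelta.comb 1 w (-1) v)
    (lap_comb_ae_zero (f := fun _ => 0) hw.1 hv.1) (hw.2.1.diff hv.2.1)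
    (fun φ hφ => by
      refine (pairX_comb hφ 1 w.toH1 (-1) v.toH1).trans ?_
      rw [hw.2.2.1 φ hφ, hv.2.2.1 φ hφ]
      ring)
    (fun φ hφ => by
      rw [normalPairing_comb hφ, hw.2.2.2 φ hφ, hv.2.2.2 φ hφ]
      ring)
  filter_upwards [ae_eq_of_comb h] with p hp
  rw [hp, one_mul]

lemma HasOuterTrace.reflX {i : Fin 4} {w : HDelta (sub (nbX i))}
    (hw : HasOuterTrace (quadrant (nbX i)) w.toH1 0) :
    HasOuterTrace (quadrant i) (reflX i w).toH1 0 :=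
  hw.pull (isFlip_nbX i) (isFlip_quadrant_nbX i)

lemma HasOuterTrace.reflY {i : Fin 4} {w : HDelta (sub (nbY i))}
    (hw : HasOuterTrace (quadrant (nbY i)) w.toH1 0) :
    HasOuterTrace (quadrant i) (reflY i w).toH1 0 :=
  hw.pull (isFlip_nbY i) (isFlip_quadrant_nbY i)

/-- The first step is solvable if the Dirichlet data on the horizontal interface are the trace of
a function `l` with the correct outer trace. -/
lemma exists_firstStep (hf : MemLp f 2 (volume.restrict Omega)) {i : Fin 4} {l : H1 (sub i)}
    (hl : HasOuterTrace (quadrant i) l g)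
    (hlu : ∀ φ, IsTest (patch i (nbY i)) φ → pairY l φ = pairY (u i).toH1 φ)
    (hpsi : ∀ j, HasOuterTrace (quadrant j) (psi j).toH1 0) :
    ∃ w, FirstStep f g θ u psi i w := by
  obtain ⟨w, h1, h2, h3, h4⟩ := exists_mixedY i
    (hf.mono_measure (Measure.restrict_mono_set _ (sub_subset i)))
    (H1.comb 1 l (-θ) (H1.comb 1 (psi i).toH1 1 (reflY i (psi (nbY i))).toH1))
    (hl.add_zero ((hpsi i).comb_zero (hpsi (nbY i)).reflY 1 1) (-θ))
    (HDelta.comb 1 (u i) (-θ) (HDelta.comb 1 (psi i) (-1) (reflX i (psi (nbX i)))))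
  refine ⟨w, firstStep_iff.2 ⟨h1, h2, fun φ hφ => ?_, fun φ hφ => ?_⟩⟩
  · rw [h3 φ hφ, pairY_comb hφ, pairY_comb hφ, hlu φ hφ, pairY_reflY i _ hφ]
    ring
  · rw [h4 φ hφ, normalPairing_comb hφ, normalPairing_comb hφ, normalPairing_reflX i _ hφ]
    ring

/-- The error of a piecewise approximation. -/
def err (uo : HDelta Omega) (u : ∀ i : Fin 4, HDelta (sub i)) (i : Fin 4) : HDelta (sub i) :=
  HDelta.comb 1 (uo.loc i) (-1) (u i)

lemma pairX_err (uo : HDelta Omega) (u : ∀ i : Fin 4, HDelta (sub i)) (i : Fin 4)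
    {P : Set (ℝ × ℝ)} {φ : ℝ × ℝ → ℝ} (hφ : IsTest P φ) :
    pairX (err uo u i).toH1 φ = pairX (uo.toH1.loc i) φ - pairX (u i).toH1 φ :=
  (pairX_comb hφ 1 (uo.toH1.loc i) (-1) (u i).toH1).trans (by ring)

lemma pairY_err (uo : HDelta Omega) (u : ∀ i : Fin 4, HDelta (sub i)) (i : Fin 4)
    {P : Set (ℝ × ℝ)} {φ : ℝ × ℝ → ℝ} (hφ : IsTest P φ) :
    pairY (err uo u i).toH1 φ = pairY (uo.toH1.loc i) φ - pairY (u i).toH1 φ :=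
  (pairY_comb hφ 1 (uo.toH1.loc i) (-1) (u i).toH1).trans (by ring)

lemma normalPairing_err (uo : HDelta Omega) (u : ∀ i : Fin 4, HDelta (sub i)) (i : Fin 4)
    {P : Set (ℝ × ℝ)} {φ : ℝ × ℝ → ℝ} (hφ : IsTest P φ) :
    normalPairing (err uo u i) φ = normalPairing (uo.loc i) φ - normalPairing (u i) φ :=
  (normalPairing_comb hφ 1 (uo.loc i) (-1) (u i)).trans (by ring)

lemma SolvesDirichlet.outerTrace_err {uo : HDelta Omega} (huo : SolvesDirichlet f g uo) {i : Fin 4}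
    (hu : HasOuterTrace (quadrant i) (u i).toH1 g) :
    HasOuterTrace (quadrant i) (err uo u i).toH1 0 :=
  (huo.2.loc i).diff hu

lemma SolvesDirichlet.lap_err {uo : HDelta Omega} (huo : SolvesDirichlet f g uo) {i : Fin 4}
    (hu : ∀ᵐ p ∂volume.restrict (sub i), -(u i).lap p = f p) :
    ∀ᵐ p ∂volume.restrict (sub i), (err uo u i).lap p = 0 :=
  lap_comb_ae_zero (w := uo.loc i) (ae_mono (Measure.restrict_mono_set _ (sub_subset i)) huo.1) hu

/-- The second step is always solvable: the jump of `u` on the vertical interface is a jump of the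
error, which vanishes on the outer boundary. -/
lemma exists_secondStep {uo : HDelta Omega} (huo : SolvesDirichlet f g uo)
    (hu : ∀ j, HasOuterTrace (quadrant j) (u j).toH1 g) (i : Fin 4) :
    ∃ w, SecondStep u i w := by
  obtain ⟨w, h1, h2, h3, h4⟩ := exists_mixedX i (f := fun _ => 0) MemLp.zero'
    (H1.comb 1 (reflX i (err uo u (nbX i))).toH1 (-1) (err uo u i).toH1)
    ((huo.outerTrace_err (hu (nbX i))).reflX.comb_zero (huo.outerTrace_err (hu i)) 1 (-1))
    (HDelta.comb 1 (u i) 1 (reflY i (u (nbY i))))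
  refine ⟨w, secondStep_iff.2 ⟨h1, h2, fun φ hφ => ?_, fun φ hφ => ?_⟩⟩
  · rw [h3 φ hφ, pairX_comb hφ, pairX_reflX i _ hφ, pairX_err _ _ _ hφ, pairX_err _ _ _ hφ]
    linear_combination -pairX_loc_add uo.toH1 i hφ
  · rw [h4 φ hφ, normalPairing_comb hφ, normalPairing_reflY i _ hφ]
    ring

/-- The method can be continued from states which admit a lifting `l` of the Dirichlet data, and it
stays in such states. -/
lemma exists_isMixedNNM (hf : MemLp f 2 (volume.restrict Omega)) {uo : HDelta Omega}
    (huo : SolvesDirichlet f g uo) (θ : ℝ)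
    (hu : ∀ i, ∃ l : H1 (sub i), HasOuterTrace (quadrant i) l g ∧
      ∀ φ, IsTest (patch i (nbY i)) φ → pairY l φ = pairY (u i).toH1 φ)
    (hpsi : ∀ i, HasOuterTrace (quadrant i) (psi i).toH1 0) :
    ∃ U Psi : ℕ → ∀ i : Fin 4, HDelta (sub i), U 0 = u ∧ Psi 0 = psi ∧
      ∀ k i, FirstStep f g θ (U k) (Psi k) i (U (k + 1) i) ∧
        SecondStep (U (k + 1)) i (Psi (k + 1) i) := by
  let Good : (∀ i : Fin 4, HDelta (sub i)) × (∀ i : Fin 4, HDelta (sub i)) → Prop := fun s =>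
    (∀ i, ∃ l : H1 (sub i), HasOuterTrace (quadrant i) l g ∧
      ∀ φ, IsTest (patch i (nbY i)) φ → pairY l φ = pairY (s.1 i).toH1 φ) ∧
    ∀ i, HasOuterTrace (quadrant i) (s.2 i).toH1 0
  have step : ∀ s : {s // Good s}, ∃ t : {s // Good s}, ∀ i,
      FirstStep f g θ s.1.1 s.1.2 i (t.1.1 i) ∧ SecondStep t.1.1 i (t.1.2 i) := by
    rintro ⟨s, h1, h2⟩
    have hex : ∀ i, ∃ w, FirstStep f g θ s.1 s.2 i w := fun i => by
      obtain ⟨l, hl, hlu⟩ := h1 i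
      exact exists_firstStep hf hl hlu h2
    choose v hv using hex
    have hvo : ∀ j, HasOuterTrace (quadrant j) (v j).toH1 g := fun j => (hv j).2.1
    choose q hq using exists_secondStep huo hvo
    exact ⟨⟨(v, q), fun i => ⟨(v i).toH1, hvo i, fun _ _ => rfl⟩, fun i => (hq i).2.1⟩,
      fun i => ⟨hv i, hq i⟩⟩
  choose next hnext using step
  let S : ℕ → {s // Good s} := fun n => Nat.rec ⟨(u, psi), hu, hpsi⟩ (fun _ s => next s) n
  exact ⟨fun k => (S k).1.1, fun k => (S k).1.2, rfl, rfl, fun k i => hnext (S k) i⟩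

/-! ### Symmetries of the error -/

/-- The piecewise functions which are odd with respect to the vertical and even with respect to
the horizontal interfaces. -/
def IsOddEven (e : ∀ i : Fin 4, HDelta (sub i)) : Prop :=
  ∀ i, (∀ᵐ p ∂volume.restrict (sub i), (e i).val p = -1 * (reflX i (e (nbX i))).val p) ∧
    ∀ᵐ p ∂volume.restrict (sub i), (e i).val p = 1 * (reflY i (e (nbY i))).val p

end Steps

section Congr
variable {i : Fin 4} {w v : HDelta (sub i)} {c : ℝ} {P : Set (ℝ × ℝ)} {φ : ℝ × ℝ → ℝ}

lemma ae_eq_comb_zero (h : ∀ᵐ p ∂volume.restrict (sub i), w.val p = c * v.val p) :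
    w.val =ᵐ[volume.restrict (sub i)] (HDelta.comb c v 0 v).val := by
  filter_upwards [h] with p hp
  simp [HDelta.comb, H1.comb, hp]

lemma pairX_of_ae_eq (h : ∀ᵐ p ∂volume.restrict (sub i), w.val p = c * v.val p)
    (hφ : IsTest P φ) : pairX w.toH1 φ = c * pairX v.toH1 φ := by
  rw [pairX_congr (isOpen_sub i) (ae_eq_comb_zero h)]
  exact (pairX_comb hφ c v.toH1 0 v.toH1).trans (by ring)

lemma pairY_of_ae_eq (h : ∀ᵐ p ∂volume.restrict (sub i), w.val p = c * v.val p)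
    (hφ : IsTest P φ) : pairY w.toH1 φ = c * pairY v.toH1 φ := by
  rw [pairY_congr (isOpen_sub i) (ae_eq_comb_zero h)]
  exact (pairY_comb hφ c v.toH1 0 v.toH1).trans (by ring)

lemma normalPairing_of_ae_eq (h : ∀ᵐ p ∂volume.restrict (sub i), w.val p = c * v.val p)
    (hφ : IsTest P φ) : normalPairing w φ = c * normalPairing v φ := by
  rw [normalPairing_congr (isOpen_sub i) (ae_eq_comb_zero h), normalPairing_comb hφ]
  ring

end Congr

section Symmetry
variable {e : ∀ i : Fin 4, HDelta (sub i)} {i : Fin 4} {φ : ℝ × ℝ → ℝ}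

lemma IsOddEven.pairX (he : IsOddEven e) (hφ : IsTest (patch i (nbX i)) φ) :
    pairX (e (nbX i)).toH1 φ = MixedNNM.pairX (e i).toH1 φ := by
  rw [pairX_of_ae_eq (he i).1 hφ, pairX_reflX i _ hφ]
  ring

lemma IsOddEven.pairY (he : IsOddEven e) (hφ : IsTest (patch i (nbY i)) φ) :
    pairY (e (nbY i)).toH1 φ = -MixedNNM.pairY (e i).toH1 φ := by
  rw [pairY_of_ae_eq (he i).2 hφ, pairY_reflY i _ hφ]
  ring

lemma IsOddEven.normalPairingX (he : IsOddEven e) (hφ : IsTest (patch i (nbX i)) φ) :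
    normalPairing (e (nbX i)) φ = -normalPairing (e i) φ := by
  rw [normalPairing_of_ae_eq (he i).1 hφ, normalPairing_reflX i _ hφ]
  ring

lemma IsOddEven.normalPairingY (he : IsOddEven e) (hφ : IsTest (patch i (nbY i)) φ) :
    normalPairing (e (nbY i)) φ = normalPairing (e i) φ := by
  rw [normalPairing_of_ae_eq (he i).2 hφ, normalPairing_reflY i _ hφ]
  ring

lemma IsOddEven.of_ae_eq (he : IsOddEven e) {e' : ∀ i : Fin 4, HDelta (sub i)} {c : ℝ}
    (h : ∀ i, ∀ᵐ p ∂volume.restrict (sub i), (e' i).val p = c * (e i).val p) : IsOddEven e' := by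
  intro i
  constructor
  · filter_upwards [(he i).1, h i, (isFlip_nbX i).ae (h (nbX i))] with p h1 h2 h3
    simp only [reflX, HDelta.pull, H1.pull] at h1 ⊢
    rw [h2, h3, h1]
    ring
  · filter_upwards [(he i).2, h i, (isFlip_nbY i).ae (h (nbY i))] with p h1 h2 h3
    simp only [reflY, HDelta.pull, H1.pull] at h1 ⊢
    rw [h2, h3, h1]
    ring

/-- For an odd function, the reflections across the two interfaces differ by the sign. -/
lemma reflX_eq_neg_reflY {D : HDelta Omega}
    (hD : ∀ᵐ p ∂volume.restrict Omega, D.val (flip (-1) (-1) p) = -D.val p) (i : Fin 4) :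
    ∀ᵐ p ∂volume.restrict (sub i), (reflX i (D.loc (nbX i))).val p =
      -1 * (reflY i (D.loc (nbY i))).val p := by
  have h := (isFlip_nbY i).ae (ae_mono (Measure.restrict_mono_set _ (sub_subset (nbY i))) hD)
  filter_upwards [h] with p hp
  have e1 : flip (-1) (-1) (flip 1 (-1) p) = flip (-1) 1 p := by ext <;> simp [flip]
  rw [e1] at hp
  simp only [reflX, reflY, HDelta.pull, H1.pull, HDelta.loc, HDelta.res, H1.res]
  rw [hp]
  ring

/-- Harmonic functions on the subdomains with the Dirichlet data on the horizontal and the Neumann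
data on the vertical interfaces of an odd function are odd with respect to the vertical and even
with respect to the horizontal interfaces. -/
lemma isOddEven_of_odd {D : HDelta Omega}
    (hD : ∀ᵐ p ∂volume.restrict Omega, D.val (flip (-1) (-1) p) = -D.val p)
    (hlap : ∀ i, ∀ᵐ p ∂volume.restrict (sub i), (e i).lap p = 0)
    (hO : ∀ i, HasOuterTrace (quadrant i) (e i).toH1 0)
    (heD : ∀ i φ, IsTest (patch i (nbY i)) φ → pairY (e i).toH1 φ = pairY (D.loc i).toH1 φ)
    (heN : ∀ i φ, IsTest (patch i (nbX i)) φ → normalPairing (e i) φ = normalPairing (D.loc i) φ) :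
    IsOddEven e := by
  have hYflip : ∀ (i : Fin 4) {φ : ℝ × ℝ → ℝ}, IsTest (patch i (nbY i)) φ →
      pairY (reflX i (e (nbX i))).toH1 φ = pairY (reflX i (D.loc (nbX i))).toH1 φ := by
    intro i φ hφ
    have hfl : IsTest (patch (nbX i) (nbY (nbX i))) (fun p => φ (flip (-1) 1 p)) := by
      have hF : IsFlip (-1) 1 (patch (nbX i) (nbY (nbX i))) (patch i (nbY i)) :=
        ⟨Or.inr rfl, Or.inl rfl, fun p => by
          rw [patch_nbY, patch_nbY, sx_nbX]
          simp [flip, mem_half]⟩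
      exact hF.isTest hφ
    refine (pairY_pull hφ (isFlip_nbX i) (e (nbX i)).toH1).trans
      (Eq.trans ?_ (pairY_pull hφ (isFlip_nbX i) (D.loc (nbX i)).toH1).symm)
    rw [heD _ _ hfl]
  have hNflip : ∀ (i : Fin 4) {φ : ℝ × ℝ → ℝ}, IsTest (patch i (nbX i)) φ →
      normalPairing (reflY i (e (nbY i))) φ = normalPairing (reflY i (D.loc (nbY i))) φ := by
    intro i φ hφ
    have hfl : IsTest (patch (nbY i) (nbX (nbY i))) (fun p => φ (flip 1 (-1) p)) := by
      have hF : IsFlip 1 (-1) (patch (nbY i) (nbX (nbY i))) (patch i (nbX i)) :=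
        ⟨Or.inl rfl, Or.inr rfl, fun p => by
          rw [patch_nbX, patch_nbX, sy_nbY]
          simp [flip, mem_half]⟩
      exact hF.isTest hφ
    refine (normalPairing_pull hφ (isFlip_nbY i) (e (nbY i))).trans
      (Eq.trans ?_ (normalPairing_pull hφ (isFlip_nbY i) (D.loc (nbY i))).symm)
    rw [heN _ _ hfl]
  -- By uniqueness for the mixed problem, it suffices to compare the data of `e i` with those of the
  -- reflected neighbours.
  intro i
  have hsymm := reflX_eq_neg_reflY hD i
  constructor
  · refine ae_eq_of_comb (w := (e i).toH1) (v := (reflX i (e (nbX i))).toH1) ?_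
    refine ae_eq_zero_of_mixedY i (HDelta.comb 1 (e i) (- -1) (reflX i (e (nbX i)))) ?_
      ((hO i).comb_zero (hO (nbX i)).reflX 1 (- -1)) (fun φ hφ => ?_) fun φ hφ => ?_
    · filter_upwards [hlap i, (isFlip_nbX i).ae (hlap (nbX i))] with p h1 h2
      simp [HDelta.comb, reflX, HDelta.pull, h1, h2]
    · refine (pairY_comb hφ 1 (e i).toH1 (- -1) (reflX i (e (nbX i))).toH1).trans ?_
      rw [hYflip i hφ, pairY_of_ae_eq hsymm hφ, pairY_reflY i _ hφ, heD i φ hφ]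
      have hadd : pairY (D.loc i).toH1 φ + pairY (D.loc (nbY i)).toH1 φ = 0 :=
        pairY_loc_add D.toH1 i hφ
      linear_combination hadd
    · have hφ' : IsTest (patch (nbX i) (nbX (nbX i))) φ := by rwa [patch_nbX_symm]
      rw [normalPairing_comb hφ, normalPairing_reflX i _ hφ, heN i φ hφ, heN _ φ hφ']
      linear_combination normalPairing_loc_addX D i hφ
  · refine ae_eq_of_comb (w := (e i).toH1) (v := (reflY i (e (nbY i))).toH1) ?_
    refine ae_eq_zero_of_mixedY i (HDelta.comb 1 (e i) (-1) (reflY i (e (nbY i)))) ?_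
      ((hO i).comb_zero (hO (nbY i)).reflY 1 (-1)) (fun φ hφ => ?_) fun φ hφ => ?_
    · filter_upwards [hlap i, (isFlip_nbY i).ae (hlap (nbY i))] with p h1 h2
      simp [HDelta.comb, reflY, HDelta.pull, h1, h2]
    · refine (pairY_comb hφ 1 (e i).toH1 (-1) (reflY i (e (nbY i))).toH1).trans ?_
      have hφ' : IsTest (patch (nbY i) (nbY (nbY i))) φ := by rwa [patch_nbY_symm]
      rw [pairY_reflY i _ hφ, heD i φ hφ, heD _ φ hφ']
      have hadd : pairY (D.loc i).toH1 φ + pairY (D.loc (nbY i)).toH1 φ = 0 :=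
        pairY_loc_add D.toH1 i hφ
      linear_combination hadd
    · have h1 := normalPairing_of_ae_eq hsymm hφ
      rw [normalPairing_reflX i _ hφ] at h1
      rw [normalPairing_comb hφ, hNflip i hφ, heN i φ hφ]
      linear_combination normalPairing_loc_addX D i hφ - h1
end Symmetry

/-! ### Propagation of the error -/

section Propagation
variable {f g : ℝ × ℝ → ℝ} {θ : ℝ} {u psi : ∀ i : Fin 4, HDelta (sub i)} {uo : HDelta Omega}

/-- For an error with the symmetries, the correction is a multiple of the error. -/
lemma SecondStep.eq_err (huo : SolvesDirichlet f g uo)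
    (hlap : ∀ i, ∀ᵐ p ∂volume.restrict (sub i), -(u i).lap p = f p)
    (hu : ∀ i, HasOuterTrace (quadrant i) (u i).toH1 g) (he : IsOddEven (err uo u)) {i : Fin 4}
    {w : HDelta (sub i)} (hw : SecondStep u i w) :
    ∀ᵐ p ∂volume.restrict (sub i), w.val p = -2 * (err uo u i).val p := by
  obtain ⟨h1, h2, h3, h4⟩ := secondStep_iff.1 hw
  refine ae_eq_of_comb (w := w.toH1) (v := (err uo u i).toH1) ?_
  refine ae_eq_zero_of_mixedX i (HDelta.comb 1 w (- -2) (err uo u i)) ?_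
    (h2.comb_zero (huo.outerTrace_err (hu i)) 1 (- -2)) (fun φ hφ => ?_) fun φ hφ => ?_
  · filter_upwards [h1, huo.lap_err (hlap i)] with p e1 e2
    simp only [HDelta.comb, e2]
    linarith
  · refine (pairX_comb hφ 1 w.toH1 (- -2) (err uo u i).toH1).trans ?_
    have e1 := he.pairX hφ
    rw [pairX_err uo u i hφ, pairX_err uo u _ hφ] at e1
    rw [h3 φ hφ, pairX_err uo u i hφ]
    linear_combination pairX_loc_add uo.toH1 i hφ - e1
  · have e1 := he.normalPairingY hφ
    rw [normalPairing_err uo u i hφ, normalPairing_err uo u _ hφ] at e1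
    rw [normalPairing_comb hφ, h4 φ hφ, normalPairing_err uo u i hφ]
    linear_combination normalPairing_loc_addY uo i hφ - e1

/-- If the correction is `-2` times the error and the error has the symmetries, then the first step
multiplies the error by `1 - 4θ`. -/
lemma FirstStep.err_eq (huo : SolvesDirichlet f g uo)
    (hlap : ∀ i, ∀ᵐ p ∂volume.restrict (sub i), -(u i).lap p = f p)
    (hu : ∀ i, HasOuterTrace (quadrant i) (u i).toH1 g) (he : IsOddEven (err uo u))
    (hpsi : ∀ i, ∀ᵐ p ∂volume.restrict (sub i), (psi i).val p = -2 * (err uo u i).val p)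
    {v : ∀ i : Fin 4, HDelta (sub i)} {i : Fin 4} (hv : FirstStep f g θ u psi i (v i)) :
    ∀ᵐ p ∂volume.restrict (sub i), (err uo v i).val p = (1 - 4 * θ) * (err uo u i).val p := by
  obtain ⟨h1, h2, h3, h4⟩ := firstStep_iff.1 hv
  refine ae_eq_of_comb (w := (err uo v i).toH1) (v := (err uo u i).toH1) ?_
  refine ae_eq_zero_of_mixedY i (HDelta.comb 1 (err uo v i) (-(1 - 4 * θ)) (err uo u i)) ?_
    ((huo.outerTrace_err h2).comb_zero (huo.outerTrace_err (hu i)) 1 (-(1 - 4 * θ)))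
    (fun φ hφ => ?_) fun φ hφ => ?_
  · filter_upwards [huo.lap_err h1, huo.lap_err (hlap i)] with p e1 e2
    simp [HDelta.comb, e1, e2]
  · refine (pairY_comb hφ 1 (err uo v i).toH1 (-(1 - 4 * θ)) (err uo u i).toH1).trans ?_
    rw [pairY_err uo v i hφ, h3 φ hφ, pairY_of_ae_eq (hpsi i) hφ, pairY_of_ae_eq (hpsi _) hφ,
      he.pairY hφ, pairY_err uo u i hφ]
    ring
  · rw [normalPairing_comb hφ, normalPairing_err uo v i hφ, h4 φ hφ,
      normalPairing_of_ae_eq (hpsi i) hφ, normalPairing_of_ae_eq (hpsi _) hφ,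
      he.normalPairingX hφ, normalPairing_err uo u i hφ]
    ring

/-- Whatever the initial functions are, the error of the first iterate is odd with respect to the
vertical and even with respect to the horizontal interfaces, if all data are odd. -/
lemma isOddEven_err (huo : SolvesDirichlet f g uo) {V S : HDelta Omega}
    (huo' : ∀ᵐ p ∂volume.restrict Omega, uo.val (flip (-1) (-1) p) = -uo.val p)
    (hV : ∀ p, V.val (flip (-1) (-1) p) = -V.val p)
    (hS : ∀ p, S.val (flip (-1) (-1) p) = -S.val p)
    (hu : ∀ i, (u i).val =ᵐ[volume.restrict (sub i)] V.val)
    (hpsi : ∀ i, (psi i).val =ᵐ[volume.restrict (sub i)] S.val)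
    {v : ∀ i : Fin 4, HDelta (sub i)} (hv : ∀ i, FirstStep f g θ u psi i (v i)) :
    IsOddEven (err uo v) := by
  have hv' := fun i => firstStep_iff.1 (hv i)
  have hu' : ∀ i, (u i).val =ᵐ[volume.restrict (sub i)] (V.loc i).val := hu
  have hpsi' : ∀ i, (psi i).val =ᵐ[volume.restrict (sub i)] (S.loc i).val := hpsi
  -- On the interfaces where they enter, the two values (or normal derivatives) of `ψ⁰` add up to
  -- twice one of them, so that the data of the error are those of the odd function
  -- `u_o - u⁰ + 2θψ⁰`.
  refine isOddEven_of_odd (D := HDelta.comb 1 uo (-1) (HDelta.comb 1 V (-(2 * θ)) S)) ?_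
    (fun i => huo.lap_err (hv' i).1) (fun i => huo.outerTrace_err (hv' i).2.1)
    (fun i φ hφ => ?_) fun i φ hφ => ?_
  · filter_upwards [huo'] with p hp
    simp only [HDelta.comb, H1.comb, hp, hV, hS]
    ring
  · have e1 : pairY ((HDelta.comb 1 uo (-1) (HDelta.comb 1 V (-(2 * θ)) S)).loc i).toH1 φ =
        1 * pairY (uo.toH1.loc i) φ + -1 * (1 * pairY (V.loc i).toH1 φ +
          -(2 * θ) * pairY (S.loc i).toH1 φ) := by
      rw [← pairY_comb hφ, ← pairY_comb hφ]
      rfl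
    have hadd : pairY (S.loc i).toH1 φ + pairY (S.loc (nbY i)).toH1 φ = 0 :=
      pairY_loc_add S.toH1 i hφ
    rw [pairY_err uo v i hφ, (hv' i).2.2.1 φ hφ, e1, pairY_congr (isOpen_sub i) (hu' i),
      pairY_congr (isOpen_sub i) (hpsi' i), pairY_congr (isOpen_sub _) (hpsi' (nbY i))]
    linear_combination -θ * hadd
  · have e1 : normalPairing ((HDelta.comb 1 uo (-1) (HDelta.comb 1 V (-(2 * θ)) S)).loc i) φ =
        1 * normalPairing (uo.loc i) φ + -1 * (1 * normalPairing (V.loc i) φ +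
          -(2 * θ) * normalPairing (S.loc i) φ) := by
      rw [← normalPairing_comb hφ, ← normalPairing_comb hφ]
      rfl
    rw [normalPairing_err uo v i hφ, (hv' i).2.2.2 φ hφ, e1,
      normalPairing_congr (isOpen_sub i) (hu' i),
      normalPairing_congr (isOpen_sub i) (hpsi' i),
      normalPairing_congr (isOpen_sub _) (hpsi' (nbX i))]
    linear_combination -θ * normalPairing_loc_addX S i hφ

end Propagation

/-! ### Error norms -/

lemma err_eqv {uo : HDelta Omega} {u v : ∀ i : Fin 4, HDelta (sub i)} {c : ℝ} {i : Fin 4}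
    (h : ∀ᵐ p ∂volume.restrict (sub i), (err uo u i).val p = c * (err uo v i).val p) :
    ∀ᵐ p ∂volume.restrict (sub i), uo.val p - (u i).val p = c * (uo.val p - (v i).val p) ∧
      uo.dx p - (u i).dx p = c * (uo.dx p - (v i).dx p) ∧
      uo.dy p - (u i).dy p = c * (uo.dy p - (v i).dy p) := by
  have h1 := H1.Eqv.of_val (isOpen_sub i) (ae_eq_comb_zero h)
  filter_upwards [h1.val, h1.dx, h1.dy] with p e1 e2 e3
  simp only [err, HDelta.comb, H1.comb, HDelta.loc, HDelta.res, H1.res] at e1 e2 e3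
  refine ⟨?_, ?_, ?_⟩ <;> linarith

lemma errL2_eq {uo : HDelta Omega} {u v : ∀ i : Fin 4, HDelta (sub i)} {c : ℝ}
    (h : ∀ i, ∀ᵐ p ∂volume.restrict (sub i), (err uo u i).val p = c * (err uo v i).val p) :
    errL2 uo.toH1 u = |c| * errL2 uo.toH1 v := by
  rw [errL2, errL2, ← Real.sqrt_sq_eq_abs, ← Real.sqrt_mul (sq_nonneg c), Finset.mul_sum]
  congr 1
  refine Finset.sum_congr rfl fun i _ => ?_
  rw [← integral_const_mul]
  refine integral_congr_ae ?_
  filter_upwards [err_eqv (h i)] with p hp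
  rw [hp.1]
  ring

lemma errH1_eq {uo : HDelta Omega} {u v : ∀ i : Fin 4, HDelta (sub i)} {c : ℝ}
    (h : ∀ i, ∀ᵐ p ∂volume.restrict (sub i), (err uo u i).val p = c * (err uo v i).val p) :
    errH1 uo.toH1 u = |c| * errH1 uo.toH1 v := by
  rw [errH1, errH1, Finset.mul_sum]
  refine Finset.sum_congr rfl fun i _ => ?_
  rw [← Real.sqrt_sq_eq_abs, ← Real.sqrt_mul (sq_nonneg c), ← integral_const_mul]
  congr 1
  refine integral_congr_ae ?_
  filter_upwards [err_eqv (h i)] with p hp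
  rw [hp.1, hp.2.1, hp.2.2]
  ring

lemma tendsto_zero_of_geometric {N : ℕ → ℝ} {c : ℝ} (hc0 : 0 ≤ c) (hc : c < 1)
    (h : ∀ k, 1 ≤ k → N k = c ^ (k - 1) * N 1) : Tendsto N atTop (𝓝 0) := by
  have h1 : Tendsto (fun k : ℕ => c ^ (k - 1) * N 1) atTop (𝓝 (0 * N 1)) :=
    ((tendsto_pow_atTop_nhds_zero_of_lt_one hc0 hc).comp (tendsto_sub_atTop_nat 1)).mul_const _
  rw [zero_mul] at h1
  refine h1.congr' ?_
  filter_upwards [eventually_ge_atTop 1] with k hk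
  exact (h k hk).symm

lemma mem_frontier_skeleton {a : ℝ} (ha : a = 1 ∨ a = -1) :
    ((a, 0) : ℝ × ℝ) ∈ frontier Omega ∩ skeleton := by
  have h1 : ((a, 0) : ℝ × ℝ) ∈ closure Omega := by
    rw [closure_Omega]
    rcases ha with rfl | rfl <;> norm_num
  refine ⟨⟨h1, fun h => ?_⟩, h1, Or.inr rfl⟩
  rw [isOpen_Omega.interior_eq] at h
  rcases ha with rfl | rfl
  · exact lt_irrefl _ h.1.2
  · exact lt_irrefl _ h.1.1

end MixedNNM

end

theorem theorem4 (f g : ℝ × ℝ → ℝ) (hf : MemLp f 2 (volume.restrict MixedNNM.Omega))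
    (hg : MixedNNM.MemH32 g)
    (u0 psi0 : MixedNNM.H1 MixedNNM.Omega) (h0 : MixedNNM.Compatible g u0 psi0)
    (uo : MixedNNM.HDelta MixedNNM.Omega)
    (huo : MixedNNM.SolvesDirichlet (MixedNNM.oddPart f) (MixedNNM.oddPart g) uo)
    (θ : ℝ) (hθ : θ ∈ Ioo (0 : ℝ) (1 / 2)) :
    -- the method produces a sequence
    (∃ u psi : ℕ → ∀ i : Fin 4, MixedNNM.HDelta (MixedNNM.sub i),
      MixedNNM.IsMixedNNM (MixedNNM.oddPart f) (MixedNNM.oddPart g) θ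
        (MixedNNM.oddPart u0.val) (MixedNNM.oddPart psi0.val) u psi) ∧
    ∀ u psi : ℕ → ∀ i : Fin 4, MixedNNM.HDelta (MixedNNM.sub i),
      MixedNNM.IsMixedNNM (MixedNNM.oddPart f) (MixedNNM.oddPart g) θ
        (MixedNNM.oddPart u0.val) (MixedNNM.oddPart psi0.val) u psi →
      -- every local problem has a unique solution
      (∀ k i, ∀ w : MixedNNM.HDelta (MixedNNM.sub i),
        MixedNNM.FirstStep (MixedNNM.oddPart f) (MixedNNM.oddPart g) θ (u k) (psi k) i w →
        w.val =ᵐ[volume.restrict (MixedNNM.sub i)] (u (k + 1) i).val) ∧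
      (∀ k i, ∀ w : MixedNNM.HDelta (MixedNNM.sub i),
        MixedNNM.SecondStep (u (k + 1)) i w →
        w.val =ᵐ[volume.restrict (MixedNNM.sub i)] (psi (k + 1) i).val) ∧
      -- the error is multiplied by `1 - 4θ` in every iteration
      (∀ k, 1 ≤ k → ∀ i, ∀ᵐ p ∂volume.restrict (MixedNNM.sub i),
        uo.val p - (u k i).val p = (1 - 4 * θ) ^ (k - 1) * (uo.val p - (u 1 i).val p)) ∧
      -- geometric convergence with factor `|1 - 4θ| < 1` in both norms
      |1 - 4 * θ| < 1 ∧
      (∀ k, 1 ≤ k → MixedNNM.errL2 uo.toH1 (u k) =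
        |1 - 4 * θ| ^ (k - 1) * MixedNNM.errL2 uo.toH1 (u 1)) ∧
      (∀ k, 1 ≤ k → MixedNNM.errH1 uo.toH1 (u k) =
        |1 - 4 * θ| ^ (k - 1) * MixedNNM.errH1 uo.toH1 (u 1)) ∧
      Tendsto (fun k => MixedNNM.errL2 uo.toH1 (u k)) atTop (𝓝 0) ∧
      Tendsto (fun k => MixedNNM.errH1 uo.toH1 (u k)) atTop (𝓝 0) ∧
      -- direct solver for `θ = 1/4`
      (θ = 1 / 4 → ∀ k, 2 ≤ k → ∀ i,
        (u k i).val =ᵐ[volume.restrict (MixedNNM.sub i)] uo.val) := by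
  open MixedNNM in
  obtain ⟨G, hG2, hGc, hGg⟩ := hg
  obtain ⟨hu2, huc, hs2, hs0, hcomp⟩ := h0
  obtain ⟨V, hV⟩ := hu2.odd.exists_hDelta
  obtain ⟨S, hS⟩ := hs2.odd.exists_hDelta
  have hVval : V.val = oddPart u0.val := by rw [hV, H1.odd_val]
  have hSval : S.val = oddPart psi0.val := by rw [hS, H1.odd_val]
  have hS0 : HasOuterTrace univ S.toH1 0 := by
    rw [hS]
    exact hs0.comb_zero (hs0.pull isFlip_Omega isFlip_univ) _ _
  refine ⟨?_, fun u psi ⟨hu0, hpsi0, hstep⟩ => ?_⟩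
  · obtain ⟨Gx, -, hGx, -⟩ := hG2.odd
    obtain ⟨ux, -, hux, -⟩ := hu2.odd
    have hG : ∀ p ∈ frontier Omega, G.odd.val p = oddPart g p := fun p hp => by
      rw [H1.odd_val, oddPart, oddPart, hGg p hp, hGg _ (neg_mem_frontier_Omega hp)]
    have hu : ∀ p ∈ frontier Omega ∩ skeleton, u0.val p = G.val p := fun p hp =>
      (hcomp p hp).trans (hGg p hp.1).symm
    have hpt : ∀ a : ℝ, (a = 1 ∨ a = -1) → u0.odd.val (a, 0) = G.odd.val (a, 0) := fun a ha => by
      have ha' : -a = 1 ∨ -a = -1 := by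
        rcases ha with rfl | rfl <;> norm_num
      rw [H1.odd_val, H1.odd_val, oddPart, oddPart, Prod.neg_mk, neg_zero,
        hu _ (mem_frontier_skeleton ha), hu _ (mem_frontier_skeleton ha')]
    obtain ⟨l, hl, hlu⟩ := exists_lift G.odd u0.odd Gx ux hGx hux
      (by rw [H1.odd_val]; exact continuousOn_oddPart hGc)
      (by rw [H1.odd_val]; exact continuousOn_oddPart huc) (hpt _ (Or.inr rfl))
      (hpt _ (Or.inl rfl)) hG
    obtain ⟨u, psi, hu0, hpsi0, h⟩ := exists_isMixedNNM (u := fun i => V.loc i)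
      (psi := fun i => S.loc i) (memLp_oddPart hf) huo θ
      (fun i => ⟨l.loc i, hl.loc i, fun φ hφ => (hlu i φ hφ).trans (by rw [← hV]; rfl)⟩)
      fun i => hS0.loc i
    refine ⟨u, psi, fun i => ?_, fun i => ?_, h⟩
    · rw [hu0, ← hVval]
      exact ae_eq_refl _
    · rw [hpsi0, ← hSval]
      exact ae_eq_refl _
  · have hlap : ∀ k i, ∀ᵐ p ∂volume.restrict (sub i), -(u (k + 1) i).lap p = oddPart f p :=
      fun k i => (hstep k i).1.1
    have hO : ∀ k i, HasOuterTrace (quadrant i) (u (k + 1) i).toH1 (oddPart g) :=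
      fun k i => (hstep k i).1.2.1
    have hodd : ∀ (h : ℝ × ℝ → ℝ) p,
        oddPart h (MixedNNM.flip (-1) (-1) p) = -oddPart h p := fun h p => by
      rw [flip_neg_neg, oddPart_neg]
    -- The symmetries of the error are preserved, and they are what makes the next step a
    -- multiplication by `1 - 4θ`.
    have key : ∀ k, IsOddEven (err uo (u (k + 1))) ∧ ∀ i, ∀ᵐ p ∂volume.restrict (sub i),
        (err uo (u (k + 1)) i).val p = (1 - 4 * θ) ^ k * (err uo (u 1) i).val p := by
      intro k
      induction k with
      | zero =>
        refine ⟨isOddEven_err huo huo.odd (V := V) (S := S) (by rw [hVval]; exact hodd _)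
          (by rw [hSval]; exact hodd _) (by rw [hVval]; exact hu0) (by rw [hSval]; exact hpsi0)
          fun i => (hstep 0 i).1, fun i => Eventually.of_forall fun p => by simp⟩
      | succ k ih =>
        have h1 : ∀ i, ∀ᵐ p ∂volume.restrict (sub i),
            (err uo (u (k + 1 + 1)) i).val p = (1 - 4 * θ) * (err uo (u (k + 1)) i).val p :=
          fun i => FirstStep.err_eq huo (hlap k) (hO k) ih.1
            (fun j => (hstep k j).2.eq_err huo (hlap k) (hO k) ih.1) (hstep (k + 1) i).1
        refine ⟨ih.1.of_ae_eq h1, fun i => ?_⟩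
        filter_upwards [h1 i, ih.2 i] with p e1 e2
        rw [e1, e2]
        ring
    have key' : ∀ k, 1 ≤ k → ∀ i, ∀ᵐ p ∂volume.restrict (sub i),
        (err uo (u k) i).val p = (1 - 4 * θ) ^ (k - 1) * (err uo (u 1) i).val p := by
      intro k hk i
      obtain ⟨m, rfl⟩ := Nat.exists_eq_add_of_le' hk
      exact (key m).2 i
    have hc : |1 - 4 * θ| < 1 := by
      rw [abs_lt]
      constructor <;> linarith [hθ.1, hθ.2]
    have hL : ∀ k, 1 ≤ k → errL2 uo.toH1 (u k) = |1 - 4 * θ| ^ (k - 1) * errL2 uo.toH1 (u 1) :=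
      fun k hk => by rw [errL2_eq (key' k hk), abs_pow]
    have hH : ∀ k, 1 ≤ k → errH1 uo.toH1 (u k) = |1 - 4 * θ| ^ (k - 1) * errH1 uo.toH1 (u 1) :=
      fun k hk => by rw [errH1_eq (key' k hk), abs_pow]
    refine ⟨fun k i w hw => hw.unique (hstep k i).1, fun k i w hw => hw.unique (hstep k i).2,
      fun k hk i => ?_, hc, hL, hH, tendsto_zero_of_geometric (abs_nonneg _) hc hL,
      tendsto_zero_of_geometric (abs_nonneg _) hc hH, fun hθ4 k hk i => ?_⟩
    · filter_upwards [err_eqv (key' k hk i)] with p hp using hp.1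
    · filter_upwards [err_eqv (key' k (by omega) i)] with p hp
      have h1 := hp.1
      rw [hθ4, show (1 - 4 * (1 / 4) : ℝ) = 0 by norm_num, zero_pow (by omega), zero_mul] at h1
      linarith
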